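/- Let $SU(2)$ be the group of matrices $g=\begin{pmatrix}\alpha&-\overline\beta\\ \beta&\overline\alpha\end{pmatrix}$, $|\alpha|^2+|\beta|^2=1$, identified with the sphere $S^3$ of radius $2$, and let $\mu$ be its volume measure (the Haar measure of total mass $16\pi^2$). For $\ell\in\frac12\mathbb N$ and $m,s\in\{-\ell,-\ell+1,\dots,\ell\}$ put $\psi^\ell_m(z_0,z_1)=\binom{2\ell}{\ell+m}^{1/2}z_0^{\ell+m}z_1^{\ell-m}$, let the Wigner functions $D^\ell_{m,s}$ be defined by $\sum_{m}\psi^\ell_m(z)D^\ell_{m,s}(g)=\psi^\ell_s(g^{-1}z)$ for all $z\in\mathbb C^2$, and let $\phi^\ell_{m,s}=\frac{\sqrt{2\ell+1}}{4\pi}D^\ell_{m,s}$ be the corresponding orthonormal basis of $L^2(SU(2),\mu)$. Let $X=(X(g))_{g\in SU(2)}$ be a complex random field on a probability space $(\Omega,\mathbb P)$, jointly measurable in $(\omega,g)$ and with $X\in L^2(SU(2),\mu)$ almost surely. Let $a^\ell_{m,s}=\int X\,\overline{\phi^\ell_{m,s}}\,d\mu$ be its spectral coefficients, and let $X^0=a^0_{0,0}\phi^0_{0,0}$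 be its (constant in $g$) component of degree $0$. A complex random variable is called complex Gaussian if its real and imaginary parts are independent centred normal variables with the same, possibly zero, variance; a field $Y$ is complex Gaussian if $\sum_i c_iY(g_i)$ is complex Gaussian for all finite families $g_i\in SU(2)$, $c_i\in\mathbb C$. The field $X$ is bi-invariant if for all $g,g'\in SU(2)$ the fields $X(g^{-1}\,\cdot\,g')$ and $X(\cdot)$ have the same law (the same finite-dimensional distributions), and stochastically continuous if $X(h)\to X(g)$ in probability as $h\to g$, for every $g\in SU(2)$. Put $\operatorname{Var}a=\mathbb E|a-\mathbb E a|^2$. Assume that the random variables $a^\ell_{m,s}$ (for all $\ell,m,s$) are independent and that each of them is centrally symmetric, i.e. $-a^\ell_{m,s}$ has the same law as $a^\ell_{m,s}$. Then: (1) $X$ is bi-invariant if and only if $X$ is stochastically continuous, $X-X^0$ is a complex Gaussian field, and $\operatorname{Var}a^\ell_{m,s}$ depends only on $\ell$. (2) $X$ is bi-invariant and $a^0_{0,0}$ is complex Gaussian if and only if $X$ is stochastically continuous, $X$ is a complex Gaussian field, and $\operatorname{Var}a^\ell_{m,s}$ depends only on $\ell$. -/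

import Mathlib

open MeasureTheory ProbabilityTheory Filter Topology

noncomputable section

/-! ### The group `SU(2)`, identified with the sphere `S³` of radius `2` -/

/-- The group `SU(2)`; its elements are the matrices `h(α, β) = !![α, -conj β; β, conj α]` with
`|α|² + |β|² = 1`, so `α = g 0 0` and `β = g 1 0`. -/
abbrev SU2 : Type := Matrix.specialUnitaryGroup (Fin 2) ℂ

instance SU2.instIsTopologicalGroup : IsTopologicalGroup SU2 where
  continuous_inv :=
    Continuous.subtype_mk (continuous_star.comp continuous_subtype_val) _

instance SU2.instCompactSpace : CompactSpace SU2 := by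
  have hcl : IsClosed ((Matrix.specialUnitaryGroup (Fin 2) ℂ : Set (Matrix (Fin 2) (Fin 2) ℂ))) := by
    have : (Matrix.specialUnitaryGroup (Fin 2) ℂ : Set (Matrix (Fin 2) (Fin 2) ℂ)) =
        {A | A * star A = 1} ∩ {A | A.det = 1} := by
      ext A
      simp [Matrix.mem_specialUnitaryGroup_iff, Matrix.mem_unitaryGroup_iff]
    rw [this]
    refine IsClosed.inter (isClosed_eq ?_ continuous_const) (isClosed_eq ?_ continuous_const)
    · exact continuous_id.mul continuous_star
    · exact continuous_id.matrix_det
  have h1 : IsCompact {A : Fin 2 → Fin 2 → ℂ | ∀ i j, A i j ∈ Metric.closedBall (0 : ℂ) 1} := by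
    have h2 : IsCompact (Set.pi Set.univ
        fun _ : Fin 2 => Set.pi Set.univ fun _ : Fin 2 => Metric.closedBall (0 : ℂ) 1) :=
      isCompact_univ_pi fun _ => isCompact_univ_pi fun _ => isCompact_closedBall _ _
    convert h2 using 1
    ext A
    simp only [Set.mem_ofPred_eq, Set.mem_pi, Set.mem_univ, forall_true_left]
  have hK : IsCompact
      {A : Matrix (Fin 2) (Fin 2) ℂ | ∀ i j, A i j ∈ Metric.closedBall (0 : ℂ) 1} := h1
  refine isCompact_iff_compactSpace.mp (hK.of_isClosed_subset hcl ?_)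
  intro A hA i j
  have hU := (Matrix.mem_specialUnitaryGroup_iff.mp hA).1
  simpa using entry_norm_bound_of_unitary hU i j

instance SU2.instMeasurableSpace : MeasurableSpace SU2 := borel SU2

instance SU2.instBorelSpace : BorelSpace SU2 := ⟨rfl⟩

/-- The volume measure of `SU(2)` as the round `3`-sphere of radius `2`: the Haar measure of total
mass `16 π²`. -/
def sphereVolume : Measure SU2 :=
  ENNReal.ofReal (16 * Real.pi ^ 2) • Measure.haarMeasure (⊤ : TopologicalSpace.PositiveCompacts SU2)

/-! ### Wigner functions and hyperspherical harmonics

A triple `(ℓ, m, s)` with `ℓ ∈ ½ℕ` and `m, s ∈ {-ℓ, -ℓ + 1, …, ℓ}` is encoded by `n = 2ℓ : ℕ` and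
`i = ℓ + m`, `j = ℓ + s` in `Fin (n + 1)`. -/

/-- The set of all triples `(ℓ, m, s)`. -/
abbrev WignerIndex : Type := Σ n : ℕ, Fin (n + 1) × Fin (n + 1)

/-- The rescaled monomial `ψ^ℓ_m(z₀, z₁) = (2ℓ choose ℓ+m)^{1/2} z₀^{ℓ+m} z₁^{ℓ-m}`. -/
def rescaledMonomial (n : ℕ) (i : Fin (n + 1)) (z₀ z₁ : ℂ) : ℂ :=
  (Real.sqrt (n.choose i) : ℂ) * z₀ ^ (i : ℕ) * z₁ ^ (n - (i : ℕ))

/-- `(ᾱ z₀ + β̄ z₁)^{ℓ+s} (-β z₀ + α z₁)^{ℓ-s}` at `z₁ = 1`, as a polynomial in `z₀`. -/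
def wignerPoly (n : ℕ) (j : Fin (n + 1)) (g : SU2) : Polynomial ℂ :=
  (Polynomial.C (star (g.1 0 0)) * Polynomial.X + Polynomial.C (star (g.1 1 0))) ^ (j : ℕ) *
    (Polynomial.C (-(g.1 1 0)) * Polynomial.X + Polynomial.C (g.1 0 0)) ^ (n - (j : ℕ))

/-- The Wigner function `D^ℓ_{m,s} : SU(2) → ℂ`, that is, the matrix coefficient of the action of
`SU(2)` on homogeneous polynomials of degree `2ℓ` in the basis `ψ^ℓ_m`
(see `sum_rescaledMonomial_mul_wignerD`). -/
def wignerD (n : ℕ) (i j : Fin (n + 1)) (g : SU2) : ℂ :=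
  (Real.sqrt (n.choose j) / Real.sqrt (n.choose i) : ℝ) * (wignerPoly n j g).coeff i

/-- The defining identity of the Wigner functions:
`∑_m ψ^ℓ_m(z) D^ℓ_{m,s}(g) = ψ^ℓ_s(g⁻¹ z)`. -/
theorem sum_rescaledMonomial_mul_wignerD (n : ℕ) (j : Fin (n + 1)) (g : SU2) (z₀ z₁ : ℂ) :
    ∑ i, rescaledMonomial n i z₀ z₁ * wignerD n i j g =
      rescaledMonomial n j ((g⁻¹).1.mulVec ![z₀, z₁] 0) ((g⁻¹).1.mulVec ![z₀, z₁] 1) := by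
  have hinv : (g⁻¹).1 = star g.1 := rfl
  have hadj : star g.1 = Matrix.adjugate g.1 := by
    have h1 := Matrix.mem_specialUnitaryGroup_iff.mp g.2
    have h2 : star g.1 * g.1 = 1 := Matrix.mem_unitaryGroup_iff'.mp h1.1
    have h3 : g.1 * Matrix.adjugate g.1 = 1 := by rw [Matrix.mul_adjugate, h1.2, one_smul]
    exact left_inv_eq_right_inv h2 h3
  have e0 : (g⁻¹).1.mulVec ![z₀, z₁] 0 = star (g.1 0 0) * z₀ + star (g.1 1 0) * z₁ := by
    rw [hinv]; simp [Matrix.mulVec, dotProduct, Fin.sum_univ_two, Matrix.star_apply]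
  have e1 : (g⁻¹).1.mulVec ![z₀, z₁] 1 = -(g.1 1 0) * z₀ + g.1 0 0 * z₁ := by
    rw [hinv, hadj, Matrix.adjugate_fin_two]
    simp [Matrix.mulVec, dotProduct, Fin.sum_univ_two]
  rw [e0, e1]
  have hj : (j : ℕ) ≤ n := Nat.lt_succ_iff.mp j.2
  generalize ha : star (g.1 0 0) = a
  generalize hb : star (g.1 1 0) = b
  generalize hc : -(g.1 1 0) = c
  generalize hd : g.1 0 0 = d
  have hp : wignerPoly n j g = (Polynomial.C a * Polynomial.X + Polynomial.C b) ^ (j : ℕ) *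
      (Polynomial.C c * Polynomial.X + Polynomial.C d) ^ (n - (j : ℕ)) := by
    rw [wignerPoly, ha, hb, hc, hd]
  have hd1 : ((Polynomial.C a * Polynomial.X + Polynomial.C b) ^ (j : ℕ)).natDegree ≤ (j : ℕ) := by
    simpa using Polynomial.natDegree_pow_le_of_le (j : ℕ)
      (Polynomial.natDegree_linear_le (a := a) (b := b))
  have hd2 : ((Polynomial.C c * Polynomial.X + Polynomial.C d) ^ (n - (j : ℕ))).natDegree ≤
      n - (j : ℕ) := by
    simpa using Polynomial.natDegree_pow_le_of_le (n - (j : ℕ))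
      (Polynomial.natDegree_linear_le (a := c) (b := d))
  have hdeg : (wignerPoly n j g).natDegree < n + 1 := by
    rw [hp]
    refine lt_of_le_of_lt Polynomial.natDegree_mul_le ?_
    omega
  have key : ∑ i : Fin (n + 1), (wignerPoly n j g).coeff i * z₀ ^ (i : ℕ) * z₁ ^ (n - (i : ℕ)) =
      (a * z₀ + b * z₁) ^ (j : ℕ) * (c * z₀ + d * z₁) ^ (n - (j : ℕ)) := by
    rw [Fin.sum_univ_eq_sum_range
      (fun i : ℕ => (wignerPoly n j g).coeff i * z₀ ^ i * z₁ ^ (n - i)) (n + 1)]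
    by_cases hz : z₁ = 0
    · subst hz
      rw [Finset.sum_range_succ, Finset.sum_eq_zero]
      · have hcoeff : (wignerPoly n j g).coeff n = a ^ (j : ℕ) * c ^ (n - (j : ℕ)) := by
          rw [hp]
          have := Polynomial.coeff_mul_add_eq_of_natDegree_le hd1 hd2
          rw [Nat.add_sub_cancel' hj] at this
          rw [this]
          have l1 := Polynomial.coeff_pow_of_natDegree_le
            (Polynomial.natDegree_linear_le (a := a) (b := b)) (m := (j : ℕ))
          have l2 := Polynomial.coeff_pow_of_natDegree_le
            (Polynomial.natDegree_linear_le (a := c) (b := d)) (m := n - (j : ℕ))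
          simp only [mul_one] at l1 l2
          rw [l1, l2]
          simp
        rw [hcoeff]
        have : z₀ ^ n = z₀ ^ (j : ℕ) * z₀ ^ (n - (j : ℕ)) := by
          rw [← pow_add, Nat.add_sub_cancel' hj]
        simp only [Nat.sub_self, pow_zero, mul_zero, add_zero, zero_add, mul_one, this, mul_pow]
        ring
      · intro i hi
        have : n - i ≠ 0 := by have := Finset.mem_range.mp hi; omega
        simp [this]
    · have hev := Polynomial.eval_eq_sum_range' hdeg (z₀ / z₁)
      have h1 : ∑ i ∈ Finset.range (n + 1), (wignerPoly n j g).coeff i * z₀ ^ i * z₁ ^ (n - i) =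
          z₁ ^ n * (wignerPoly n j g).eval (z₀ / z₁) := by
        rw [hev, Finset.mul_sum]
        refine Finset.sum_congr rfl fun i hi => ?_
        have hi' : i ≤ n := Nat.lt_succ_iff.mp (Finset.mem_range.mp hi)
        have : z₁ ^ n = z₁ ^ i * z₁ ^ (n - i) := by rw [← pow_add, Nat.add_sub_cancel' hi']
        rw [this, div_pow]
        field_simp
      rw [h1, hp]
      have : z₁ ^ n = z₁ ^ (j : ℕ) * z₁ ^ (n - (j : ℕ)) := by
        rw [← pow_add, Nat.add_sub_cancel' hj]
      simp only [Polynomial.eval_mul, Polynomial.eval_pow, Polynomial.eval_add, Polynomial.eval_C,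
        Polynomial.eval_X]
      rw [this, mul_mul_mul_comm, ← mul_pow, ← mul_pow]
      congr 2 <;> field_simp
  have hl : ∀ i : Fin (n + 1), rescaledMonomial n i z₀ z₁ * wignerD n i j g =
      (Real.sqrt (n.choose j) : ℂ) *
        ((wignerPoly n j g).coeff i * z₀ ^ (i : ℕ) * z₁ ^ (n - (i : ℕ))) := by
    intro i
    have hpos : (0 : ℝ) < n.choose i := by
      exact_mod_cast Nat.choose_pos (Nat.lt_succ_iff.mp i.2)
    have hne : (Real.sqrt (n.choose i) : ℂ) ≠ 0 := by
      exact_mod_cast (Real.sqrt_pos.mpr hpos).ne'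
    simp only [rescaledMonomial, wignerD]
    push_cast
    field_simp
  rw [Finset.sum_congr rfl fun i _ => hl i, ← Finset.mul_sum, key, rescaledMonomial]
  ring

/-- The hyperspherical harmonics `φ^ℓ_{m,s} = √(2ℓ+1) / (4π) · D^ℓ_{m,s}`, an orthonormal basis of
`L²(SU(2))` for the measure `sphereVolume`. -/
def hypersphericalHarmonic (n : ℕ) (i j : Fin (n + 1)) (g : SU2) : ℂ :=
  (Real.sqrt (n + 1) / (4 * Real.pi) : ℝ) * wignerD n i j g

/-! ### Random fields on `SU(2)` -/

section RandomFields

variable {Ω : Type*} [MeasurableSpace Ω]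

/-- A square integrable random field: jointly measurable, with almost surely square integrable
trajectories. -/
def IsSquareIntegrableField (P : Measure Ω) (X : Ω → SU2 → ℂ) : Prop :=
  Measurable (Function.uncurry X) ∧ ∀ᵐ ω ∂P, MemLp (X ω) 2 sphereVolume

/-- The spectral coefficient `a^ℓ_{m,s} = ∫ X(g) conj (φ^ℓ_{m,s}(g)) dg`. -/
def spectralCoeff (X : Ω → SU2 → ℂ) (k : WignerIndex) (ω : Ω) : ℂ :=
  ∫ g, X ω g * star (hypersphericalHarmonic k.1 k.2.1 k.2.2 g) ∂sphereVolume

/-- The component `X^ℓ = ∑_{m,s} a^ℓ_{m,s} φ^ℓ_{m,s}` of degree `n = 2ℓ`. -/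
def degreeComponent (X : Ω → SU2 → ℂ) (n : ℕ) (ω : Ω) (g : SU2) : ℂ :=
  ∑ i : Fin (n + 1), ∑ j : Fin (n + 1),
    spectralCoeff X ⟨n, i, j⟩ ω * hypersphericalHarmonic n i j g

/-- `X(g⁻¹ · g')` and `X(·)` have the same law (as random elements of `SU2 → ℂ` with the product
`σ`-algebra, i.e. the same finite-dimensional distributions) for all `g, g'`. -/
def IsBiInvariant (P : Measure Ω) (X : Ω → SU2 → ℂ) : Prop :=
  ∀ g g' : SU2, IdentDistrib (fun ω (p : SU2) => X ω (g⁻¹ * p * g')) (fun ω (p : SU2) => X ω p) P P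

/-- `a` is centrally symmetric: `-a` has the same law as `a`. -/
def IsCentrallySymmetric (P : Measure Ω) (a : Ω → ℂ) : Prop :=
  IdentDistrib (fun ω => -a ω) a P P

/-- `a` is complex Gaussian: real and imaginary parts are independent centred normal variables with
the same variance (possibly zero). -/
def IsComplexGaussian (P : Measure Ω) (a : Ω → ℂ) : Prop :=
  AEMeasurable a P ∧ ∃ v : NNReal, P.map a =
    ((gaussianReal 0 v).prod (gaussianReal 0 v)).map fun p : ℝ × ℝ => (p.1 : ℂ) + p.2 * Complex.I

/-- `X` is a complex Gaussian field: for all points `g₁, …, g_N`, the vector `(X(g₁), …, X(g_N))` is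
complex Gaussian, i.e. all its complex linear combinations are. -/
def IsComplexGaussianField (P : Measure Ω) (X : Ω → SU2 → ℂ) : Prop :=
  ∀ (N : ℕ) (g : Fin N → SU2) (c : Fin N → ℂ), IsComplexGaussian P fun ω => ∑ i, c i * X ω (g i)

/-- `X` is stochastically continuous (continuous in probability at every point). -/
def IsStochasticallyContinuous (P : Measure Ω) (X : Ω → SU2 → ℂ) : Prop :=
  ∀ g : SU2, TendstoInMeasure P (fun h ω => X ω h) (𝓝 g) (fun ω => X ω g)

/-- `Var a = E |a - E a|²`, as an extended nonnegative real number. -/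
def complexVariance (P : Measure Ω) (a : Ω → ℂ) : ENNReal :=
  ∫⁻ ω, ‖a ω - ∫ ω', a ω' ∂P‖ₑ ^ 2 ∂P

/-- The variance of `a^ℓ_{m,s}` depends only on `ℓ`. -/
def VarianceDependsOnlyOnDegree (P : Measure Ω) (X : Ω → SU2 → ℂ) : Prop :=
  ∃ v : ℕ → ENNReal, ∀ k : WignerIndex, complexVariance P (spectralCoeff X k) = v k.1

end RandomFields

end

/-! Translations of the field act on its coefficients of degree `n` by unitary matrices: a left
translation by the conjugate Wigner matrix on the first index, a right translation by the Wigner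
matrix on the second. The theorem thus becomes a statement about independent symmetric variables
whose joint law is invariant under these matrices.

Invariance forces Gaussianity. Along a one-parameter subgroup the Wigner matrix mixes, to first
order, only neighbouring indices. Differentiating the expectation of a product of two sines, of real
linear forms in two neighbouring coordinates `x j` and `x k`, gives a functional equation between
their characteristic functions in which the variables separate. Both therefore solve the same
Gaussian differential equation (`isCircularGaussianCharFun_of_linkedByRotations`). No moments are
assumed, so everything is multiplied by `exp (-ε ‖x‖ ^ 2)`, which is invariant under unitary
matrices and factors over the coordinates, and `ε` tends to `0` at the end. Passing from neighbour
to neighbour equalizes the laws within a degree. In degree `0` there is no neighbour, and this is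
why the constant component is exceptional.

Conversely, independent circular Gaussian variables of equal variance have a unitarily invariant
joint law (`identDistrib_of_unitary`).

Two bridges join field and coefficients. Coefficients are limits of averages along one deterministic
sequence of points, by the strong law of large numbers, so the law of the field determines theirs
(`identDistrib_spectralCoeff`). In the other direction the harmonics are complete, by recurrences
and Stone–Weierstrass, so the field is recovered almost everywhere from its coefficients, and
everywhere by stochastic continuity (`identDistrib_of_spectralCoeff`). Stochastic continuity itself
follows from invariance by averaging over the group and using the continuity of translations in
`L²`. -/

noncomputable section

/-! ### Algebra of the Wigner functions -/

lemma sqrt_choose_pos {n : ℕ} (i : Fin (n + 1)) : 0 < Real.sqrt (n.choose i) :=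
  Real.sqrt_pos.mpr (by exact_mod_cast Nat.choose_pos (Nat.lt_succ_iff.mp i.2))

lemma sqrt_choose_ne_zero {n : ℕ} (i : Fin (n + 1)) : (Real.sqrt (n.choose i) : ℂ) ≠ 0 := by
  exact_mod_cast (sqrt_choose_pos i).ne'

/-- At `z₁ = 1` the difference of the two sides is a polynomial in `z₀` whose coefficients are
nonzero multiples of `x i - y i`. The group laws of the Wigner functions are proved by comparing
generating identities through this lemma. -/
lemma rescaledMonomial_ext {n : ℕ} {x y : Fin (n + 1) → ℂ}
    (h : ∀ z₀ z₁, ∑ i, rescaledMonomial n i z₀ z₁ * x i = ∑ i, rescaledMonomial n i z₀ z₁ * y i) :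
    x = y := by
  have key : (∑ i : Fin (n + 1), Polynomial.C ((Real.sqrt (n.choose i) : ℂ) * (x i - y i)) *
      Polynomial.X ^ (i : ℕ)) = 0 := by
    refine Polynomial.funext fun z => ?_
    have := h z 1
    simp only [rescaledMonomial, one_pow, mul_one] at this
    simp only [Polynomial.eval_finsetSum, Polynomial.eval_mul, Polynomial.eval_C,
      Polynomial.eval_pow, Polynomial.eval_X, Polynomial.eval_zero]
    rw [← sub_eq_zero.mpr this, ← Finset.sum_sub_distrib]
    exact Finset.sum_congr rfl fun i _ => by ring
  funext i
  have hc := congrArg (fun p => Polynomial.coeff p (i : ℕ)) key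
  simp only [Polynomial.finsetSum_coeff, Polynomial.coeff_C_mul, Polynomial.coeff_X_pow,
    Polynomial.coeff_zero] at hc
  rw [Finset.sum_eq_single i (fun k _ hk => by
    rw [if_neg fun h => hk (Fin.ext h.symm), mul_zero]) (by simp)] at hc
  simp only [if_true, mul_one, mul_eq_zero, sqrt_choose_ne_zero, false_or] at hc
  exact sub_eq_zero.mp hc

lemma wignerD_mul (n : ℕ) (i j : Fin (n + 1)) (g h : SU2) :
    wignerD n i j (g * h) = ∑ k, wignerD n i k g * wignerD n k j h := by
  revert i
  rw [← funext_iff]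
  refine rescaledMonomial_ext fun z₀ z₁ => ?_
  have e : (fun i : Fin 2 => (![(g⁻¹).1.mulVec ![z₀, z₁] 0, (g⁻¹).1.mulVec ![z₀, z₁] 1]) i) =
      (g⁻¹).1.mulVec ![z₀, z₁] := by
    funext i; fin_cases i <;> rfl
  have e1 : ((g * h)⁻¹).1.mulVec ![z₀, z₁] =
      (h⁻¹).1.mulVec ![(g⁻¹).1.mulVec ![z₀, z₁] 0, (g⁻¹).1.mulVec ![z₀, z₁] 1] := by
    rw [mul_inv_rev, Submonoid.coe_mul, ← Matrix.mulVec_mulVec]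
    exact congrArg _ e.symm
  rw [sum_rescaledMonomial_mul_wignerD, e1, ← sum_rescaledMonomial_mul_wignerD]
  simp_rw [← sum_rescaledMonomial_mul_wignerD, Finset.mul_sum, Finset.sum_mul]
  rw [Finset.sum_comm]
  exact Finset.sum_congr rfl fun k _ => Finset.sum_congr rfl fun l _ => by ring

/-- The binomial theorem; the square roots in the rescaled monomials are there for this identity,
from which unitarity follows. -/
lemma sum_rescaledMonomial_mul_rescaledMonomial (n : ℕ) (z₀ z₁ w₀ w₁ : ℂ) :
    ∑ i, rescaledMonomial n i z₀ z₁ * rescaledMonomial n i w₀ w₁ = (z₀ * w₀ + z₁ * w₁) ^ n := by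
  rw [add_pow, ← Fin.sum_univ_eq_sum_range
    (fun i => (z₀ * w₀) ^ i * (z₁ * w₁) ^ (n - i) * (n.choose i : ℂ)) (n + 1)]
  refine Finset.sum_congr rfl fun i _ => ?_
  have : (Real.sqrt (n.choose i) : ℂ) * (Real.sqrt (n.choose i) : ℂ) = (n.choose i : ℂ) := by
    rw [← Complex.ofReal_mul, Real.mul_self_sqrt (Nat.cast_nonneg _)]; simp
  simp only [rescaledMonomial, mul_pow]
  rw [← this]
  ring

lemma star_rescaledMonomial (n : ℕ) (i : Fin (n + 1)) (z₀ z₁ : ℂ) :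
    star (rescaledMonomial n i z₀ z₁) = rescaledMonomial n i (star z₀) (star z₁) := by
  simp [rescaledMonomial]

/-- Both sides are paired with monomials in `z` and in `w`. The reproducing identity reduces the
claim to moving `g` across the bilinear form `z₀ * w₀ + z₁ * w₁`, where it becomes the transpose. -/
lemma wignerD_inv (n : ℕ) (i j : Fin (n + 1)) (g : SU2) :
    wignerD n i j g⁻¹ = star (wignerD n j i g) := by
  suffices h : ∀ i, (fun j => wignerD n i j g⁻¹) = fun j => star (wignerD n j i g) from
    congrFun (h i) j
  suffices h : ∀ w₀ w₁ : ℂ,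
      (fun i => ∑ j, rescaledMonomial n j w₀ w₁ * wignerD n i j g⁻¹) =
        fun i => ∑ j, rescaledMonomial n j w₀ w₁ * star (wignerD n j i g) from
    fun i => rescaledMonomial_ext fun w₀ w₁ => congrFun (h w₀ w₁) i
  intro w₀ w₁
  refine rescaledMonomial_ext fun z₀ z₁ => ?_
  have hl : ∑ i, rescaledMonomial n i z₀ z₁ *
      ∑ j, rescaledMonomial n j w₀ w₁ * wignerD n i j g⁻¹ =
      ∑ j, rescaledMonomial n j (g.1.mulVec ![z₀, z₁] 0) (g.1.mulVec ![z₀, z₁] 1) *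
        rescaledMonomial n j w₀ w₁ := by
    have := fun j => sum_rescaledMonomial_mul_wignerD n j g⁻¹ z₀ z₁
    rw [inv_inv] at this
    simp_rw [← this, Finset.mul_sum, Finset.sum_mul]
    rw [Finset.sum_comm]
    exact Finset.sum_congr rfl fun k _ => Finset.sum_congr rfl fun l _ => by ring
  have hr : ∀ i, ∑ j, rescaledMonomial n j w₀ w₁ * star (wignerD n j i g) =
      rescaledMonomial n i (star ((g⁻¹).1.mulVec ![star w₀, star w₁] 0))
        (star ((g⁻¹).1.mulVec ![star w₀, star w₁] 1)) := by
    intro i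
    rw [← star_rescaledMonomial, ← sum_rescaledMonomial_mul_wignerD, star_sum]
    refine Finset.sum_congr rfl fun k _ => ?_
    rw [star_mul', star_rescaledMonomial, star_star, star_star]
  simp_rw [hl, hr, sum_rescaledMonomial_mul_rescaledMonomial]
  congr 1
  have hinv : (g⁻¹).1 = star g.1 := rfl
  rw [hinv]
  simp [Matrix.mulVec, dotProduct, Fin.sum_univ_two, Matrix.star_apply]
  ring

lemma wignerD_one (n : ℕ) (i j : Fin (n + 1)) : wignerD n i j 1 = if i = j then 1 else 0 := by
  revert i
  rw [← funext_iff]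
  refine rescaledMonomial_ext fun z₀ z₁ => ?_
  rw [sum_rescaledMonomial_mul_wignerD]
  simp

lemma wignerD_zero (i j : Fin 1) (g : SU2) : wignerD 0 i j g = 1 := by
  have hi : i = 0 := Subsingleton.elim _ _
  have hj : j = 0 := Subsingleton.elim _ _
  subst hi hj
  simp [wignerD, wignerPoly]

lemma sum_star_wignerD_mul (n : ℕ) (i j : Fin (n + 1)) (g : SU2) :
    ∑ k, star (wignerD n k i g) * wignerD n k j g = if i = j then 1 else 0 := by
  simp_rw [← wignerD_inv]
  rw [← wignerD_mul, inv_mul_cancel, wignerD_one]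

lemma continuous_coeff_mul {T : Type*} [TopologicalSpace T] {p q : T → Polynomial ℂ}
    (hp : ∀ i, Continuous fun t => (p t).coeff i) (hq : ∀ i, Continuous fun t => (q t).coeff i)
    (i : ℕ) : Continuous fun t => (p t * q t).coeff i := by
  simp_rw [Polynomial.coeff_mul]
  exact continuous_finsetSum _ fun k _ => (hp _).mul (hq _)

lemma continuous_coeff_pow {T : Type*} [TopologicalSpace T] {p : T → Polynomial ℂ}
    (hp : ∀ i, Continuous fun t => (p t).coeff i) (m : ℕ) :
    ∀ i, Continuous fun t => (p t ^ m).coeff i := by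
  induction m with
  | zero => intro i; simp only [pow_zero]; exact continuous_const
  | succ m ih => simp_rw [pow_succ]; exact continuous_coeff_mul ih hp

lemma continuous_coeff_linear {T : Type*} [TopologicalSpace T] {a b : T → ℂ}
    (ha : Continuous a) (hb : Continuous b) (i : ℕ) :
    Continuous fun t => (Polynomial.C (a t) * Polynomial.X + Polynomial.C (b t)).coeff i := by
  simp only [Polynomial.coeff_add, Polynomial.coeff_C_mul, Polynomial.coeff_C]
  refine (ha.mul continuous_const).add ?_
  split_ifs
  exacts [hb, continuous_const]

lemma SU2.continuous_entry (i j : Fin 2) : Continuous fun g : SU2 => g.1 i j :=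
  continuous_subtype_val.matrix_elem i j

lemma continuous_wignerPoly_coeff (n : ℕ) (j : Fin (n + 1)) (i : ℕ) :
    Continuous fun g => (wignerPoly n j g).coeff i := by
  have h0 := SU2.continuous_entry 0 0
  have h1 := SU2.continuous_entry 1 0
  exact continuous_coeff_mul
    (continuous_coeff_pow (continuous_coeff_linear h0.star h1.star) _)
    (continuous_coeff_pow (continuous_coeff_linear h1.neg h0) _) i

lemma continuous_wignerD (n : ℕ) (i j : Fin (n + 1)) : Continuous (wignerD n i j) :=
  continuous_const.mul (continuous_wignerPoly_coeff n j i)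

lemma continuous_hypersphericalHarmonic (n : ℕ) (i j : Fin (n + 1)) :
    Continuous (hypersphericalHarmonic n i j) :=
  continuous_const.mul (continuous_wignerD n i j)

/-! ### One-parameter subgroups -/

/-- The curve `t ↦ h(cos t, κ sin t)` in `SU(2)`, for `|κ| = 1`. -/
def SU2.rotation (κ : ℂ) (hκ : star κ * κ = 1) (t : ℝ) : SU2 :=
  ⟨!![(Real.cos t : ℂ), -(star κ * Real.sin t); κ * Real.sin t, (Real.cos t : ℂ)], by
    have hcs : (Real.cos t : ℂ) * Real.cos t + (Real.sin t : ℂ) * Real.sin t = 1 := by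
      have := Real.cos_sq_add_sin_sq t
      rw [pow_two, pow_two] at this
      exact_mod_cast this
    rw [Matrix.mem_specialUnitaryGroup_iff, Matrix.mem_unitaryGroup_iff]
    constructor
    · have e : star κ * (Real.sin t) * (κ * Real.sin t) = (Real.sin t : ℂ) * Real.sin t := by
        linear_combination (Real.sin t : ℂ) * Real.sin t * hκ
      ext i j
      have h1 : (starRingEnd ℂ) κ * κ = 1 := hκ
      fin_cases i <;> fin_cases j <;>
        simp [Matrix.mul_apply, Fin.sum_univ_two, Matrix.star_apply, -Complex.ofReal_cos,
          -Complex.ofReal_sin]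
      · linear_combination (Real.sin t : ℂ) * Real.sin t * h1 + hcs
      · ring
      · ring
      · linear_combination (Real.sin t : ℂ) * Real.sin t * h1 + hcs
    · rw [Matrix.det_fin_two_of]
      linear_combination (Real.sin t : ℂ) * Real.sin t * hκ + hcs⟩

lemma SU2.rotation_zero (κ : ℂ) (hκ : star κ * κ = 1) : SU2.rotation κ hκ 0 = 1 := by
  apply Subtype.ext
  ext i j
  fin_cases i <;> fin_cases j <;> simp [SU2.rotation]

lemma hasDerivAt_coeff_mul {p q : ℝ → Polynomial ℂ} {p' q' : Polynomial ℂ} {t : ℝ}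
    (hp : ∀ i, HasDerivAt (fun t => (p t).coeff i) (p'.coeff i) t)
    (hq : ∀ i, HasDerivAt (fun t => (q t).coeff i) (q'.coeff i) t) (i : ℕ) :
    HasDerivAt (fun t => (p t * q t).coeff i) ((p' * q t + p t * q').coeff i) t := by
  simp_rw [Polynomial.coeff_add, Polynomial.coeff_mul, ← Finset.sum_add_distrib]
  exact HasDerivAt.fun_sum fun k _ => (hp _).mul (hq _)

lemma hasDerivAt_coeff_pow {p : ℝ → Polynomial ℂ} {p' : Polynomial ℂ} {t : ℝ}
    (hp : ∀ i, HasDerivAt (fun t => (p t).coeff i) (p'.coeff i) t) (m : ℕ) :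
    ∀ i, HasDerivAt (fun t => (p t ^ m).coeff i)
      ((Polynomial.C (m : ℂ) * p' * p t ^ (m - 1)).coeff i) t := by
  induction m with
  | zero => intro i; simpa using hasDerivAt_const t ((1 : Polynomial ℂ).coeff i)
  | succ m ih =>
    intro i
    have h := hasDerivAt_coeff_mul ih hp i
    simp_rw [pow_succ]
    convert h using 2
    rcases m with _ | m
    · simp
    · simp only [Nat.add_sub_cancel, pow_succ]
      push_cast
      simp only [map_add, map_one, map_natCast]
      ring

lemma hasDerivAt_coeff_linear {a b : ℝ → ℂ} {a' b' : ℂ} {t : ℝ}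
    (ha : HasDerivAt a a' t) (hb : HasDerivAt b b' t) (i : ℕ) :
    HasDerivAt (fun t => (Polynomial.C (a t) * Polynomial.X + Polynomial.C (b t)).coeff i)
      ((Polynomial.C a' * Polynomial.X + Polynomial.C b').coeff i) t := by
  simp only [Polynomial.coeff_add, Polynomial.coeff_C_mul, Polynomial.coeff_C]
  refine (ha.mul_const _).add ?_
  split_ifs
  exacts [hb, hasDerivAt_const _ _]

/-- The derivative at `t = 0` of the Wigner matrix along `SU2.rotation κ`. -/
def wignerGenerator (n : ℕ) (κ : ℂ) (i j : Fin (n + 1)) : ℂ :=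
  (Real.sqrt (n.choose j) / Real.sqrt (n.choose i) : ℝ) *
    ((if (i : ℕ) + 1 = j then star κ * j else 0) - if (i : ℕ) = j + 1 then κ * (n - j) else 0)

lemma hasDerivAt_wignerD_rotation (n : ℕ) (κ : ℂ) (hκ : star κ * κ = 1) (i j : Fin (n + 1)) :
    HasDerivAt (fun t => wignerD n i j (SU2.rotation κ hκ t)) (wignerGenerator n κ i j) 0 := by
  refine HasDerivAt.const_mul _ ?_
  have hc : HasDerivAt (fun t : ℝ => (Real.cos t : ℂ)) 0 0 := by
    have := (Real.hasDerivAt_cos 0).ofReal_comp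
    simpa using this
  have hs : HasDerivAt (fun t : ℝ => (Real.sin t : ℂ)) 1 0 := by
    have := (Real.hasDerivAt_sin 0).ofReal_comp
    simpa using this
  have e0 : ∀ t, (SU2.rotation κ hκ t).1 0 0 = Real.cos t := fun t => rfl
  have e1 : ∀ t, (SU2.rotation κ hκ t).1 1 0 = κ * Real.sin t := fun t => rfl
  have hc' : ∀ t : ℝ, star (Real.cos t : ℂ) = Real.cos t := fun t => Complex.conj_ofReal _
  have hs' : ∀ t : ℝ, star (κ * Real.sin t : ℂ) = star κ * Real.sin t := fun t => by
    rw [star_mul']; exact congrArg _ (Complex.conj_ofReal _)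
  have h := hasDerivAt_coeff_mul
    (hasDerivAt_coeff_pow (hasDerivAt_coeff_linear hc (hs.const_mul (star κ))) (j : ℕ))
    (hasDerivAt_coeff_pow (hasDerivAt_coeff_linear (hs.const_mul κ).neg hc) (n - (j : ℕ))) i
  simp only [wignerPoly, e0, e1, hc', hs']
  have hj : (j : ℕ) ≤ n := Nat.lt_succ_iff.mp j.2
  refine h.congr_deriv ?_
  simp only [Pi.neg_apply, Real.cos_zero, Real.sin_zero, Complex.ofReal_one, Complex.ofReal_zero, mul_zero, neg_zero,
    map_zero, zero_mul, map_one, one_mul, zero_add, add_zero, mul_one, one_pow]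
  have e : Polynomial.X ^ (j : ℕ) *
      (Polynomial.C ((n - (j : ℕ) : ℕ) : ℂ) * (Polynomial.C (-κ) * Polynomial.X)) =
      Polynomial.C (-(κ * (n - j))) * Polynomial.X ^ ((j : ℕ) + 1) := by
    rw [Nat.cast_sub hj, pow_succ]
    simp only [map_neg, map_mul, map_sub]
    ring
  rw [← Polynomial.C_mul, Polynomial.coeff_add, e, Polynomial.coeff_C_mul, Polynomial.coeff_C_mul,
    Polynomial.coeff_X_pow, Polynomial.coeff_X_pow, sub_eq_add_neg]
  rcases hj0 : (j : ℕ) with _ | k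
  · simp only [Nat.cast_zero, zero_mul, zero_add]
    split_ifs <;> simp_all
  · simp only [Nat.add_sub_cancel, Nat.add_right_cancel_iff]
    split_ifs <;> ring

/-- The entry of the Wigner generator just above the diagonal, for `κ = 1`. -/
def ladderCoeff (n i : ℕ) : ℝ :=
  Real.sqrt (n.choose (i + 1)) / Real.sqrt (n.choose i) * (i + 1)

lemma ladderCoeff_pos {n i : ℕ} (h : i + 1 ≤ n) : 0 < ladderCoeff n i := by
  have h1 : 0 < Real.sqrt (n.choose (i + 1)) :=
    Real.sqrt_pos.mpr (by exact_mod_cast Nat.choose_pos h)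
  have h2 : 0 < Real.sqrt (n.choose i) :=
    Real.sqrt_pos.mpr (by exact_mod_cast Nat.choose_pos (by omega))
  unfold ladderCoeff
  positivity

lemma wignerGenerator_above {n : ℕ} (κ : ℂ) {i j : Fin (n + 1)} (h : (i : ℕ) + 1 = j) :
    wignerGenerator n κ i j = star κ * ladderCoeff n i := by
  have h' : ¬ (i : ℕ) = j + 1 := by omega
  rw [wignerGenerator, if_pos h, if_neg h', ladderCoeff, ← h]
  push_cast
  ring

/-- The generator is skew-Hermitian: `(n choose i+1) (i+1) = (n choose i) (n-i)` matches the entry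
below the diagonal with the one above. -/
lemma wignerGenerator_below {n : ℕ} (κ : ℂ) {i j : Fin (n + 1)} (h : (i : ℕ) + 1 = j) :
    wignerGenerator n κ j i = -(κ * ladderCoeff n i) := by
  have h' : ¬ (j : ℕ) + 1 = i := by omega
  have hin : (i : ℕ) + 1 ≤ n := by have := j.2; omega
  have hr : ladderCoeff n i = Real.sqrt (n.choose i) / Real.sqrt (n.choose j) * (n - i) := by
    have h1 := sqrt_choose_pos i
    have h2 := sqrt_choose_pos j
    rw [ladderCoeff, h]
    have hc := Nat.choose_succ_right_eq n i
    have hc' : (n.choose j : ℝ) * (i + 1) = n.choose i * (n - i) := by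
      rw [← h, ← Nat.cast_sub (by omega : (i : ℕ) ≤ n)]
      exact_mod_cast hc
    field_simp
    rw [Real.sq_sqrt (Nat.cast_nonneg _), Real.sq_sqrt (Nat.cast_nonneg _)]
    exact hc'
  rw [wignerGenerator, if_pos h.symm, if_neg h', hr]
  push_cast
  ring

lemma wignerGenerator_of_ne {n : ℕ} (κ : ℂ) {i j : Fin (n + 1)} (h : (i : ℕ) + 1 ≠ j)
    (h' : (i : ℕ) ≠ j + 1) : wignerGenerator n κ i j = 0 := by
  simp [wignerGenerator, h, h']

/-! ### Completeness of the hyperspherical harmonics -/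

/-- The linear span of the Wigner functions. -/
def wignerSpan : Submodule ℂ (SU2 → ℂ) :=
  Submodule.span ℂ (Set.range fun k : WignerIndex => wignerD k.1 k.2.1 k.2.2)

lemma wignerD_mem_wignerSpan (n : ℕ) (i j : Fin (n + 1)) : wignerD n i j ∈ wignerSpan :=
  Submodule.subset_span ⟨⟨n, i, j⟩, rfl⟩

/-- All coefficients of a family of polynomials lie in the span of the Wigner functions. -/
def HasWignerCoeffs (Q : SU2 → Polynomial ℂ) : Prop :=
  ∀ i, (fun g => (Q g).coeff i) ∈ wignerSpan

namespace HasWignerCoeffs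

variable {Q R : SU2 → Polynomial ℂ}

lemma add (hQ : HasWignerCoeffs Q) (hR : HasWignerCoeffs R) :
    HasWignerCoeffs fun g => Q g + R g := fun i => by
  simp only [Polynomial.coeff_add]
  exact wignerSpan.add_mem (hQ i) (hR i)

lemma sub (hQ : HasWignerCoeffs Q) (hR : HasWignerCoeffs R) :
    HasWignerCoeffs fun g => Q g - R g := fun i => by
  simp only [Polynomial.coeff_sub]
  exact wignerSpan.sub_mem (hQ i) (hR i)

lemma C_mul (x : ℂ) (hQ : HasWignerCoeffs Q) :
    HasWignerCoeffs fun g => Polynomial.C x * Q g := fun i => by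
  simp only [Polynomial.coeff_C_mul]
  exact wignerSpan.smul_mem x (hQ i)

lemma of_C_mul {x : ℂ} (hx : x ≠ 0) (hQ : HasWignerCoeffs fun g => Polynomial.C x * Q g) :
    HasWignerCoeffs Q := by
  have := hQ.C_mul x⁻¹
  simpa only [← mul_assoc, ← map_mul, inv_mul_cancel₀ hx, map_one, one_mul] using this

lemma X_mul (hQ : HasWignerCoeffs Q) : HasWignerCoeffs fun g => Polynomial.X * Q g := by
  rintro (_ | i)
  · simp only [Polynomial.coeff_X_mul_zero]
    exact wignerSpan.zero_mem
  · simpa only [Polynomial.coeff_X_mul] using hQ i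

lemma derivative (hQ : HasWignerCoeffs Q) :
    HasWignerCoeffs fun g => Polynomial.derivative (Q g) := fun i => by
  simp only [Polynomial.coeff_derivative]
  have := wignerSpan.smul_mem ((i : ℂ) + 1) (hQ (i + 1))
  refine (congrArg (· ∈ wignerSpan) (funext fun g => ?_)).mp this
  simp [mul_comm]

end HasWignerCoeffs

/-- `(ᾱ X + β̄)^p (-β X + α)^q`. -/
def wignerProd (p q : ℕ) (g : SU2) : Polynomial ℂ :=
  (Polynomial.C (star (g.1 0 0)) * Polynomial.X + Polynomial.C (star (g.1 1 0))) ^ p *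
    (Polynomial.C (-(g.1 1 0)) * Polynomial.X + Polynomial.C (g.1 0 0)) ^ q

lemma wignerPoly_eq_wignerProd (n : ℕ) (j : Fin (n + 1)) (g : SU2) :
    wignerPoly n j g = wignerProd j (n - j) g := rfl

lemma natDegree_wignerProd_le (p q : ℕ) (g : SU2) : (wignerProd p q g).natDegree ≤ p + q := by
  refine Polynomial.natDegree_mul_le.trans (add_le_add ?_ ?_)
  · exact (Polynomial.natDegree_pow_le_of_le p Polynomial.natDegree_linear_le).trans (mul_one p).le
  · exact (Polynomial.natDegree_pow_le_of_le q Polynomial.natDegree_linear_le).trans (mul_one q).le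

/-- Up to square roots of binomial coefficients, these coefficients are the Wigner functions with `n
= p + q` and `j = p`; beyond degree `p + q` they vanish. -/
lemma hasWignerCoeffs_wignerProd (p q : ℕ) : HasWignerCoeffs (wignerProd p q) := by
  intro i
  by_cases hi : i ≤ p + q
  · let i' : Fin (p + q + 1) := ⟨i, by omega⟩
    let j' : Fin (p + q + 1) := ⟨p, by omega⟩
    have hj := sqrt_choose_ne_zero j'
    have := wignerSpan.smul_mem
      ((Real.sqrt ((p + q).choose i') : ℂ) / (Real.sqrt ((p + q).choose j') : ℂ))
      (wignerD_mem_wignerSpan (p + q) i' j')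
    refine (congrArg (· ∈ wignerSpan) (funext fun g => ?_)).mp this
    have e : wignerPoly (p + q) j' g = wignerProd p q g := by
      rw [wignerPoly_eq_wignerProd]
      simp [j']
    have hi0 := sqrt_choose_ne_zero i'
    simp only [Pi.smul_apply, smul_eq_mul, wignerD, e]
    push_cast
    field_simp
    rfl
  · refine (congrArg (· ∈ wignerSpan) (funext fun g => ?_)).mp wignerSpan.zero_mem
    exact (Polynomial.coeff_eq_zero_of_natDegree_lt
      ((natDegree_wignerProd_le p q g).trans_lt (not_le.mp hi))).symm

lemma SU2.star_mul_self_add (g : SU2) :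
    star (g.1 0 0) * g.1 0 0 + star (g.1 1 0) * g.1 1 0 = 1 := by
  have h := Matrix.mem_unitaryGroup_iff'.mp (Matrix.mem_specialUnitaryGroup_iff.mp g.2).1
  have := congrFun (congrFun h 0) 0
  simpa [Matrix.mul_apply, Fin.sum_univ_two, Matrix.star_apply] using this

/-! ### Recurrences for the generating polynomials: multiplication by the matrix entries. -/

section Recurrences

variable (p q : ℕ) (g : SU2)

open Polynomial

/-- The two linear factors have determinant `|α|² + |β|² = 1`; this is the elimination of `X`
between them. -/
lemma wignerProd_det :
    C (star (g.1 0 0)) * wignerProd p (q + 1) g - C (-(g.1 1 0)) * wignerProd (p + 1) q g =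
      wignerProd p q g := by
  have h : C (star (g.1 0 0)) * C (g.1 0 0) + C (star (g.1 1 0)) * C (g.1 1 0) = 1 := by
    rw [← C_mul, ← C_mul, ← C_add, SU2.star_mul_self_add, C_1]
  simp only [wignerProd, map_neg]
  linear_combination
    ((C (star (g.1 0 0)) * X + C (star (g.1 1 0))) ^ p * (-C (g.1 1 0) * X + C (g.1 0 0)) ^ q) * h

lemma derivative_wignerProd :
    derivative (wignerProd (p + 1) (q + 1) g) =
      C ((p : ℂ) + 1) * (C (star (g.1 0 0)) * wignerProd p (q + 1) g) +
        C ((q : ℂ) + 1) * (C (-(g.1 1 0)) * wignerProd (p + 1) q g) := by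
  simp only [wignerProd, derivative_mul, derivative_pow, derivative_C, derivative_X,
    Nat.add_sub_cancel, map_add, map_neg, map_natCast, map_one, Nat.cast_add, Nat.cast_one]
  ring

lemma derivative_wignerProd_zero_right :
    derivative (wignerProd (p + 1) 0 g) =
      C ((p : ℂ) + 1) * (C (star (g.1 0 0)) * wignerProd p 0 g) := by
  simp only [wignerProd, derivative_mul, derivative_pow, derivative_C,
    derivative_X, Nat.add_sub_cancel, map_add, map_natCast, map_one, Nat.cast_add,
    Nat.cast_one, pow_zero, derivative_one]
  ring

lemma derivative_wignerProd_zero_left :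
    derivative (wignerProd 0 (q + 1) g) =
      C ((q : ℂ) + 1) * (C (-(g.1 1 0)) * wignerProd 0 q g) := by
  simp only [wignerProd, derivative_mul, derivative_pow, derivative_C,
    derivative_X, Nat.add_sub_cancel, map_add, map_natCast, map_one, Nat.cast_add,
    Nat.cast_one, pow_zero, derivative_one]
  ring

lemma wignerProd_succ_left :
    wignerProd (p + 1) q g = X * (C (star (g.1 0 0)) * wignerProd p q g) +
      C (star (g.1 1 0)) * wignerProd p q g := by
  simp only [wignerProd]; ring

lemma wignerProd_succ_right :
    wignerProd p (q + 1) g = X * (C (-(g.1 1 0)) * wignerProd p q g) +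
      C (g.1 0 0) * wignerProd p q g := by
  simp only [wignerProd]; ring

end Recurrences

lemma natCast_add_two_ne_zero (p q : ℕ) : (p : ℂ) + q + 2 ≠ 0 := by
  exact_mod_cast (by omega : p + q + 2 ≠ 0)

/-- The derivative formula and the determinant relation are two linear equations for `ᾱ W(p, q+1)`
and `-β W(p+1, q)`, where `W` is `wignerProd`. Solving them divides by `p + q + 2`. Differentiation
in `X` only shifts and rescales coefficients, so it stays in the span. -/
lemma hasWignerCoeffs_star_alpha_mul (p q : ℕ) :
    HasWignerCoeffs fun g => Polynomial.C (star (g.1 0 0)) * wignerProd p q g := by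
  rcases q with _ | q
  · refine HasWignerCoeffs.of_C_mul (Nat.cast_add_one_ne_zero p) ?_
    simp_rw [← derivative_wignerProd_zero_right]
    exact (hasWignerCoeffs_wignerProd _ _).derivative
  · refine HasWignerCoeffs.of_C_mul (natCast_add_two_ne_zero p q) ?_
    convert (hasWignerCoeffs_wignerProd (p + 1) (q + 1)).derivative.add
      ((hasWignerCoeffs_wignerProd p q).C_mul ((q : ℂ) + 1)) using 2 with g
    rw [derivative_wignerProd, ← wignerProd_det p q g]
    simp only [map_add, map_natCast, map_one, map_ofNat]
    ring

lemma hasWignerCoeffs_neg_beta_mul (p q : ℕ) :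
    HasWignerCoeffs fun g => Polynomial.C (-(g.1 1 0)) * wignerProd p q g := by
  rcases p with _ | p
  · refine HasWignerCoeffs.of_C_mul (Nat.cast_add_one_ne_zero q) ?_
    simp_rw [← derivative_wignerProd_zero_left]
    exact (hasWignerCoeffs_wignerProd _ _).derivative
  · refine HasWignerCoeffs.of_C_mul (natCast_add_two_ne_zero p q) ?_
    convert (hasWignerCoeffs_wignerProd (p + 1) (q + 1)).derivative.sub
      ((hasWignerCoeffs_wignerProd p q).C_mul ((p : ℂ) + 1)) using 2 with g
    rw [derivative_wignerProd, ← wignerProd_det p q g]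
    simp only [map_add, map_natCast, map_one, map_ofNat]
    ring

/-- Splitting one linear factor off `wignerProd (p + 1) q` leaves the wanted product once the
multiple of `ᾱ` is subtracted. -/
lemma hasWignerCoeffs_star_beta_mul (p q : ℕ) :
    HasWignerCoeffs fun g => Polynomial.C (star (g.1 1 0)) * wignerProd p q g := by
  convert (hasWignerCoeffs_wignerProd (p + 1) q).sub
    (hasWignerCoeffs_star_alpha_mul p q).X_mul using 2 with g
  rw [wignerProd_succ_left]; ring

lemma hasWignerCoeffs_alpha_mul (p q : ℕ) :
    HasWignerCoeffs fun g => Polynomial.C (g.1 0 0) * wignerProd p q g := by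
  convert (hasWignerCoeffs_wignerProd p (q + 1)).sub
    (hasWignerCoeffs_neg_beta_mul p q).X_mul using 2 with g
  rw [wignerProd_succ_right]; ring

lemma mul_mem_wignerSpan {f w : SU2 → ℂ}
    (hf : ∀ p q, HasWignerCoeffs fun g => Polynomial.C (f g) * wignerProd p q g)
    (hw : w ∈ wignerSpan) : f * w ∈ wignerSpan := by
  induction hw using Submodule.span_induction with
  | mem x hx =>
    obtain ⟨⟨n, i, j⟩, rfl⟩ := hx
    have := wignerSpan.smul_mem
      ((Real.sqrt (n.choose j) / Real.sqrt (n.choose i) : ℝ) : ℂ) (hf j (n - j) i)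
    refine (congrArg (· ∈ wignerSpan) (funext fun g => ?_)).mp this
    simp only [Pi.smul_apply, smul_eq_mul, Pi.mul_apply, wignerD, Polynomial.coeff_C_mul,
      wignerPoly_eq_wignerProd]
    ring
  | zero => simp
  | add x y _ _ hx hy => simpa [mul_add] using wignerSpan.add_mem hx hy
  | smul c x _ hx => simpa using wignerSpan.smul_mem c hx

/-- The matrix entries as continuous functions. -/
def SU2.entry (i j : Fin 2) : C(SU2, ℂ) := ⟨_, SU2.continuous_entry i j⟩

/-- The algebra generated by `α`, `β` and their conjugates. -/
def entryAlgebra : StarSubalgebra ℂ C(SU2, ℂ) :=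
  StarAlgebra.adjoin ℂ {SU2.entry 0 0, SU2.entry 1 0}

lemma mem_wignerSpan_of_mem_entryAlgebra {f : C(SU2, ℂ)} (hf : f ∈ entryAlgebra) :
    (f : SU2 → ℂ) ∈ wignerSpan := by
  have hf' : f ∈ Algebra.adjoin ℂ ({SU2.entry 0 0, SU2.entry 1 0} ∪
    star {SU2.entry 0 0, SU2.entry 1 0} : Set C(SU2, ℂ)) := hf
  -- Stability of the span under multiplication by `f` passes to products, so it is what the
  -- induction proves. It is then applied to the constant function `wignerD 0 0 0 = 1`.
  have key : ∀ w ∈ wignerSpan, (f : SU2 → ℂ) * w ∈ wignerSpan := by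
    induction hf' using Algebra.adjoin_induction with
    | mem x hx =>
      intro w hw
      simp only [Set.mem_union, Set.mem_insert_iff, Set.mem_singleton_iff, Set.mem_star] at hx
      rcases hx with (rfl | rfl) | (h | h)
      · exact mul_mem_wignerSpan hasWignerCoeffs_alpha_mul hw
      · refine mul_mem_wignerSpan (fun p q => ?_) hw
        convert (hasWignerCoeffs_neg_beta_mul p q).C_mul (-1) using 2 with g
        simp [SU2.entry]
      · rw [← star_star x, h]
        exact mul_mem_wignerSpan hasWignerCoeffs_star_alpha_mul hw
      · rw [← star_star x, h]
        exact mul_mem_wignerSpan hasWignerCoeffs_star_beta_mul hw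
    | algebraMap r =>
      intro w hw
      simpa [Algebra.algebraMap_eq_smul_one] using wignerSpan.smul_mem r hw
    | add x y _ _ hx hy =>
      intro w hw
      simpa [add_mul] using wignerSpan.add_mem (hx ‹_› w hw) (hy ‹_› w hw)
    | mul x y _ _ hx hy =>
      intro w hw
      simpa [mul_assoc] using hx ‹_› _ (hy ‹_› w hw)
  have h1 := key _ (wignerD_mem_wignerSpan 0 0 0)
  have e : wignerD 0 0 0 = 1 := funext fun g => wignerD_zero 0 0 g
  rwa [e, mul_one] at h1

lemma SU2.ext_entry {g h : SU2} (h0 : g.1 0 0 = h.1 0 0) (h1 : g.1 1 0 = h.1 1 0) : g = h := by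
  have key : ∀ g : SU2, g.1 0 1 = -star (g.1 1 0) ∧ g.1 1 1 = star (g.1 0 0) := by
    intro g
    have h1 := Matrix.mem_specialUnitaryGroup_iff.mp g.2
    have h2 : star g.1 * g.1 = 1 := Matrix.mem_unitaryGroup_iff'.mp h1.1
    have h3 : g.1 * Matrix.adjugate g.1 = 1 := by rw [Matrix.mul_adjugate, h1.2, one_smul]
    have h4 := left_inv_eq_right_inv h2 h3
    rw [Matrix.adjugate_fin_two] at h4
    have e0 := congrFun (congrFun h4 0) 0
    have e1 := congrFun (congrFun h4 0) 1
    simp only [Matrix.star_apply, Matrix.of_apply, Matrix.cons_val', Matrix.cons_val_zero,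
      Matrix.cons_val_one, Matrix.cons_val_fin_one] at e0 e1
    exact ⟨by rw [e1, neg_neg], e0.symm⟩
  apply Subtype.ext
  ext i j
  fin_cases i <;> fin_cases j
  · exact h0
  · exact ((key g).1.trans (by rw [h1])).trans (key h).1.symm
  · exact h1
  · exact ((key g).2.trans (by rw [h0])).trans (key h).2.symm

/-- Stone–Weierstrass: the first column determines an element of `SU(2)`, so the two entries
separate points. -/
lemma entryAlgebra_topologicalClosure : entryAlgebra.topologicalClosure = ⊤ := by
  refine ContinuousMap.starSubalgebra_topologicalClosure_eq_top_of_separatesPoints _ ?_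
  intro x y hxy
  by_cases h0 : x.1 0 0 = y.1 0 0
  · exact ⟨_, ⟨SU2.entry 1 0, StarAlgebra.subset_adjoin _ _ (by simp), rfl⟩,
      fun h1 => hxy (SU2.ext_entry h0 h1)⟩
  · exact ⟨_, ⟨SU2.entry 0 0, StarAlgebra.subset_adjoin _ _ (by simp), rfl⟩, h0⟩

/-- The hyperspherical harmonics as continuous maps. -/
def harmonicMap (k : WignerIndex) : C(SU2, ℂ) :=
  ⟨_, continuous_hypersphericalHarmonic k.1 k.2.1 k.2.2⟩

lemma span_harmonicMap_topologicalClosure :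
    (Submodule.span ℂ (Set.range harmonicMap)).topologicalClosure = ⊤ := by
  have hle : Subalgebra.toSubmodule entryAlgebra.toSubalgebra ≤
      Submodule.span ℂ (Set.range harmonicMap) := by
    intro f hf
    have h := mem_wignerSpan_of_mem_entryAlgebra hf
    have hmap : wignerSpan ≤ (Submodule.span ℂ (Set.range harmonicMap)).map
        (ContinuousMap.coeFnLinearMap ℂ) := by
      refine Submodule.span_le.mpr ?_
      rintro _ ⟨k, rfl⟩
      have hne : ((Real.sqrt (k.1 + 1) / (4 * Real.pi) : ℝ) : ℂ) ≠ 0 := by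
        have : 0 < Real.sqrt (k.1 + 1) / (4 * Real.pi) := by positivity
        exact_mod_cast this.ne'
      refine ⟨((Real.sqrt (k.1 + 1) / (4 * Real.pi) : ℝ) : ℂ)⁻¹ • harmonicMap k,
        Submodule.smul_mem _ _ (Submodule.subset_span ⟨k, rfl⟩), funext fun g => ?_⟩
      change _ * hypersphericalHarmonic _ _ _ _ = _
      rw [hypersphericalHarmonic, inv_mul_cancel_left₀ hne]
    obtain ⟨f', hf', e⟩ := hmap h
    have : f' = f := DFunLike.coe_injective e
    rwa [this] at hf'
  have hcl := Submodule.topologicalClosure_mono hle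
  have ht : (Subalgebra.toSubmodule entryAlgebra.toSubalgebra).topologicalClosure = ⊤ :=
    congr_arg (Subalgebra.toSubmodule <| StarSubalgebra.toSubalgebra ·)
      entryAlgebra_topologicalClosure
  rw [ht] at hcl
  exact top_unique hcl

/-! ### The volume measure -/

instance sphereVolume.instIsHaarMeasure : sphereVolume.IsHaarMeasure :=
  Measure.IsHaarMeasure.smul _
    (by simp) ENNReal.ofReal_ne_top

lemma sphereVolume_univ : sphereVolume Set.univ = ENNReal.ofReal (16 * Real.pi ^ 2) := by
  have : Measure.haarMeasure (⊤ : TopologicalSpace.PositiveCompacts SU2) Set.univ = 1 :=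
    Measure.haarMeasure_self
  rw [sphereVolume, Measure.smul_apply, this, smul_eq_mul, mul_one]

instance sphereVolume.instIsMulRightInvariant : sphereVolume.IsMulRightInvariant where
  map_mul_right_eq_self g := by
    -- A right translate of Haar measure is again left invariant, hence a multiple of it; equality
    -- of the finite total masses makes the factor `1`.
    have h := Measure.isMulInvariant_eq_smul_of_compactSpace
      (Measure.map (· * g) sphereVolume) sphereVolume
    have hu := congrArg (fun μ : Measure SU2 => μ Set.univ) h
    have h0 : sphereVolume Set.univ ≠ 0 := by
      rw [sphereVolume_univ]; simp
    simp only [Measure.map_apply (measurable_mul_const g) MeasurableSet.univ, Set.preimage_univ,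
      Measure.smul_apply] at hu
    have hc : (Measure.haarScalarFactor (Measure.map (· * g) sphereVolume) sphereVolume) = 1 := by
      rw [ENNReal.smul_def, smul_eq_mul] at hu
      nth_rewrite 1 [← one_mul (sphereVolume Set.univ)] at hu
      rw [ENNReal.mul_left_inj h0 (measure_ne_top _ _)] at hu
      exact_mod_cast hu.symm
    rw [h, hc, one_smul]

instance SU2.instSecondCountableTopology : SecondCountableTopology SU2 :=
  haveI : SecondCountableTopology (Matrix (Fin 2) (Fin 2) ℂ) :=
    inferInstanceAs (SecondCountableTopology (Fin 2 → Fin 2 → ℂ))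
  TopologicalSpace.Subtype.secondCountableTopology _

/-! ### Reconstruction of a square integrable function from its coefficients -/

/-- The hyperspherical harmonics as elements of `L²`. -/
def harmonicLp (k : WignerIndex) : Lp ℂ 2 sphereVolume :=
  ContinuousMap.toLp 2 sphereVolume ℂ (harmonicMap k)

lemma span_harmonicLp_topologicalClosure :
    (Submodule.span ℂ (Set.range harmonicLp)).topologicalClosure = ⊤ := by
  have h := (ContinuousMap.toLp_denseRange ℂ sphereVolume ℂ
    (ENNReal.ofNat_ne_top (n := 2))).topologicalClosure_map_submodule
      span_harmonicMap_topologicalClosure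
  rw [Submodule.map_span, ← Set.range_comp] at h
  exact h

/-- The set of indices of degree at most `N`. -/
def degreeFinset (N : ℕ) : Finset WignerIndex :=
  (Finset.range (N + 1)).sigma fun _ => Finset.univ

lemma mem_degreeFinset {N : ℕ} {k : WignerIndex} : k ∈ degreeFinset N ↔ k.1 ≤ N := by
  simp [degreeFinset]

/-- The span of the harmonics of degree at most `N`. -/
def harmonicSpan (N : ℕ) : Submodule ℂ (Lp ℂ 2 sphereVolume) :=
  Submodule.span ℂ (harmonicLp '' degreeFinset N)

instance harmonicSpan.instFiniteDimensional (N : ℕ) : FiniteDimensional ℂ (harmonicSpan N) :=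
  FiniteDimensional.span_of_finite ℂ ((degreeFinset N).finite_toSet.image _)

open scoped InnerProductSpace in
-- Orthonormality of the harmonics is not needed. An abstract orthonormal basis of the span is
-- expanded in the harmonics, so its inner products with `x` are combinations of Fourier
-- coefficients, and the projection is a combination of continuous functions.
lemma exists_harmonicSpan_starProjection_eq (N : ℕ) : ∃ w : WignerIndex → C(SU2, ℂ),
    ∀ x, (harmonicSpan N).starProjection x =
      ∑ k ∈ degreeFinset N, ⟪harmonicLp k, x⟫_ℂ • ContinuousMap.toLp 2 sphereVolume ℂ (w k) := by
  have hmem : ∀ e ∈ harmonicSpan N, ∃ b : WignerIndex → ℂ,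
      ∑ k ∈ degreeFinset N, b k • harmonicLp k = e := by
    intro e he
    rw [harmonicSpan, Submodule.mem_span_image_finset_iff_exists_fun] at he
    obtain ⟨c, hc⟩ := he
    refine ⟨fun k => if h : k ∈ degreeFinset N then c ⟨k, h⟩ else 0, ?_⟩
    rw [← hc, ← Finset.sum_coe_sort]
    exact Finset.sum_congr rfl fun k _ => by simp
  let E := stdOrthonormalBasis ℂ (harmonicSpan N)
  choose b hb using fun m => hmem (E m) (E m).2
  refine ⟨fun k => ∑ m, star (b m k) • ∑ l ∈ degreeFinset N, b m l • harmonicMap l, fun x => ?_⟩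
  have e : ∀ m, ContinuousMap.toLp 2 sphereVolume ℂ (∑ l ∈ degreeFinset N, b m l • harmonicMap l) =
      (E m : Lp ℂ 2 sphereVolume) := by
    intro m
    rw [← hb m, map_sum]
    exact Finset.sum_congr rfl fun k _ => by rw [map_smul]; rfl
  simp_rw [map_sum, map_smul, e]
  have := E.starProjection_eq_sum_rankOne
  rw [this]
  simp only [sum_apply, InnerProductSpace.rankOne_apply]
  simp_rw [Finset.smul_sum, smul_smul]
  rw [Finset.sum_comm]
  refine Finset.sum_congr rfl fun m _ => ?_
  rw [← Finset.sum_smul]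
  congr 1
  rw [← hb m, sum_inner]
  refine Finset.sum_congr rfl fun k _ => ?_
  rw [inner_smul_left, mul_comm]
  rfl

lemma harmonicSpan_mono : Monotone harmonicSpan := fun M N h =>
  Submodule.span_mono (Set.image_mono fun k hk => by
    simp only [Finset.mem_coe, mem_degreeFinset] at hk ⊢
    exact hk.trans h)

lemma iSup_harmonicSpan_topologicalClosure : (⨆ N, harmonicSpan N).topologicalClosure = ⊤ := by
  refine top_unique ?_
  rw [← span_harmonicLp_topologicalClosure]
  refine Submodule.topologicalClosure_mono (Submodule.span_le.mpr ?_)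
  rintro _ ⟨k, rfl⟩
  exact Submodule.mem_iSup_of_mem k.1
    (Submodule.subset_span ⟨k, by simp [mem_degreeFinset], rfl⟩)

/-- A choice of continuous functions dual to the harmonics of degree at most `N`. -/
def reconstructionKernel (N : ℕ) : WignerIndex → C(SU2, ℂ) :=
  (exists_harmonicSpan_starProjection_eq N).choose

/-- The `k`-th Fourier coefficient of a function on `SU(2)`. -/
def fourierCoefficient (f : SU2 → ℂ) (k : WignerIndex) : ℂ :=
  ∫ g, f g * star (hypersphericalHarmonic k.1 k.2.1 k.2.2 g) ∂sphereVolume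

/-- The function of degree at most `N` with given coefficients, evaluated at a point. -/
def reconstruct (N : ℕ) (a : WignerIndex → ℂ) (g : SU2) : ℂ :=
  ∑ k ∈ degreeFinset N, a k * reconstructionKernel N k g

open scoped InnerProductSpace in
-- `reconstruct N` represents the orthogonal projection onto `harmonicSpan N`. These subspaces
-- increase and have dense union, so the projections converge strongly to the identity.
lemma tendsto_eLpNorm_sub_reconstruct {f : SU2 → ℂ} (hf : MemLp f 2 sphereVolume) :
    Tendsto (fun N => eLpNorm (fun g => reconstruct N (fourierCoefficient f) g - f g) 2 sphereVolume)
      atTop (𝓝 0) := by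
  have h1 := Submodule.starProjection_tendsto_self harmonicSpan harmonicSpan_mono (hf.toLp f)
    iSup_harmonicSpan_topologicalClosure.ge
  have hinner : ∀ k, ⟪harmonicLp k, hf.toLp f⟫_ℂ = fourierCoefficient f k := by
    intro k
    rw [L2.inner_def]
    refine integral_congr_ae ?_
    filter_upwards [hf.coeFn_toLp, ContinuousMap.coeFn_toLp (p := 2) (𝕜 := ℂ) sphereVolume
      (harmonicMap k)] with g h1 h2
    rw [h1]
    have : (harmonicLp k) g = harmonicMap k g := h2
    rw [this, RCLike.inner_apply']
    exact mul_comm _ _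
  have h2 : ∀ N, (harmonicSpan N).starProjection (hf.toLp f) =
      ContinuousMap.toLp 2 sphereVolume ℂ
        (∑ k ∈ degreeFinset N, fourierCoefficient f k • reconstructionKernel N k) := by
    intro N
    rw [(exists_harmonicSpan_starProjection_eq N).choose_spec, map_sum]
    refine Finset.sum_congr rfl fun k _ => ?_
    rw [hinner, map_smul]
    rfl
  rw [tendsto_iff_edist_tendsto_0] at h1
  refine h1.congr fun N => ?_
  rw [Lp.edist_def, h2]
  refine eLpNorm_congr_ae ?_
  filter_upwards [hf.coeFn_toLp, ContinuousMap.coeFn_toLp (p := 2) (𝕜 := ℂ) sphereVolume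
    (∑ k ∈ degreeFinset N, fourierCoefficient f k • reconstructionKernel N k)] with g h1 h2
  rw [Pi.sub_apply, h1, h2]
  simp [reconstruct]

/-! ### Behaviour of the coefficients under translations -/

lemma integrable_mul_star_harmonic {f : SU2 → ℂ} (hf : Integrable f sphereVolume) (n : ℕ)
    (i j : Fin (n + 1)) :
    Integrable (fun g => f g * star (hypersphericalHarmonic n i j g)) sphereVolume := by
  have hc := (continuous_hypersphericalHarmonic n i j).star
  obtain ⟨C, hC⟩ := isCompact_univ.exists_bound_of_continuousOn hc.continuousOn
  exact hf.mul_bdd hc.aestronglyMeasurable (ae_of_all _ fun g => hC g trivial)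

lemma hypersphericalHarmonic_mul (n : ℕ) (i j : Fin (n + 1)) (g p : SU2) :
    hypersphericalHarmonic n i j (g * p) =
      ∑ m, wignerD n i m g * hypersphericalHarmonic n m j p := by
  simp_rw [hypersphericalHarmonic, wignerD_mul, Finset.mul_sum]
  exact Finset.sum_congr rfl fun m _ => by ring

lemma hypersphericalHarmonic_mul_inv (n : ℕ) (i j : Fin (n + 1)) (g p : SU2) :
    hypersphericalHarmonic n i j (p * g⁻¹) =
      ∑ m, star (wignerD n j m g) * hypersphericalHarmonic n i m p := by
  simp_rw [hypersphericalHarmonic, wignerD_mul, wignerD_inv, Finset.mul_sum]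
  exact Finset.sum_congr rfl fun m _ => by ring

lemma fourierCoefficient_left_translate {f : SU2 → ℂ} (hf : Integrable f sphereVolume) (g : SU2)
    (n : ℕ) (i j : Fin (n + 1)) :
    fourierCoefficient (fun p => f (g⁻¹ * p)) ⟨n, i, j⟩ =
      ∑ m, star (wignerD n i m g) * fourierCoefficient f ⟨n, m, j⟩ := by
  rw [fourierCoefficient, ← integral_mul_left_eq_self _ g]
  simp only [inv_mul_cancel_left, hypersphericalHarmonic_mul, star_sum, star_mul', Finset.mul_sum]
  rw [integral_finsetSum]
  · refine Finset.sum_congr rfl fun m _ => ?_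
    rw [fourierCoefficient, ← integral_const_mul]
    exact integral_congr_ae (ae_of_all _ fun p => mul_left_comm _ _ _)
  · intro m _
    exact ((integrable_mul_star_harmonic hf n m j).const_mul (star (wignerD n i m g))).congr
      (ae_of_all _ fun p => mul_left_comm _ _ _)

lemma fourierCoefficient_right_translate {f : SU2 → ℂ} (hf : Integrable f sphereVolume) (g : SU2)
    (n : ℕ) (i j : Fin (n + 1)) :
    fourierCoefficient (fun p => f (p * g)) ⟨n, i, j⟩ =
      ∑ m, wignerD n j m g * fourierCoefficient f ⟨n, i, m⟩ := by
  rw [fourierCoefficient, ← integral_mul_right_eq_self _ g⁻¹]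
  simp only [inv_mul_cancel_right, hypersphericalHarmonic_mul_inv, star_sum, star_mul', star_star,
    Finset.mul_sum]
  rw [integral_finsetSum]
  · refine Finset.sum_congr rfl fun m _ => ?_
    rw [fourierCoefficient, ← integral_const_mul]
    exact integral_congr_ae (ae_of_all _ fun p => mul_left_comm _ _ _)
  · intro m _
    exact ((integrable_mul_star_harmonic hf n i m).const_mul (wignerD n j m g)).congr
      (ae_of_all _ fun p => mul_left_comm _ _ _)

/-- Complex combinations of the generators for `κ = 1` and `κ = I` are ladder operators: here only
the superdiagonal survives, with the opposite sign only the subdiagonal. -/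
lemma wignerGenerator_add_I_mul {n : ℕ} (i m : Fin (n + 1)) :
    wignerGenerator n 1 i m + Complex.I * wignerGenerator n Complex.I i m =
      if (i : ℕ) + 1 = m then 2 * (ladderCoeff n i : ℂ) else 0 := by
  by_cases h : (i : ℕ) + 1 = m
  · rw [if_pos h, wignerGenerator_above _ h, wignerGenerator_above _ h]
    simp only [star_one, Complex.star_def, Complex.conj_I]
    linear_combination -(ladderCoeff n i : ℂ) * Complex.I_mul_I
  · rw [if_neg h]
    by_cases h' : (m : ℕ) + 1 = i
    · rw [wignerGenerator_below _ h', wignerGenerator_below _ h']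
      linear_combination -(ladderCoeff n m : ℂ) * Complex.I_mul_I
    · rw [wignerGenerator_of_ne _ h (Ne.symm h'), wignerGenerator_of_ne _ h (Ne.symm h')]
      simp

lemma wignerGenerator_sub_I_mul {n : ℕ} (i m : Fin (n + 1)) :
    wignerGenerator n 1 i m - Complex.I * wignerGenerator n Complex.I i m =
      if (m : ℕ) + 1 = i then -(2 * (ladderCoeff n m : ℂ)) else 0 := by
  by_cases h' : (m : ℕ) + 1 = i
  · rw [if_pos h', wignerGenerator_below _ h', wignerGenerator_below _ h']
    linear_combination (ladderCoeff n m : ℂ) * Complex.I_mul_I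
  · rw [if_neg h']
    by_cases h : (i : ℕ) + 1 = m
    · rw [wignerGenerator_above _ h, wignerGenerator_above _ h]
      simp only [star_one, Complex.star_def, Complex.conj_I]
      linear_combination (ladderCoeff n i : ℂ) * Complex.I_mul_I
    · rw [wignerGenerator_of_ne _ h (Ne.symm h'), wignerGenerator_of_ne _ h (Ne.symm h')]
      simp

/-- The representation of positive degree has no invariant vectors. -/
lemma eq_zero_of_forall_wignerD_invariant {n : ℕ} (hn : n ≠ 0) {v : Fin (n + 1) → ℂ}
    (hv : ∀ g i, ∑ m, wignerD n i m g * v m = v i) : v = 0 := by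
  have hA : ∀ κ : ℂ, star κ * κ = 1 → ∀ i, ∑ m, wignerGenerator n κ i m * v m = 0 := by
    intro κ hκ i
    have h1 : HasDerivAt (fun t => ∑ m, wignerD n i m (SU2.rotation κ hκ t) * v m)
        (∑ m, wignerGenerator n κ i m * v m) 0 :=
      HasDerivAt.fun_sum fun m _ => (hasDerivAt_wignerD_rotation n κ hκ i m).mul_const _
    simp_rw [hv] at h1
    exact h1.unique (hasDerivAt_const _ _)
  have h1 := hA 1 (by simp)
  have hI := hA Complex.I (by simp)
  funext k
  -- Each row of a ladder operator has at most one nonzero entry. Row `k - 1` of the superdiagonal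
  -- operator isolates `v k` for `k > 0`; `v 0` is isolated by row `1` of the other, which exists as
  -- `n ≠ 0`.
  by_cases hk : (k : ℕ) = 0
  · let i : Fin (n + 1) := ⟨1, by omega⟩
    have hki : (k : ℕ) + 1 = i := by simp [i, hk]
    have h : ∑ m, (wignerGenerator n 1 i m - Complex.I * wignerGenerator n Complex.I i m) * v m
        = 0 := by
      simp_rw [sub_mul, Finset.sum_sub_distrib, mul_assoc, ← Finset.mul_sum, h1, hI]
      simp
    simp_rw [wignerGenerator_sub_I_mul] at h
    rw [Finset.sum_eq_single k (fun m _ hm => by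
      rw [if_neg fun e => hm (Fin.ext (by omega)), zero_mul]) (by simp), if_pos hki] at h
    have hr : (ladderCoeff n k : ℂ) ≠ 0 := by
      exact_mod_cast (ladderCoeff_pos (by omega : (k : ℕ) + 1 ≤ n)).ne'
    simpa [hr] using h
  · let i : Fin (n + 1) := ⟨k - 1, by omega⟩
    have hki : (i : ℕ) + 1 = k := by simp only [i]; omega
    have h : ∑ m, (wignerGenerator n 1 i m + Complex.I * wignerGenerator n Complex.I i m) * v m
        = 0 := by
      simp_rw [add_mul, Finset.sum_add_distrib, mul_assoc, ← Finset.mul_sum, h1, hI]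
      simp
    simp_rw [wignerGenerator_add_I_mul] at h
    rw [Finset.sum_eq_single k (fun m _ hm => by
      rw [if_neg fun e => hm (Fin.ext (by omega)), zero_mul]) (by simp), if_pos hki] at h
    have hr : (ladderCoeff n i : ℂ) ≠ 0 := by
      exact_mod_cast (ladderCoeff_pos (by omega : (i : ℕ) + 1 ≤ n)).ne'
    simpa [hr] using h

/-- A constant is unchanged by left translations, so the conjugates of its coefficients in a column
form an invariant vector. -/
lemma fourierCoefficient_const (c : ℂ) {k : WignerIndex} (hk : k.1 ≠ 0) :
    fourierCoefficient (fun _ => c) k = 0 := by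
  obtain ⟨n, i, j⟩ := k
  have h : (fun i => star (fourierCoefficient (fun _ => (c : ℂ)) ⟨n, i, j⟩)) = 0 := by
    refine eq_zero_of_forall_wignerD_invariant hk fun g i => ?_
    have := fourierCoefficient_left_translate (integrable_const c) g n i j
    rw [this, star_sum]
    exact Finset.sum_congr rfl fun m _ => by rw [star_mul', star_star]
  simpa using congrFun h i

lemma hypersphericalHarmonic_zero (i j : Fin 1) (g : SU2) :
    hypersphericalHarmonic 0 i j g = ((4 * Real.pi)⁻¹ : ℝ) := by
  simp [hypersphericalHarmonic, wignerD_zero]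

lemma fourierCoefficient_const_zero (c : ℂ) (i j : Fin 1) :
    fourierCoefficient (fun _ => c) ⟨0, i, j⟩ = 4 * Real.pi * c := by
  have hpi : (Real.pi : ℂ) ≠ 0 := by exact_mod_cast Real.pi_ne_zero
  have e : sphereVolume.real Set.univ = 16 * Real.pi ^ 2 := by
    rw [measureReal_def, sphereVolume_univ, ENNReal.toReal_ofReal (by positivity)]
  simp only [fourierCoefficient, hypersphericalHarmonic_zero, Complex.star_def,
    Complex.conj_ofReal, integral_const, e, Complex.real_smul]
  push_cast
  field_simp
  ring

/-! ### Limits of random variables and their laws -/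

section LinearCombinations

variable {Ω : Type*} [MeasurableSpace Ω] {P : Measure Ω}

lemma charFun_map_mul_const {a : Ω → ℂ} (ha : AEMeasurable a P) (c w : ℂ) :
    charFun (P.map fun ω => c * a ω) w = charFun (P.map a) (star c * w) := by
  have hca : AEMeasurable (fun ω => c * a ω) P := ha.const_mul c
  have hF : ∀ w, Continuous fun x : ℂ => Complex.exp (inner ℝ x w * Complex.I) := by
    intro w; fun_prop
  rw [charFun_apply, charFun_apply, integral_map hca (hF _).aestronglyMeasurable,
    integral_map ha (hF _).aestronglyMeasurable]
  congr 1
  funext ω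
  congr 3
  simp [Complex.inner]
  ring

lemma charFun_sum_mul {ι : Type*} {a : ι → Ω → ℂ} (ha : ∀ k, AEMeasurable (a k) P)
    (hindep : iIndepFun a P) (s : Finset ι) (c : ι → ℂ) (w : ℂ) :
    charFun (P.map fun ω => ∑ k ∈ s, c k * a k ω) w =
      ∏ k ∈ s, charFun (P.map (a k)) (star (c k) * w) := by
  have hi : iIndepFun (fun k ω => c k * a k ω) P :=
    hindep.comp (fun k x => c k * x) fun k => measurable_const_mul (c k)
  rw [(hi.restrict s).charFun_map_fun_finsetSum_eq_prod fun k _ => (ha k).const_mul (c k),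
    Finset.prod_apply]
  exact Finset.prod_congr rfl fun k _ => charFun_map_mul_const (ha k) _ _

end LinearCombinations

section Limits

variable {Ω : Type*} [MeasurableSpace Ω] {P : Measure Ω} [IsProbabilityMeasure P]

/-- Almost sure convergence implies convergence in distribution, and limits in distribution are
unique. -/
lemma identDistrib_of_ae_tendsto {E : Type*} [TopologicalSpace E] [MeasurableSpace E]
    [BorelSpace E] [HasOuterApproxClosed E] {X Y : ℕ → Ω → E} {Z W : Ω → E}
    (hZ : AEMeasurable Z P) (hW : AEMeasurable W P)
    (hXZ : ∀ᵐ ω ∂P, Tendsto (fun n => X n ω) atTop (𝓝 (Z ω)))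
    (hYW : ∀ᵐ ω ∂P, Tendsto (fun n => Y n ω) atTop (𝓝 (W ω)))
    (h : ∀ n, IdentDistrib (X n) (Y n) P P) : IdentDistrib Z W P P := by
  have h1 := tendstoInDistribution_of_ae_tendsto (fun n => (h n).aemeasurable_fst) hZ hXZ
  have h2 := tendstoInDistribution_of_ae_tendsto (fun n => (h n).aemeasurable_snd) hW hYW
  have h3 : TendstoInDistribution X atTop W (fun _ => P) P := by
    refine ⟨fun n => (h n).aemeasurable_fst, hW, ?_⟩
    have e : ∀ n, (⟨P.map (X n), Measure.isProbabilityMeasure_map (h n).aemeasurable_fst⟩ :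
        ProbabilityMeasure E) =
        ⟨P.map (Y n), Measure.isProbabilityMeasure_map (h n).aemeasurable_snd⟩ :=
      fun n => Subtype.ext (h n).map_eq
    simp_rw [e]
    exact h2.tendsto
  exact ⟨hZ, hW, tendstoInDistribution_unique X h1 h3⟩

lemma tendsto_charFun_of_ae_tendsto {X : ℕ → Ω → ℂ} {Z : Ω → ℂ} (hX : ∀ n, AEMeasurable (X n) P)
    (hZ : AEMeasurable Z P) (h : ∀ᵐ ω ∂P, Tendsto (fun n => X n ω) atTop (𝓝 (Z ω))) (w : ℂ) :
    Tendsto (fun n => charFun (P.map (X n)) w) atTop (𝓝 (charFun (P.map Z) w)) := by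
  have hm : ∀ {Y : Ω → ℂ}, AEMeasurable Y P →
      charFun (P.map Y) w = ∫ ω, Complex.exp (inner ℝ (Y ω) w * Complex.I) ∂P := by
    intro Y hY
    rw [charFun_apply, integral_map hY]
    exact (by fun_prop : Continuous fun x : ℂ =>
      Complex.exp (inner ℝ x w * Complex.I)).aestronglyMeasurable
  simp_rw [hm hZ, fun n => hm (hX n)]
  refine tendsto_integral_of_dominated_convergence (fun _ => 1) (fun n => ?_)
    (integrable_const _) (fun n => ae_of_all _ fun ω => ?_) ?_
  · exact (by fun_prop : Continuous fun x : ℂ =>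
      Complex.exp (inner ℝ x w * Complex.I)).measurable.comp_aemeasurable (hX n)
      |>.aestronglyMeasurable
  · exact (Complex.norm_exp_ofReal_mul_I _).le
  · filter_upwards [h] with ω hω
    exact (by fun_prop : Continuous fun x : ℂ =>
      Complex.exp (inner ℝ x w * Complex.I)).continuousAt.tendsto.comp hω

/-! ### Complex Gaussian variables -/

/-- `f` is the characteristic function of a centred circular normal law. -/
def IsCircularGaussianCharFun (f : ℂ → ℂ) : Prop :=
  ∃ v : NNReal, ∀ w, f w = (Real.exp (-(v * ‖w‖ ^ 2 / 2)) : ℝ)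

lemma charFun_circularGaussian (v : NNReal) (w : ℂ) :
    charFun (((gaussianReal 0 v).prod (gaussianReal 0 v)).map
      fun p : ℝ × ℝ => (p.1 : ℂ) + p.2 * Complex.I) w = (Real.exp (-(v * ‖w‖ ^ 2 / 2)) : ℝ) := by
  have hc : Continuous fun p : ℝ × ℝ => (p.1 : ℂ) + p.2 * Complex.I := by fun_prop
  rw [charFun_apply, integral_map hc.measurable.aemeasurable
    (by fun_prop : Continuous fun x : ℂ =>
      Complex.exp (inner ℝ x w * Complex.I)).aestronglyMeasurable]
  have e : ∀ p : ℝ × ℝ, Complex.exp (inner ℝ ((p.1 : ℂ) + p.2 * Complex.I) w * Complex.I) =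
      Complex.exp (w.re * p.1 * Complex.I) * Complex.exp (w.im * p.2 * Complex.I) := by
    intro p
    rw [← Complex.exp_add, ← add_mul]
    congr 2
    simp [Complex.inner]
  simp_rw [e]
  rw [integral_prod_mul (fun x : ℝ => Complex.exp (w.re * x * Complex.I))
    (fun y : ℝ => Complex.exp (w.im * y * Complex.I)), ← charFun_apply_real, ← charFun_apply_real,
    charFun_gaussianReal, charFun_gaussianReal, ← Complex.exp_add, Complex.ofReal_exp]
  congr 1
  rw [Complex.sq_norm, Complex.normSq_apply]
  push_cast
  ring

lemma isComplexGaussian_iff {a : Ω → ℂ} :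
    IsComplexGaussian P a ↔ AEMeasurable a P ∧ IsCircularGaussianCharFun (charFun (P.map a)) := by
  refine and_congr_right fun ha => exists_congr fun v => ⟨fun h w => ?_, fun h => ?_⟩
  · rw [h, charFun_circularGaussian]
  · have := Measure.isProbabilityMeasure_map (μ := P) ha
    have hc : Continuous fun p : ℝ × ℝ => (p.1 : ℂ) + p.2 * Complex.I := by fun_prop
    have := Measure.isProbabilityMeasure_map (μ := (gaussianReal 0 v).prod (gaussianReal 0 v))
      hc.measurable.aemeasurable
    refine Measure.ext_of_charFun (funext fun w => ?_)
    rw [h, charFun_circularGaussian]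

/-- A continuous pointwise limit of multiples of characteristic functions of centred circular
normal laws is one, too. -/
lemma IsCircularGaussianCharFun.of_tendsto {F : ℕ → ℂ → ℂ} {f : ℂ → ℂ} (hf : ContinuousAt f 0)
    (hf0 : f 0 = 1) (hF : ∀ n, ∃ C v : ℝ, 0 ≤ v ∧ ∀ w, F n w = (C * Real.exp (-(v * ‖w‖ ^ 2 / 2)) : ℝ))
    (h : ∀ w, Tendsto (fun n => F n w) atTop (𝓝 (f w))) : IsCircularGaussianCharFun f := by
  choose C v hv hFv using hF
  -- The value at `w = 0` identifies the limit of the prefactors, which can then be divided out.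
  have hC : Tendsto C atTop (𝓝 1) := by
    have := (Complex.continuous_re.tendsto _).comp (h 0)
    rw [hf0] at this
    simpa [Function.comp_def, hFv] using this
  have hre : ∀ w, Tendsto (fun n => Real.exp (-(v n * ‖w‖ ^ 2 / 2))) atTop (𝓝 (f w).re) := by
    intro w
    have h1 := (Complex.continuous_re.tendsto _).comp (h w)
    have h2 := h1.div hC one_ne_zero
    rw [div_one] at h2
    refine h2.congr' ?_
    filter_upwards [hC.eventually_ne one_ne_zero] with n hn
    simp only [Pi.div_apply, Function.comp, hFv, Complex.ofReal_re]
    field_simp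
  have him : ∀ w, (f w).im = 0 := by
    intro w
    refine tendsto_nhds_unique ((Complex.continuous_im.tendsto _).comp (h w)) ?_
    simp only [Function.comp_def, hFv, Complex.ofReal_im]
    exact tendsto_const_nhds
  set q := (f 1).re with hq
  have hq1 : Tendsto (fun n => Real.exp (-(v n / 2))) atTop (𝓝 q) := by simpa using hre 1
  have hq0 : 0 ≤ q := ge_of_tendsto' hq1 fun n => (Real.exp_pos _).le
  have hqle : q ≤ 1 := le_of_tendsto' hq1 fun n => by
    rw [Real.exp_le_one_iff]; have := hv n; linarith
  -- Each Gaussian factor at `w` is the power `‖w‖ ^ 2` of its value at `1`, so the limit at `1`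
  -- determines all others, without convergence of the `v n` being known.
  have hpow : ∀ w, w ≠ 0 → (f w).re = q ^ (‖w‖ ^ 2 : ℝ) := by
    intro w hw
    have hw' : 0 < ‖w‖ ^ 2 := by positivity
    refine tendsto_nhds_unique (hre w) ?_
    have h3 := ((Real.continuousAt_rpow_const q (‖w‖ ^ 2) (Or.inr hw'.le)).tendsto).comp hq1
    refine h3.congr fun n => ?_
    simp only [Function.comp]
    rw [← Real.exp_mul]
    congr 1
    ring
  -- If `q = 0`, the limit would vanish away from `0`, contradicting continuity at `0` where its
  -- value is `1`. This excludes an escape of the variances to infinity.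
  have hqpos : 0 < q := by
    rcases hq0.lt_or_eq with h | h
    · exact h
    · exfalso
      have h0 : ∀ w, w ≠ 0 → f w = 0 := fun w hw => by
        apply Complex.ext
        · rw [hpow w hw, ← h, Real.zero_rpow (by positivity)]; rfl
        · rw [him]; rfl
      have ht : Tendsto f (𝓝[≠] 0) (𝓝 0) :=
        tendsto_const_nhds.congr' (eventually_nhdsWithin_of_forall fun w hw => (h0 w hw).symm)
      have := tendsto_nhds_unique ht (hf.tendsto.mono_left nhdsWithin_le_nhds)
      rw [hf0] at this
      exact zero_ne_one this
  refine ⟨⟨-2 * Real.log q, by have := Real.log_nonpos hq0 hqle; linarith⟩, fun w => ?_⟩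
  apply Complex.ext
  · rw [Complex.ofReal_re]
    by_cases hw : w = 0
    · simp [hw, hf0]
    · rw [hpow w hw, Real.rpow_def_of_pos hqpos]
      congr 1
      change _ = -((-2 * Real.log q) * ‖w‖ ^ 2 / 2)
      ring
  · rw [him, Complex.ofReal_im]

lemma isComplexGaussian_of_ae_tendsto {a : ℕ → Ω → ℂ} {b : Ω → ℂ}
    (ha : ∀ n, IsComplexGaussian P (a n)) (hb : AEMeasurable b P)
    (h : ∀ᵐ ω ∂P, Tendsto (fun n => a n ω) atTop (𝓝 (b ω))) : IsComplexGaussian P b := by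
  have := Measure.isProbabilityMeasure_map (μ := P) hb
  simp_rw [isComplexGaussian_iff] at ha ⊢
  refine ⟨hb, IsCircularGaussianCharFun.of_tendsto (F := fun n => charFun (P.map (a n)))
    continuous_charFun.continuousAt (by simp) (fun n => ?_)
    (tendsto_charFun_of_ae_tendsto (fun n => (ha n).1) hb h)⟩
  obtain ⟨v, hv⟩ := (ha n).2
  exact ⟨1, v, v.2, fun w => by rw [hv, one_mul]⟩

lemma isComplexGaussian_sum_mul {ι : Type*} {a : ι → Ω → ℂ} (s : Finset ι) (c : ι → ℂ)
    (ha : ∀ k, IsComplexGaussian P (a k)) (hindep : iIndepFun a P) :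
    IsComplexGaussian P fun ω => ∑ k ∈ s, c k * a k ω := by
  simp_rw [isComplexGaussian_iff] at ha ⊢
  refine ⟨Finset.aemeasurable_fun_sum s fun k _ => (ha k).1.const_mul (c k), ?_⟩
  choose v hv using fun k => (ha k).2
  refine ⟨∑ k ∈ s, v k * ‖c k‖₊ ^ 2, fun w => ?_⟩
  rw [charFun_sum_mul (fun k => (ha k).1) hindep]
  simp_rw [hv, ← Complex.ofReal_prod, ← Real.exp_sum]
  congr 2
  push_cast
  simp_rw [norm_mul, norm_star, Finset.sum_mul, Finset.sum_div, ← Finset.sum_neg_distrib]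
  exact Finset.sum_congr rfl fun k _ => by ring

lemma ae_tendsto_average {S : Type*} [MeasurableSpace S] {ν : Measure S} [IsProbabilityMeasure ν]
    {f : S → ℂ} (hf : Measurable f) (hint : Integrable f ν) :
    ∀ᵐ ξ ∂Measure.infinitePi fun _ : ℕ => ν,
      Tendsto (fun n : ℕ => (n : ℝ)⁻¹ • ∑ m ∈ Finset.range n, f (ξ m)) atTop (𝓝 (∫ x, f x ∂ν)) := by
  have he : ∀ m, MeasurePreserving (fun ξ : ℕ → S => ξ m) (Measure.infinitePi fun _ => ν) ν :=
    fun m => ⟨measurable_pi_apply m, Measure.infinitePi_map_eval _ m⟩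
  have h := strong_law_ae (μ := Measure.infinitePi fun _ : ℕ => ν) (fun m ξ => f (ξ m))
    ((he 0).integrable_comp_of_integrable hint)
    (fun i j hij => (iIndepFun_infinitePi (P := fun _ : ℕ => ν) fun _ => hf).indepFun hij)
    (fun m => ⟨(hf.comp (measurable_pi_apply m)).aemeasurable,
      (hf.comp (measurable_pi_apply 0)).aemeasurable, by
        rw [← Function.comp_def f (fun ξ : ℕ → S => ξ m),
          ← Function.comp_def f (fun ξ : ℕ → S => ξ 0),
          ← Measure.map_map hf (measurable_pi_apply m), ← Measure.map_map hf (measurable_pi_apply 0),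
          (he m).map_eq, (he 0).map_eq]⟩)
  have e : ∫ ξ : ℕ → S, f (ξ 0) ∂(Measure.infinitePi fun _ => ν) = ∫ x, f x ∂ν := by
    have := integral_map (μ := Measure.infinitePi fun _ : ℕ => ν)
      (measurable_pi_apply 0).aemeasurable (f := f) hf.aestronglyMeasurable
    rw [(he 0).map_eq] at this
    exact this.symm
  rwa [e] at h

/-- Integrals of the trajectories of countably many random fields can be computed as limits of
averages along one deterministic sequence of points. -/
lemma exists_sampling {S : Type*} [MeasurableSpace S] (ν : Measure S) [IsProbabilityMeasure ν]
    {ι : Type*} [Countable ι] {Z : ι → Ω → S → ℂ}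
    (hZ : ∀ i, Measurable (Function.uncurry (Z i)))
    (hint : ∀ i, ∀ᵐ ω ∂P, Integrable (Z i ω) ν) :
    ∃ ξ : ℕ → S, ∀ i, ∀ᵐ ω ∂P,
      Tendsto (fun n : ℕ => (n : ℝ)⁻¹ • ∑ m ∈ Finset.range n, Z i ω (ξ m)) atTop
        (𝓝 (∫ x, Z i ω x ∂ν)) := by
  have key : ∀ i, ∀ᵐ ξ ∂Measure.infinitePi fun _ : ℕ => ν, ∀ᵐ ω ∂P,
      Tendsto (fun n : ℕ => (n : ℝ)⁻¹ • ∑ m ∈ Finset.range n, Z i ω (ξ m)) atTop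
        (𝓝 (∫ x, Z i ω x ∂ν)) := by
    intro i
    have h1 : ∀ᵐ ω ∂P, ∀ᵐ ξ ∂Measure.infinitePi fun _ : ℕ => ν,
        Tendsto (fun n : ℕ => (n : ℝ)⁻¹ • ∑ m ∈ Finset.range n, Z i ω (ξ m)) atTop
          (𝓝 (∫ x, Z i ω x ∂ν)) := by
      filter_upwards [hint i] with ω hω
      exact ae_tendsto_average ((hZ i).comp measurable_prodMk_left) hω
    -- The strong law gives, for each `ω`, almost every sample sequence. Fubini exchanges the two
    -- quantifiers, so that some sequence `ξ` serves almost every `ω`, for all of the countably many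
    -- `i` at once.
    refine (Measure.ae_ae_comm ?_).mp h1
    have hm : Measurable fun ω => ∫ x, Z i ω x ∂ν :=
      ((hZ i).stronglyMeasurable.integral_prod_right).measurable
    have hs : MeasurableSet {p : Ω × (ℕ → S) | Tendsto (fun n : ℕ =>
        (n : ℝ)⁻¹ • ∑ m ∈ Finset.range n, Z i p.1 (p.2 m) - ∫ x, Z i p.1 x ∂ν) atTop (𝓝 0)} := by
      refine measurableSet_tendsto _ fun n => ?_
      have hsum : Measurable fun p : Ω × (ℕ → S) => ∑ m ∈ Finset.range n, Z i p.1 (p.2 m) :=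
        Finset.measurable_fun_sum _ fun m _ => (hZ i).comp
          (measurable_fst.prodMk ((measurable_pi_apply m).comp measurable_snd))
      exact (hsum.const_smul (n : ℝ)⁻¹).sub (hm.comp measurable_fst)
    simpa only [tendsto_sub_nhds_zero_iff] using hs
  obtain ⟨ξ, hξ⟩ := (ae_all_iff.mpr key).exists
  exact ⟨ξ, hξ⟩

end Limits

/-! ### A characterization of circular Gaussian laws by invariance under rotations -/

section Damped

variable (μ : Measure ℂ) [IsProbabilityMeasure μ] {ε : ℝ}

/-- The Gaussian damping factor. -/
def damping (ε : ℝ) (x : ℂ) : ℝ := Real.exp (-(ε * ‖x‖ ^ 2))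

lemma damping_pos (ε : ℝ) (x : ℂ) : 0 < damping ε x := Real.exp_pos _

lemma damping_le_one (hε : 0 < ε) (x : ℂ) : damping ε x ≤ 1 := by
  rw [damping, Real.exp_le_one_iff]
  have : 0 ≤ ε * ‖x‖ ^ 2 := by positivity
  linarith

lemma continuous_damping (ε : ℝ) : Continuous (damping ε) := by
  unfold damping; fun_prop

/-- Damping makes linear functions bounded, so that one may differentiate under the integral for
laws without moments. The constant comes from `1 + t ≤ exp t` and is not sharp. -/
lemma norm_mul_damping_le (hε : 0 < ε) (x : ℂ) : ‖x‖ * damping ε x ≤ 1 + ε⁻¹ := by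
  have h1 : 1 + ε * ‖x‖ ^ 2 ≤ Real.exp (ε * ‖x‖ ^ 2) := by
    have := Real.add_one_le_exp (ε * ‖x‖ ^ 2); linarith
  rw [damping, Real.exp_neg, ← div_eq_mul_inv, div_le_iff₀ (Real.exp_pos _)]
  have h2 : ‖x‖ ≤ (1 + ε⁻¹) * (1 + ε * ‖x‖ ^ 2) := by
    have h3 : (1 + ε⁻¹) * (1 + ε * ‖x‖ ^ 2) = 1 + ε⁻¹ + ε * ‖x‖ ^ 2 + ‖x‖ ^ 2 := by
      field_simp
      ring
    have h4 : 0 < ε⁻¹ := by positivity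
    have h5 : 0 ≤ ε * ‖x‖ ^ 2 := by positivity
    nlinarith [sq_nonneg (‖x‖ - 1)]
  exact h2.trans (mul_le_mul_of_nonneg_left h1 (by positivity))

/-- The damped characteristic function. -/
def dampedCos (ε : ℝ) (u : ℂ) : ℝ := ∫ x, Real.cos (inner ℝ u x) * damping ε x ∂μ

/-- Minus the derivative of the damped characteristic function at `v` in direction `y`. -/
def dampedSin (ε : ℝ) (v y : ℂ) : ℝ :=
  ∫ x, inner ℝ y x * Real.sin (inner ℝ v x) * damping ε x ∂μ

variable {μ}

lemma integrable_cos_mul_damping (hε : 0 < ε) (u : ℂ) :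
    Integrable (fun x => Real.cos (inner ℝ u x) * damping ε x) μ := by
  have hd := continuous_damping ε
  refine Integrable.of_bound (C := 1)
    (by fun_prop : Continuous fun x : ℂ => Real.cos (inner ℝ u x) * damping ε x).aestronglyMeasurable
    (ae_of_all _ fun x => ?_)
  rw [norm_mul, Real.norm_of_nonneg (damping_pos ε x).le]
  exact mul_le_one₀ (Real.abs_cos_le_one _) (damping_pos ε x).le (damping_le_one hε x)

lemma norm_inner_mul_damping_le (hε : 0 < ε) (y x : ℂ) :
    |inner ℝ y x| * damping ε x ≤ ‖y‖ * (1 + ε⁻¹) := by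
  calc |inner ℝ y x| * damping ε x ≤ (‖y‖ * ‖x‖) * damping ε x :=
        mul_le_mul_of_nonneg_right (abs_real_inner_le_norm y x) (damping_pos ε x).le
    _ = ‖y‖ * (‖x‖ * damping ε x) := by ring
    _ ≤ _ := mul_le_mul_of_nonneg_left (norm_mul_damping_le hε x) (norm_nonneg _)

lemma dampedCos_zero_pos (hε : 0 < ε) : 0 < dampedCos μ ε 0 := by
  have h := integrable_cos_mul_damping (μ := μ) hε 0
  simp only [inner_zero_left, Real.cos_zero, one_mul] at h
  simp only [dampedCos, inner_zero_left, Real.cos_zero, one_mul]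
  rw [integral_pos_iff_support_of_nonneg (fun x => (damping_pos ε x).le) h]
  have : Function.support (damping ε) = Set.univ :=
    Set.eq_univ_of_forall fun x => (damping_pos ε x).ne'
  rw [this, measure_univ]
  exact one_pos

lemma dampedCos_le (hε : 0 < ε) (u : ℂ) : dampedCos μ ε u ≤ dampedCos μ ε 0 := by
  refine integral_mono (integrable_cos_mul_damping hε u) (integrable_cos_mul_damping hε 0)
    fun x => mul_le_mul_of_nonneg_right ?_ (damping_pos ε x).le
  rw [inner_zero_left, Real.cos_zero]
  exact Real.cos_le_one _

lemma continuous_dampedCos (hε : 0 < ε) : Continuous (dampedCos μ ε) := by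
  have hd := continuous_damping ε
  refine continuous_of_dominated (bound := fun _ => 1) (fun u => ?_) (fun u => ?_)
    (integrable_const _) (ae_of_all _ fun x => by fun_prop)
  · exact (integrable_cos_mul_damping hε u).aestronglyMeasurable
  · refine ae_of_all _ fun x => ?_
    rw [norm_mul, Real.norm_of_nonneg (damping_pos ε x).le]
    exact mul_le_one₀ (Real.abs_cos_le_one _) (damping_pos ε x).le (damping_le_one hε x)

lemma hasDerivAt_dampedCos (hε : 0 < ε) (u : ℂ) (t : ℝ) :
    HasDerivAt (fun t : ℝ => dampedCos μ ε (t * u)) (-dampedSin μ ε (t * u) u) t := by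
  have hd := continuous_damping ε
  have hin : ∀ (t : ℝ) (x : ℂ), inner ℝ ((t : ℂ) * u) x = t * inner ℝ u x := by
    intro t x
    rw [← Complex.real_smul, real_inner_smul_left]
  have h := (hasDerivAt_integral_of_dominated_loc_of_deriv_le (μ := μ) (x₀ := t)
    (F := fun t x => Real.cos (t * inner ℝ u x) * damping ε x)
    (F' := fun t x => -Real.sin (t * inner ℝ u x) * inner ℝ u x * damping ε x)
    (s := Set.univ) (bound := fun _ => ‖u‖ * (1 + ε⁻¹)) Filter.univ_mem
    (Eventually.of_forall fun t => ?_) ?_ ?_ ?_ (integrable_const _) ?_).2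
  · simp only [dampedCos, hin]
    refine h.congr_deriv ?_
    rw [dampedSin, ← integral_neg]
    congr 1
    funext x
    rw [hin]
    ring
  · exact (by fun_prop : Continuous fun x : ℂ =>
      Real.cos (t * inner ℝ u x) * damping ε x).aestronglyMeasurable
  · simpa only [hin] using integrable_cos_mul_damping (μ := μ) hε (t * u)
  · exact (by fun_prop : Continuous fun x : ℂ =>
      -Real.sin (t * inner ℝ u x) * inner ℝ u x * damping ε x).aestronglyMeasurable
  · refine ae_of_all _ fun x t _ => ?_
    rw [norm_mul, norm_mul, norm_neg, Real.norm_of_nonneg (damping_pos ε x).le]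
    refine le_trans ?_ (norm_inner_mul_damping_le hε u x)
    refine mul_le_mul_of_nonneg_right ?_ (damping_pos ε x).le
    exact mul_le_of_le_one_left (abs_nonneg _) (Real.abs_sin_le_one _)
  · refine ae_of_all _ fun x t _ => ?_
    refine HasDerivAt.mul_const ?_ _
    exact (Real.hasDerivAt_cos _).comp t (hasDerivAt_mul_const _)

lemma exists_ne_zero_dampedCos_ne_zero (hε : 0 < ε) : ∃ u : ℂ, u ≠ 0 ∧ dampedCos μ ε u ≠ 0 := by
  have h := (continuous_dampedCos (μ := μ) hε).continuousAt.eventually_ne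
    (dampedCos_zero_pos (μ := μ) hε).ne'
  have h2 : ∀ᶠ u in 𝓝[≠] (0 : ℂ), u ≠ 0 ∧ dampedCos μ ε u ≠ 0 :=
    (eventually_mem_nhdsWithin).and (h.filter_mono nhdsWithin_le_nhds)
  exact h2.exists

/-- Along the ray `t ↦ t * u` the hypothesis reads `φ' = -r t ‖u‖² φ`. The product of `φ` with the
integrating factor `exp (r t² ‖u‖² / 2)` is constant, and is compared at `t = 0` and `t = 1`. -/
lemma dampedCos_eq_of_dampedSin_eq (hε : 0 < ε) {r : ℝ}
    (h : ∀ u, dampedSin μ ε u u = r * ‖u‖ ^ 2 * dampedCos μ ε u) (u : ℂ) :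
    dampedCos μ ε u = dampedCos μ ε 0 * Real.exp (-(r * ‖u‖ ^ 2 / 2)) := by
  have hs : ∀ t : ℝ, dampedSin μ ε (t * u) u = r * t * ‖u‖ ^ 2 * dampedCos μ ε (t * u) := by
    intro t
    by_cases ht : t = 0
    · simp [ht, dampedSin]
    · have e : dampedSin μ ε (t * u) (t * u) = t * dampedSin μ ε (t * u) u := by
        simp only [dampedSin]
        rw [← integral_const_mul]
        congr 1
        funext x
        rw [← Complex.real_smul, real_inner_smul_left]
        ring
      have h1 := h (t * u)
      rw [e, norm_mul, Complex.norm_real, Real.norm_eq_abs, mul_pow, sq_abs] at h1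
      refine mul_left_cancel₀ ht ?_
      rw [h1]
      ring
  have hder : ∀ t : ℝ, HasDerivAt (fun t : ℝ => dampedCos μ ε (t * u) *
      Real.exp (r * t ^ 2 * ‖u‖ ^ 2 / 2)) 0 t := by
    intro t
    have h1 := hasDerivAt_dampedCos (μ := μ) hε u t
    have h2 : HasDerivAt (fun t : ℝ => r * t ^ 2 * ‖u‖ ^ 2 / 2) (r * t * ‖u‖ ^ 2) t := by
      have := (((hasDerivAt_pow 2 t).const_mul r).mul_const (‖u‖ ^ 2)).div_const 2
      refine this.congr_deriv ?_
      simp only [Nat.add_one_sub_one, pow_one, Nat.cast_ofNat]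
      ring
    refine (h1.mul h2.exp).congr_deriv ?_
    rw [hs]
    ring
  have hconst := is_const_of_deriv_eq_zero (fun t => (hder t).differentiableAt)
    (fun t => (hder t).deriv) 1 0
  simp only [Complex.ofReal_one, one_mul, Complex.ofReal_zero, zero_mul, one_pow, mul_one,
    ne_eq, OfNat.ofNat_ne_zero, not_false_eq_true, zero_pow, mul_zero, zero_div,
    Real.exp_zero] at hconst
  rw [Real.exp_neg, ← hconst, mul_assoc, mul_inv_cancel₀ (Real.exp_pos _).ne', mul_one]

/-- Separation of variables: fixing one argument where the damped characteristic function is nonzero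
shows that `dampedSin` is `r * ‖u‖ ^ 2` times `dampedCos`, with the same `r` for both laws. -/
lemma exists_dampedCos_eq {ν : Measure ℂ} [IsProbabilityMeasure ν] (hε : 0 < ε)
    (h : ∀ u v, ‖u‖ ^ 2 * dampedCos μ ε u * dampedSin ν ε v v =
      ‖v‖ ^ 2 * dampedCos ν ε v * dampedSin μ ε u u) :
    ∃ r, 0 ≤ r ∧ (∀ u, dampedCos μ ε u = dampedCos μ ε 0 * Real.exp (-(r * ‖u‖ ^ 2 / 2))) ∧
      ∀ u, dampedCos ν ε u = dampedCos ν ε 0 * Real.exp (-(r * ‖u‖ ^ 2 / 2)) := by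
  obtain ⟨u₀, hu₀, hu₀'⟩ := exists_ne_zero_dampedCos_ne_zero (μ := μ) hε
  obtain ⟨v₀, hv₀, hv₀'⟩ := exists_ne_zero_dampedCos_ne_zero (μ := ν) hε
  have hu₁ : ‖u₀‖ ≠ 0 := norm_ne_zero_iff.mpr hu₀
  have hv₁ : ‖v₀‖ ≠ 0 := norm_ne_zero_iff.mpr hv₀
  set r := dampedSin ν ε v₀ v₀ / (‖v₀‖ ^ 2 * dampedCos ν ε v₀) with hr
  have hμ : ∀ u, dampedSin μ ε u u = r * ‖u‖ ^ 2 * dampedCos μ ε u := by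
    intro u
    rw [hr]
    field_simp
    linear_combination -h u v₀
  have hr' : r = dampedSin μ ε u₀ u₀ / (‖u₀‖ ^ 2 * dampedCos μ ε u₀) := by
    rw [hμ u₀]
    field_simp
  have hν : ∀ v, dampedSin ν ε v v = r * ‖v‖ ^ 2 * dampedCos ν ε v := by
    intro v
    rw [hr']
    field_simp
    linear_combination h u₀ v
  have hμ' := dampedCos_eq_of_dampedSin_eq hε hμ
  refine ⟨r, ?_, hμ', dampedCos_eq_of_dampedSin_eq hε hν⟩
  -- The damped characteristic function is largest at `0`, which gives the sign of `r`.
  have h1 := dampedCos_le (μ := μ) hε 1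
  rw [hμ' 1, mul_le_iff_le_one_right (dampedCos_zero_pos hε), Real.exp_le_one_iff] at h1
  simp at h1
  linarith

/-- Symmetry makes the characteristic function equal to its conjugate, so only the cosine part
remains. -/
lemma charFun_eq_integral_cos (hμ : μ.map (fun x => -x) = μ) (u : ℂ) :
    charFun μ u = ((∫ x, Real.cos (inner ℝ u x) ∂μ : ℝ) : ℂ) := by
  have hc : Continuous fun x : ℂ => Complex.exp (inner ℝ x u * Complex.I) := by fun_prop
  have hi : Integrable (fun x : ℂ => Complex.exp (inner ℝ x u * Complex.I)) μ :=
    Integrable.of_bound hc.aestronglyMeasurable 1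
      (ae_of_all _ fun x => (Complex.norm_exp_ofReal_mul_I _).le)
  have him : (charFun μ u).im = 0 := by
    have h1 : charFun μ (-u) = charFun μ u := by
      conv_rhs => rw [← hμ, charFun_apply, integral_map measurable_neg.aemeasurable
        hc.aestronglyMeasurable]
      simp [charFun_apply]
    rw [charFun_neg] at h1
    exact Complex.conj_eq_iff_im.mp h1
  apply Complex.ext
  · rw [Complex.ofReal_re, charFun_apply]
    have := integral_re hi
    simp only [RCLike.re_to_complex] at this
    rw [← this]
    congr 1
    funext x
    rw [Complex.exp_ofReal_mul_I_re, real_inner_comm]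
  · rw [Complex.ofReal_im, him]

lemma tendsto_dampedCos (hμ : μ.map (fun x => -x) = μ) (u : ℂ) :
    Tendsto (fun N : ℕ => ((dampedCos μ (1 / ((N : ℝ) + 1)) u : ℝ) : ℂ)) atTop
      (𝓝 (charFun μ u)) := by
  rw [charFun_eq_integral_cos hμ]
  refine (Complex.continuous_ofReal.tendsto _).comp ?_
  refine tendsto_integral_of_dominated_convergence (fun _ => 1) (fun N => ?_)
    (integrable_const _) (fun N => ae_of_all _ fun x => ?_) (ae_of_all _ fun x => ?_)
  · exact (integrable_cos_mul_damping (by positivity) u).aestronglyMeasurable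
  · rw [norm_mul, Real.norm_of_nonneg (damping_pos _ x).le]
    exact mul_le_one₀ (Real.abs_cos_le_one _) (damping_pos _ x).le
      (damping_le_one (by positivity) x)
  · have h1 : Tendsto (fun N : ℕ => damping (1 / ((N : ℝ) + 1)) x) atTop (𝓝 1) := by
      have h2 := (((tendsto_one_div_add_atTop_nhds_zero_nat (𝕜 := ℝ)).mul_const
        (‖x‖ ^ 2)).neg).rexp
      simpa [damping] using h2
    simpa using h1.const_mul (Real.cos (inner ℝ u x))

/-- Two symmetric laws whose damped characteristic functions are linked by the functional equation
are the same circular Gaussian law. -/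
lemma isCircularGaussianCharFun_of_damped {ν : Measure ℂ} [IsProbabilityMeasure ν]
    (hμ : μ.map (fun x => -x) = μ) (hν : ν.map (fun x => -x) = ν)
    (h : ∀ ε, 0 < ε → ∀ u v, ‖u‖ ^ 2 * dampedCos μ ε u * dampedSin ν ε v v =
      ‖v‖ ^ 2 * dampedCos ν ε v * dampedSin μ ε u u) :
    IsCircularGaussianCharFun (charFun μ) ∧ charFun μ = charFun ν := by
  have hε : ∀ N : ℕ, 0 < 1 / ((N : ℝ) + 1) := fun N => by positivity
  choose r hr h1 h2 using fun N : ℕ => exists_dampedCos_eq (μ := μ) (ν := ν) (hε N) (h _ (hε N))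
  refine ⟨IsCircularGaussianCharFun.of_tendsto continuous_charFun.continuousAt (by simp)
    (fun N => ⟨dampedCos μ (1 / ((N : ℝ) + 1)) 0, r N, hr N, fun w => ?_⟩)
    (tendsto_dampedCos hμ), funext fun u => ?_⟩
  · rw [← h1 N w]
  -- For each damping the two functions share the exponent `r N` and differ only by the ratio of
  -- their values at `0`; that ratio tends to `1`.
  · have hμ0 := tendsto_dampedCos hμ 0
    have hν0 := tendsto_dampedCos hν 0
    simp only [charFun_zero, probReal_univ, Complex.ofReal_one] at hμ0 hν0
    have hq := (hν0.div hμ0 one_ne_zero).mul (tendsto_dampedCos hμ u)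
    rw [div_one, one_mul] at hq
    refine tendsto_nhds_unique (hq.congr fun N => ?_) (tendsto_dampedCos hν u)
    have h0 : ((dampedCos μ (1 / ((N : ℝ) + 1)) 0 : ℝ) : ℂ) ≠ 0 := by
      exact_mod_cast (dampedCos_zero_pos (hε N)).ne'
    simp only [Pi.div_apply]
    rw [h1 N u, h2 N u]
    push_cast
    field_simp

end Damped

/-! ### Product laws invariant under curves of unitary matrices, and the resulting functional
equation. -/

section Rotations

open scoped Matrix

variable {ι : Type*} [Fintype ι] {μ : ι → Measure ℂ}
  [∀ i, IsProbabilityMeasure (μ i)] {ε : ℝ}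

/-- The damping factor of a vector. -/
def vecDamping (ε : ℝ) (x : ι → ℂ) : ℝ := ∏ i, damping ε (x i)

lemma vecDamping_pos (ε : ℝ) (x : ι → ℂ) : 0 < vecDamping ε x :=
  Finset.prod_pos fun i _ => damping_pos ε (x i)

lemma continuous_vecDamping (ε : ℝ) : Continuous (vecDamping (ι := ι) ε) :=
  continuous_finsetProd _ fun i _ => (continuous_damping ε).comp (continuous_apply i)

/-- The damping is used in both forms: as a function of the norm it is invariant under unitary
matrices, as a product it respects independence. -/
lemma vecDamping_eq (ε : ℝ) (x : ι → ℂ) :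
    vecDamping ε x = Real.exp (-(ε * ∑ i, ‖x i‖ ^ 2)) := by
  simp only [vecDamping, damping, ← Real.exp_sum, Finset.sum_neg_distrib, Finset.mul_sum]

variable [DecidableEq ι]

lemma vecDamping_le (hε : 0 < ε) (x : ι → ℂ) (l : ι) : vecDamping ε x ≤ damping ε (x l) := by
  rw [vecDamping, ← Finset.mul_prod_erase _ _ (Finset.mem_univ l)]
  exact mul_le_of_le_one_right (damping_pos ε _).le
    (Finset.prod_le_one (fun i _ => (damping_pos ε _).le) fun i _ => damping_le_one hε _)

lemma norm_mul_vecDamping_le (hε : 0 < ε) (x : ι → ℂ) (l : ι) :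
    ‖x l‖ * vecDamping ε x ≤ 1 + ε⁻¹ :=
  (mul_le_mul_of_nonneg_left (vecDamping_le hε x l) (norm_nonneg _)).trans
    (norm_mul_damping_le hε (x l))

lemma integrable_mul_inner_mul_vecDamping (hε : 0 < ε) {f : (ι → ℂ) → ℝ} (hf : Continuous f)
    (hf1 : ∀ x, |f x| ≤ 1) (y : ℂ) (l : ι) :
    Integrable (fun x => f x * inner ℝ y (x l) * vecDamping ε x) (Measure.pi μ) := by
  have hd := continuous_vecDamping (ι := ι) ε
  refine Integrable.of_bound (C := ‖y‖ * (1 + ε⁻¹))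
    (by fun_prop : Continuous fun x : ι → ℂ =>
      f x * inner ℝ y (x l) * vecDamping ε x).aestronglyMeasurable (ae_of_all _ fun x => ?_)
  rw [norm_mul, norm_mul, Real.norm_of_nonneg (vecDamping_pos ε x).le]
  calc ‖f x‖ * ‖(inner ℝ y (x l) : ℝ)‖ * vecDamping ε x
      ≤ 1 * (‖y‖ * ‖x l‖) * vecDamping ε x := by
        refine mul_le_mul_of_nonneg_right ?_ (vecDamping_pos ε x).le
        exact mul_le_mul (hf1 x) (norm_inner_le_norm _ _) (norm_nonneg _) zero_le_one
    _ = ‖y‖ * (‖x l‖ * vecDamping ε x) := by ring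
    _ ≤ _ := mul_le_mul_of_nonneg_left (norm_mul_vecDamping_le hε x l) (norm_nonneg _)

/-- `D` collects the damped masses of the remaining coordinates. It depends on neither `f` nor `h`
and is positive, so it can be cancelled. -/
lemma exists_integral_pi_eq (hε : 0 < ε) {j k : ι} (hjk : j ≠ k) : ∃ D, 0 < D ∧
    ∀ f h : ℂ → ℝ, ∫ x, f (x j) * h (x k) * vecDamping ε x ∂Measure.pi μ =
      (∫ y, f y * damping ε y ∂μ j) * (∫ y, h y * damping ε y ∂μ k) * D := by
  refine ⟨∏ l ∈ (Finset.univ.erase j).erase k, dampedCos (μ l) ε 0,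
    Finset.prod_pos fun l _ => dampedCos_zero_pos hε, fun f h => ?_⟩
  have hkm : k ∈ Finset.univ.erase j := Finset.mem_erase.mpr ⟨hjk.symm, Finset.mem_univ k⟩
  let F : ι → ℂ → ℝ := fun l y => (if l = j then f y else if l = k then h y else 1) * damping ε y
  have e : ∀ x : ι → ℂ, f (x j) * h (x k) * vecDamping ε x = ∏ l, F l (x l) := by
    intro x
    simp only [F, Finset.prod_mul_distrib, vecDamping]
    congr 1
    rw [← Finset.mul_prod_erase _ _ (Finset.mem_univ j), ← Finset.mul_prod_erase _ _ hkm,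
      Finset.prod_eq_one, if_pos rfl, if_neg hjk.symm, if_pos rfl, mul_one]
    intro l hl
    simp only [Finset.mem_erase] at hl
    rw [if_neg hl.2.1, if_neg hl.1]
  simp_rw [e]
  rw [integral_fintype_prod_eq_prod, ← Finset.mul_prod_erase _ _ (Finset.mem_univ j),
    ← Finset.mul_prod_erase _ _ hkm, ← mul_assoc]
  congr 1
  · simp only [F, if_pos, if_neg hjk.symm]
  · refine Finset.prod_congr rfl fun l hl => ?_
    simp only [Finset.mem_erase] at hl
    simp only [F, if_neg hl.2.1, if_neg hl.1, dampedCos, inner_zero_left, Real.cos_zero]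

lemma integral_pi_eq_zero_of_odd (hsymm : ∀ i, (μ i).map (fun x => -x) = μ i) (k : ι)
    {F : (ι → ℂ) → ℝ} (hF : Continuous F)
    (hodd : ∀ x, F (fun i => if i = k then -x i else x i) = -F x) :
    ∫ x, F x ∂Measure.pi μ = 0 := by
  have hp : MeasurePreserving (fun (x : ι → ℂ) i => if i = k then -x i else x i)
      (Measure.pi μ) (Measure.pi μ) := by
    refine measurePreserving_pi μ μ (f := fun i (y : ℂ) => if i = k then -y else y) fun i => ?_
    by_cases h : i = k
    · simp only [if_pos h]
      exact ⟨measurable_neg, hsymm i⟩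
    · simp only [if_neg h]
      exact MeasurePreserving.id _
  have h1 := integral_map (μ := Measure.pi μ) hp.measurable.aemeasurable (f := F)
    hF.aestronglyMeasurable
  rw [hp.map_eq] at h1
  simp_rw [hodd, integral_neg] at h1
  linarith

variable {U : ℝ → Matrix ι ι ℂ} {A : Matrix ι ι ℂ}

lemma abs_sin_mul_sin_sub_le (a b a' b' : ℝ) :
    |Real.sin a' * Real.sin b' - Real.sin a * Real.sin b| ≤ |a' - a| + |b' - b| := by
  have h1 : Real.sin a' * Real.sin b' - Real.sin a * Real.sin b =
      (Real.sin a' - Real.sin a) * Real.sin b' + Real.sin a * (Real.sin b' - Real.sin b) := by ring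
  have hlip : ∀ a b, |Real.sin a - Real.sin b| ≤ |a - b| := fun a b => by
    have := Real.lipschitzWith_sin.dist_le_mul a b
    simpa [Real.dist_eq] using this
  rw [h1]
  refine (abs_add_le _ _).trans (add_le_add ?_ ?_)
  · rw [abs_mul]
    exact (mul_le_of_le_one_right (abs_nonneg _) (Real.abs_sin_le_one _)).trans (hlip _ _)
  · rw [abs_mul]
    exact (mul_le_of_le_one_left (abs_nonneg _) (Real.abs_sin_le_one _)).trans (hlip _ _)

/-- Differentiating the invariance of the law under the curve `U`. -/
lemma integral_deriv_eq_zero (hε : 0 < ε) (hU0 : U 0 = 1)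
    (hA : ∀ i j, HasDerivAt (fun t => U t i j) (A i j) 0)
    (hnorm : ∀ t x, ∑ i, ‖(U t *ᵥ x) i‖ ^ 2 = ∑ i, ‖x i‖ ^ 2)
    (hinv : ∀ t, (Measure.pi μ).map (fun x => U t *ᵥ x) = Measure.pi μ) (j k : ι) (u v : ℂ) :
    ∫ x, (Real.cos (inner ℝ u (x j)) * inner ℝ u ((A *ᵥ x) j) * Real.sin (inner ℝ v (x k)) +
      Real.sin (inner ℝ u (x j)) * (Real.cos (inner ℝ v (x k)) * inner ℝ v ((A *ᵥ x) k))) *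
        vecDamping ε x ∂Measure.pi μ = 0 := by
  have hd := continuous_vecDamping (ι := ι) ε
  have hmv : ∀ (B : Matrix ι ι ℂ), Continuous fun x : ι → ℂ => B *ᵥ x := fun B => by fun_prop
  have hmv' : ∀ (B : Matrix ι ι ℂ) i, Continuous fun x : ι → ℂ => (B *ᵥ x) i := fun B i =>
    (continuous_apply i).comp (hmv B)
  -- A product of sines, so that after differentiation parity kills all terms except those with the
  -- entries `A j k` and `A k j`.
  let S : (ι → ℂ) → ℝ := fun x => Real.sin (inner ℝ u (x j)) * Real.sin (inner ℝ v (x k))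
  have hS : Continuous S := by fun_prop
  have hSW : ∀ B : Matrix ι ι ℂ, Integrable (fun x => S (B *ᵥ x) * vecDamping ε x)
      (Measure.pi μ) := by
    intro B
    refine Integrable.of_bound (C := 1) ((hS.comp (hmv B)).mul hd).aestronglyMeasurable
      (ae_of_all _ fun x => ?_)
    rw [norm_mul, Real.norm_of_nonneg (vecDamping_pos ε x).le]
    refine mul_le_one₀ ?_ (vecDamping_pos ε x).le
      ((vecDamping_le hε x j).trans (damping_le_one hε _))
    rw [Real.norm_eq_abs, abs_mul]
    exact mul_le_one₀ (Real.abs_sin_le_one _) (abs_nonneg _) (Real.abs_sin_le_one _)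
  have hint : ∀ t, ∫ x, S (U t *ᵥ x) * vecDamping ε x ∂Measure.pi μ =
      ∫ x, S x * vecDamping ε x ∂Measure.pi μ := by
    intro t
    have h1 := integral_map (μ := Measure.pi μ) (hmv (U t)).measurable.aemeasurable
      (f := fun x => S x * vecDamping ε x) (hS.mul hd).aestronglyMeasurable
    rw [hinv] at h1
    rw [h1]
    congr 1
    funext x
    rw [vecDamping_eq, vecDamping_eq, hnorm]
  have hzero : ∀ t : ℝ, ∫ x, t⁻¹ * (S (U t *ᵥ x) - S x) * vecDamping ε x ∂Measure.pi μ = 0 := by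
    intro t
    have h2 : ∀ x, t⁻¹ * (S (U t *ᵥ x) - S x) * vecDamping ε x =
        t⁻¹ * (S (U t *ᵥ x) * vecDamping ε x - S x * vecDamping ε x) := fun x => by ring
    have h3 : Integrable (fun x => S x * vecDamping ε x) (Measure.pi μ) := by
      simpa only [Matrix.one_mulVec] using hSW 1
    simp_rw [h2]
    rw [integral_const_mul, integral_sub (hSW _) h3, hint, sub_self, mul_zero]
  -- Differentiability at `0` bounds the entries of `U t - 1` linearly in `t`. With the Lipschitz
  -- bound for the sine and the damping estimate, this dominates the difference quotients uniformly
  -- in `x`.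
  have hK : ∀ i l, ∃ K : ℝ, 0 ≤ K ∧ ∀ᶠ t in 𝓝 (0 : ℝ), ‖U t i l - (1 : Matrix ι ι ℂ) i l‖ ≤ K * |t| := by
    intro i l
    obtain ⟨K, hK0, hK⟩ := (hA i l).isBigO_sub.exists_nonneg
    refine ⟨K, hK0, ?_⟩
    filter_upwards [hK.bound] with t ht
    simpa [hU0] using ht
  choose K hK0 hK using hK
  have hdiff : ∀ᶠ t in 𝓝 (0 : ℝ), ∀ i x, ‖(U t *ᵥ x) i - x i‖ ≤ |t| * ∑ l, K i l * ‖x l‖ := by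
    have : ∀ᶠ t in 𝓝 (0 : ℝ), ∀ i l, ‖U t i l - (1 : Matrix ι ι ℂ) i l‖ ≤ K i l * |t| :=
      eventually_all.mpr fun i => eventually_all.mpr fun l => hK i l
    filter_upwards [this] with t ht i x
    have e : (U t *ᵥ x) i - x i = ∑ l, (U t i l - (1 : Matrix ι ι ℂ) i l) * x l := by
      conv_lhs => rw [← Matrix.one_mulVec x, Matrix.mulVec_mulVec, mul_one]
      simp only [Matrix.mulVec, dotProduct, sub_mul, Finset.sum_sub_distrib]
    rw [e, Finset.mul_sum]
    refine (norm_sum_le _ _).trans (Finset.sum_le_sum fun l _ => ?_)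
    rw [norm_mul]
    calc _ ≤ K i l * |t| * ‖x l‖ := mul_le_mul_of_nonneg_right (ht i l) (norm_nonneg _)
      _ = _ := by ring
  have hlim := tendsto_integral_filter_of_dominated_convergence (μ := Measure.pi μ)
    (l := 𝓝[≠] (0 : ℝ)) (F := fun t x => t⁻¹ * (S (U t *ᵥ x) - S x) * vecDamping ε x)
    (f := fun x => (Real.cos (inner ℝ u (x j)) * inner ℝ u ((A *ᵥ x) j) *
      Real.sin (inner ℝ v (x k)) + Real.sin (inner ℝ u (x j)) *
        (Real.cos (inner ℝ v (x k)) * inner ℝ v ((A *ᵥ x) k))) * vecDamping ε x)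
    (fun _ => ‖u‖ * ∑ l, K j l * (1 + ε⁻¹) + ‖v‖ * ∑ l, K k l * (1 + ε⁻¹))
    (Eventually.of_forall fun t => ?_) ?_ (integrable_const _) (ae_of_all _ fun x => ?_)
  · simp_rw [hzero] at hlim
    exact (tendsto_nhds_unique hlim tendsto_const_nhds)
  · exact ((continuous_const.mul ((hS.comp (hmv _)).sub hS)).mul hd).aestronglyMeasurable
  · filter_upwards [hdiff.filter_mono nhdsWithin_le_nhds, self_mem_nhdsWithin] with t ht ht0
    refine ae_of_all _ fun x => ?_
    have ht0' : |t| ≠ 0 := abs_ne_zero.mpr ht0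
    have hone : ∀ (w : ℂ) i, |inner ℝ w ((U t *ᵥ x) i) - inner ℝ w (x i)| ≤
        ‖w‖ * (|t| * ∑ l, K i l * ‖x l‖) := by
      intro w i
      rw [← inner_sub_right]
      exact (abs_real_inner_le_norm _ _).trans
        (mul_le_mul_of_nonneg_left (ht i x) (norm_nonneg _))
    have hS' : |S (U t *ᵥ x) - S x| ≤
        |t| * (‖u‖ * ∑ l, K j l * ‖x l‖ + ‖v‖ * ∑ l, K k l * ‖x l‖) := by
      refine (abs_sin_mul_sin_sub_le _ _ _ _).trans ((add_le_add (hone u j) (hone v k)).trans ?_)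
      exact le_of_eq (by ring)
    have hsum : ∀ i, (∑ l, K i l * ‖x l‖) * vecDamping ε x ≤ ∑ l, K i l * (1 + ε⁻¹) := by
      intro i
      rw [Finset.sum_mul]
      refine Finset.sum_le_sum fun l _ => ?_
      rw [mul_assoc]
      exact mul_le_mul_of_nonneg_left (norm_mul_vecDamping_le hε x l) (hK0 i l)
    rw [norm_mul, norm_mul, Real.norm_of_nonneg (vecDamping_pos ε x).le, norm_inv,
      Real.norm_eq_abs, Real.norm_eq_abs]
    calc |t|⁻¹ * |S (U t *ᵥ x) - S x| * vecDamping ε x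
        ≤ |t|⁻¹ * (|t| * (‖u‖ * ∑ l, K j l * ‖x l‖ + ‖v‖ * ∑ l, K k l * ‖x l‖)) *
          vecDamping ε x := by
          refine mul_le_mul_of_nonneg_right ?_ (vecDamping_pos ε x).le
          exact mul_le_mul_of_nonneg_left hS' (by positivity)
      _ = ‖u‖ * ((∑ l, K j l * ‖x l‖) * vecDamping ε x) +
          ‖v‖ * ((∑ l, K k l * ‖x l‖) * vecDamping ε x) := by
          rw [inv_mul_cancel_left₀ ht0']; ring
      _ ≤ _ := add_le_add (mul_le_mul_of_nonneg_left (hsum j) (norm_nonneg _))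
          (mul_le_mul_of_nonneg_left (hsum k) (norm_nonneg _))
  · refine Tendsto.mul_const _ ?_
    have hmvd : ∀ i, HasDerivAt (fun t => (U t *ᵥ x) i) ((A *ᵥ x) i) 0 := fun i =>
      HasDerivAt.fun_sum fun l _ => (hA i l).mul_const _
    have hin : ∀ (w : ℂ) i, HasDerivAt (fun t => (inner ℝ w ((U t *ᵥ x) i) : ℝ))
        (inner ℝ w ((A *ᵥ x) i)) 0 := fun w i => by
      have := (hasDerivAt_const (0 : ℝ) w).inner ℝ (hmvd i)
      simpa using this
    have h1 := ((hin u j).sin.mul (hin v k).sin)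
    rw [hasDerivAt_iff_tendsto_slope] at h1
    simp only [hU0, Matrix.one_mulVec] at h1
    refine h1.congr fun t => ?_
    simp [slope_def_field, S, hU0, Pi.mul_apply]
    ring

lemma real_inner_mul_right (u c x : ℂ) : inner ℝ u (c * x) = (inner ℝ (star c * u) x : ℝ) := by
  simp [Complex.inner]
  ring

/-- The functional equation linking the damped characteristic functions of two coordinates. -/
lemma dampedCos_mul_dampedSin_add (hε : 0 < ε) (hU0 : U 0 = 1)
    (hA : ∀ i j, HasDerivAt (fun t => U t i j) (A i j) 0)
    (hnorm : ∀ t x, ∑ i, ‖(U t *ᵥ x) i‖ ^ 2 = ∑ i, ‖x i‖ ^ 2)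
    (hinv : ∀ t, (Measure.pi μ).map (fun x => U t *ᵥ x) = Measure.pi μ)
    (hsymm : ∀ i, (μ i).map (fun x => -x) = μ i) {j k : ι} (hjk : j ≠ k) (u v : ℂ) :
    dampedCos (μ j) ε u * dampedSin (μ k) ε v (star (A j k) * u) +
      dampedSin (μ j) ε u (star (A k j) * v) * dampedCos (μ k) ε v = 0 := by
  have hd := continuous_vecDamping (ι := ι) ε
  have h := integral_deriv_eq_zero hε hU0 hA hnorm hinv j k u v
  let g₁ : (ι → ℂ) → ℝ := fun x => Real.cos (inner ℝ u (x j)) * Real.sin (inner ℝ v (x k))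
  let g₂ : (ι → ℂ) → ℝ := fun x => Real.sin (inner ℝ u (x j)) * Real.cos (inner ℝ v (x k))
  have hg₁ : Continuous g₁ := by fun_prop
  have hg₂ : Continuous g₂ := by fun_prop
  have hb₁ : ∀ x, |g₁ x| ≤ 1 := fun x => by
    rw [abs_mul]
    exact mul_le_one₀ (Real.abs_cos_le_one _) (abs_nonneg _) (Real.abs_sin_le_one _)
  have hb₂ : ∀ x, |g₂ x| ≤ 1 := fun x => by
    rw [abs_mul]
    exact mul_le_one₀ (Real.abs_sin_le_one _) (abs_nonneg _) (Real.abs_cos_le_one _)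
  have e : ∀ x : ι → ℂ, (Real.cos (inner ℝ u (x j)) * inner ℝ u ((A *ᵥ x) j) *
      Real.sin (inner ℝ v (x k)) + Real.sin (inner ℝ u (x j)) *
        (Real.cos (inner ℝ v (x k)) * inner ℝ v ((A *ᵥ x) k))) * vecDamping ε x =
      ∑ l, g₁ x * inner ℝ (star (A j l) * u) (x l) * vecDamping ε x +
        ∑ l, g₂ x * inner ℝ (star (A k l) * v) (x l) * vecDamping ε x := by
    intro x
    simp only [Matrix.mulVec, dotProduct, inner_sum, real_inner_mul_right, g₁, g₂, Finset.mul_sum,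
      Finset.sum_mul, add_mul]
    congr 1 <;> exact Finset.sum_congr rfl fun l _ => by ring
  have hi₁ := fun l => integrable_mul_inner_mul_vecDamping (μ := μ) hε hg₁ hb₁ (star (A j l) * u) l
  have hi₂ := fun l => integrable_mul_inner_mul_vecDamping (μ := μ) hε hg₂ hb₂ (star (A k l) * v) l
  simp_rw [e] at h
  rw [integral_add (integrable_finsetSum _ fun l _ => hi₁ l)
    (integrable_finsetSum _ fun l _ => hi₂ l), integral_finsetSum _ fun l _ => hi₁ l,
    integral_finsetSum _ fun l _ => hi₂ l] at h
  have hdflip : ∀ (m : ι) (x : ι → ℂ),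
      vecDamping ε (fun i => if i = m then -x i else x i) = vecDamping ε x := by
    intro m x
    simp only [vecDamping, damping]
    refine Finset.prod_congr rfl fun i _ => ?_
    split_ifs <;> simp
  -- `g₁` is odd in `x k` and `g₂` is odd in `x j`; multiplied by another coordinate they stay odd
  -- and integrate to `0`, by symmetry of the marginal laws.
  rw [Finset.sum_eq_single k _ (by simp), Finset.sum_eq_single j _ (by simp)] at h
  · obtain ⟨D, hD, hprod⟩ := exists_integral_pi_eq (μ := μ) hε hjk
    have h1 : ∫ x, g₁ x * inner ℝ (star (A j k) * u) (x k) * vecDamping ε x ∂Measure.pi μ =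
        dampedCos (μ j) ε u * dampedSin (μ k) ε v (star (A j k) * u) * D := by
      rw [dampedCos, dampedSin, ← hprod (fun y => Real.cos (inner ℝ u y))
        (fun y => inner ℝ (star (A j k) * u) y * Real.sin (inner ℝ v y))]
      congr 1
      funext x
      simp only [g₁]
      ring
    have h2 : ∫ x, g₂ x * inner ℝ (star (A k j) * v) (x j) * vecDamping ε x ∂Measure.pi μ =
        dampedSin (μ j) ε u (star (A k j) * v) * dampedCos (μ k) ε v * D := by
      rw [dampedCos, dampedSin, ← hprod
        (fun y => inner ℝ (star (A k j) * v) y * Real.sin (inner ℝ u y))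
        (fun y => Real.cos (inner ℝ v y))]
      congr 1
      funext x
      simp only [g₂]
      ring
    rw [h1, h2, ← add_mul] at h
    exact (mul_eq_zero.mp h).resolve_right hD.ne'
  · intro l _ hl
    refine integral_pi_eq_zero_of_odd hsymm j (by fun_prop) fun x => ?_
    simp only [g₂, hdflip, if_true, if_neg hl, if_neg hjk.symm, inner_neg_right, Real.sin_neg]
    ring
  · intro l _ hl
    refine integral_pi_eq_zero_of_odd hsymm k (by fun_prop) fun x => ?_
    simp only [g₁, hdflip, if_true, if_neg hl, if_neg hjk, inner_neg_right, Real.sin_neg]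
    ring

/-- The data used to link two coordinates of a random vector: for each phase `κ`, a curve of norm
preserving matrices leaving the law invariant, rotating the coordinates into each other. -/
structure LinkedByRotations (μ : ι → Measure ℂ) (j k : ι) (κ : ℂ) (r : ℝ) (U : ℝ → Matrix ι ι ℂ)
    (A : Matrix ι ι ℂ) : Prop where
  zero : U 0 = 1
  deriv : ∀ i j, HasDerivAt (fun t => U t i j) (A i j) 0
  norm : ∀ t x, ∑ i, ‖(U t *ᵥ x) i‖ ^ 2 = ∑ i, ‖x i‖ ^ 2
  invariant : ∀ t, (Measure.pi μ).map (fun x => U t *ᵥ x) = Measure.pi μ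
  above : A j k = star κ * r
  below : A k j = -(κ * r)

lemma dampedSin_ofReal_mul {ν : Measure ℂ} (v y : ℂ) (s : ℝ) :
    dampedSin ν ε v (s * y) = s * dampedSin ν ε v y := by
  simp only [dampedSin]
  rw [← integral_const_mul]
  congr 1
  funext x
  rw [← Complex.real_smul, real_inner_smul_left]
  ring

/-- Two independent symmetric coordinates linked by rotations have the same circular Gaussian
law. -/
lemma isCircularGaussianCharFun_of_linkedByRotations
    (hsymm : ∀ i, (μ i).map (fun x => -x) = μ i) {j k : ι} (hjk : j ≠ k) {r : ℝ} (hr : 0 < r)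
    (h : ∀ κ : ℂ, star κ * κ = 1 → ∃ U A, LinkedByRotations μ j k κ r U A) :
    IsCircularGaussianCharFun (charFun (μ j)) ∧ charFun (μ j) = charFun (μ k) := by
  refine isCircularGaussianCharFun_of_damped (hsymm j) (hsymm k) fun ε hε u v => ?_
  have hs0 : ∀ (ν : Measure ℂ), dampedSin ν ε 0 0 = 0 := fun ν => by simp [dampedSin]
  by_cases hu : u = 0
  · simp [hu, hs0]
  by_cases hv : v = 0
  · simp [hv, hs0]
  have hu' : (‖u‖ : ℂ) ≠ 0 := by simpa using hu
  have hv' : (‖v‖ : ℂ) ≠ 0 := by simpa using hv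
  have huu : star u * u = (‖u‖ : ℂ) ^ 2 := Complex.conj_mul' u
  have hvv : star v * v = (‖v‖ : ℂ) ^ 2 := Complex.conj_mul' v
  -- The phase `κ = v ū / (‖u‖ ‖v‖)` turns the direction of `u` into that of `v`. The directions in
  -- the functional equation then become real multiples of `v` and of `u`, and only radial
  -- derivatives remain.
  have hstar : star (v * star u / (‖u‖ * ‖v‖ : ℂ)) = star v * u / (‖u‖ * ‖v‖ : ℂ) := by
    simp
  have hκ : star (v * star u / (‖u‖ * ‖v‖ : ℂ)) * (v * star u / (‖u‖ * ‖v‖ : ℂ)) = 1 := by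
    rw [hstar]
    field_simp
    linear_combination (star u * u) * hvv + (‖v‖ : ℂ) ^ 2 * huu
  obtain ⟨U, A, hUA⟩ := h _ hκ
  have key := dampedCos_mul_dampedSin_add hε hUA.zero hUA.deriv hUA.norm hUA.invariant hsymm hjk u v
  have h1 : star (A j k) * u = ((r * ‖u‖ / ‖v‖ : ℝ) : ℂ) * v := by
    rw [hUA.above, star_mul', star_star, Complex.star_def, Complex.conj_ofReal]
    push_cast
    have huu' : (starRingEnd ℂ) u * u = (‖u‖ : ℂ) ^ 2 := huu
    field_simp
    linear_combination (r : ℂ) * huu'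
  have h2 : star (A k j) * v = ((-(r * ‖v‖ / ‖u‖) : ℝ) : ℂ) * u := by
    rw [hUA.below, star_neg, star_mul', hstar, Complex.star_def, Complex.conj_ofReal]
    push_cast
    have hvv' : (starRingEnd ℂ) v * v = (‖v‖ : ℂ) ^ 2 := hvv
    field_simp
    linear_combination -(r : ℂ) * hvv'
  rw [h1, h2, dampedSin_ofReal_mul, dampedSin_ofReal_mul] at key
  have hu2 : ‖u‖ ≠ 0 := norm_ne_zero_iff.mpr hu
  have hv2 : ‖v‖ ≠ 0 := norm_ne_zero_iff.mpr hv
  field_simp at key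
  refine mul_left_cancel₀ hr.ne' ?_
  linear_combination key

end Rotations

section Fields

variable {Ω : Type*} [MeasurableSpace Ω] {P : Measure Ω} {X Y : Ω → SU2 → ℂ}

/-! ### Square integrable fields and their coefficients -/

namespace IsSquareIntegrableField

lemma measurable_eval (hX : IsSquareIntegrableField P X) (g : SU2) : Measurable fun ω => X ω g :=
  hX.1.comp measurable_prodMk_right

lemma measurable_field (hX : IsSquareIntegrableField P X) : Measurable fun ω (p : SU2) => X ω p :=
  measurable_pi_iff.mpr hX.measurable_eval

lemma ae_integrable (hX : IsSquareIntegrableField P X) :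
    ∀ᵐ ω ∂P, Integrable (X ω) sphereVolume := by
  filter_upwards [hX.2] with ω hω
  exact hω.integrable one_le_two

lemma measurable_mul_harmonic (hX : IsSquareIntegrableField P X) (k : WignerIndex) :
    Measurable (Function.uncurry fun ω g =>
      X ω g * star (hypersphericalHarmonic k.1 k.2.1 k.2.2 g)) :=
  hX.1.mul ((continuous_hypersphericalHarmonic k.1 k.2.1 k.2.2).star.measurable.comp measurable_snd)

lemma measurable_spectralCoeff (hX : IsSquareIntegrableField P X) (k : WignerIndex) :
    Measurable (spectralCoeff X k) :=
  ((hX.measurable_mul_harmonic k).stronglyMeasurable.integral_prod_right).measurable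

lemma measurable_spectralCoeffs (hX : IsSquareIntegrableField P X) :
    Measurable fun ω k => spectralCoeff X k ω :=
  measurable_pi_iff.mpr hX.measurable_spectralCoeff

lemma comp_measurePreserving (hX : IsSquareIntegrableField P X) {f : SU2 → SU2}
    (hf : MeasurePreserving f sphereVolume sphereVolume) :
    IsSquareIntegrableField P fun ω p => X ω (f p) := by
  refine ⟨hX.1.comp (measurable_fst.prodMk (hf.measurable.comp measurable_snd)), ?_⟩
  filter_upwards [hX.2] with ω hω
  exact hω.comp_measurePreserving hf

lemma left_translate (hX : IsSquareIntegrableField P X) (g : SU2) :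
    IsSquareIntegrableField P fun ω p => X ω (g⁻¹ * p) :=
  hX.comp_measurePreserving (measurePreserving_mul_left sphereVolume g⁻¹)

lemma right_translate (hX : IsSquareIntegrableField P X) (g : SU2) :
    IsSquareIntegrableField P fun ω p => X ω (p * g) :=
  hX.comp_measurePreserving (measurePreserving_mul_right sphereVolume g)

lemma spectralCoeff_left_translate (hX : IsSquareIntegrableField P X) (g : SU2) :
    ∀ᵐ ω ∂P, ∀ (n : ℕ) (i j : Fin (n + 1)),
      spectralCoeff (fun ω p => X ω (g⁻¹ * p)) ⟨n, i, j⟩ ω =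
        ∑ m, star (wignerD n i m g) * spectralCoeff X ⟨n, m, j⟩ ω := by
  filter_upwards [hX.ae_integrable] with ω hω n i j
  exact fourierCoefficient_left_translate hω g n i j

lemma spectralCoeff_right_translate (hX : IsSquareIntegrableField P X) (g : SU2) :
    ∀ᵐ ω ∂P, ∀ (n : ℕ) (i j : Fin (n + 1)),
      spectralCoeff (fun ω p => X ω (p * g)) ⟨n, i, j⟩ ω =
        ∑ m, wignerD n j m g * spectralCoeff X ⟨n, i, m⟩ ω := by
  filter_upwards [hX.ae_integrable] with ω hω n i j
  exact fourierCoefficient_right_translate hω g n i j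

end IsSquareIntegrableField

lemma integral_sphereVolume (f : SU2 → ℂ) :
    ∫ g, f g ∂sphereVolume = (16 * Real.pi ^ 2 : ℝ) •
      ∫ g, f g ∂Measure.haarMeasure (⊤ : TopologicalSpace.PositiveCompacts SU2) := by
  rw [sphereVolume, integral_smul_measure, ENNReal.toReal_ofReal (by positivity)]

instance haarMeasure_top_isProbabilityMeasure :
    IsProbabilityMeasure (Measure.haarMeasure (⊤ : TopologicalSpace.PositiveCompacts SU2)) :=
  ⟨Measure.haarMeasure_self⟩

lemma integrable_haar_of_sphereVolume {f : SU2 → ℂ} (hf : Integrable f sphereVolume) :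
    Integrable f (Measure.haarMeasure (⊤ : TopologicalSpace.PositiveCompacts SU2)) := by
  rwa [sphereVolume, integrable_smul_measure (by simp) ENNReal.ofReal_ne_top] at hf

lemma measurable_reconstruct (hX : IsSquareIntegrableField P X) (N : ℕ) :
    Measurable fun q : SU2 × Ω => reconstruct N (fun k => spectralCoeff X k q.2) q.1 :=
  Finset.measurable_fun_sum _ fun k _ => ((hX.measurable_spectralCoeff k).comp measurable_snd).mul
    ((reconstructionKernel N k).continuous.measurable.comp measurable_fst)

/-- Under stochastic continuity, values at arbitrary points are limits of values at points of a
set of full measure. -/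
lemma exists_seq_ae_tendsto (hX : IsStochasticallyContinuous P X)
    (hY : IsStochasticallyContinuous P Y) {p : SU2 → Prop} (hp : ∀ᵐ g ∂sphereVolume, p g)
    (g : SU2) : ∃ q : ℕ → SU2, (∀ r, p (q r)) ∧
      (∀ᵐ ω ∂P, Tendsto (fun r => X ω (q r)) atTop (𝓝 (X ω g))) ∧
      ∀ᵐ ω ∂P, Tendsto (fun r => Y ω (q r)) atTop (𝓝 (Y ω g)) := by
  have hd : Dense {g | p g} := Measure.dense_of_ae hp
  obtain ⟨q, hq, hqg⟩ := mem_closure_iff_seq_limit.mp (hd g)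
  obtain ⟨ns, hns, h1⟩ := ((hX g).comp hqg).exists_seq_tendsto_ae
  obtain ⟨ms, hms, h2⟩ :=
    ((hY g).comp (hqg.comp hns.tendsto_atTop)).exists_seq_tendsto_ae
  exact ⟨q ∘ ns ∘ ms, fun r => hq _, h1.mono fun ω hω => hω.comp hms.tendsto_atTop, h2⟩

variable [IsProbabilityMeasure P]

/-- Spectral coefficients as limits of averages along one deterministic sequence of points. -/
lemma exists_spectralCoeff_sampling {ι : Type*} [Countable ι] {Z : ι → Ω → SU2 → ℂ}
    (hZ : ∀ i, IsSquareIntegrableField P (Z i)) : ∃ ξ : ℕ → SU2, ∀ i, ∀ᵐ ω ∂P, ∀ k,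
      Tendsto (fun n : ℕ => ∑ m ∈ Finset.range n, ((16 * Real.pi ^ 2 * (n : ℝ)⁻¹ : ℝ) : ℂ) *
        star (hypersphericalHarmonic k.1 k.2.1 k.2.2 (ξ m)) * Z i ω (ξ m)) atTop
        (𝓝 (spectralCoeff (Z i) k ω)) := by
  obtain ⟨ξ, hξ⟩ := exists_sampling (P := P)
    (Measure.haarMeasure (⊤ : TopologicalSpace.PositiveCompacts SU2))
    (Z := fun (q : ι × WignerIndex) ω g =>
      Z q.1 ω g * star (hypersphericalHarmonic q.2.1 q.2.2.1 q.2.2.2 g))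
    (fun q => (hZ q.1).measurable_mul_harmonic q.2) (fun q => by
      filter_upwards [(hZ q.1).ae_integrable] with ω hω
      exact integrable_haar_of_sphereVolume (integrable_mul_star_harmonic hω _ _ _))
  refine ⟨ξ, fun i => ae_all_iff.mpr fun k => ?_⟩
  filter_upwards [hξ (i, k)] with ω hω
  have h := hω.const_smul (16 * Real.pi ^ 2 : ℝ)
  rw [← integral_sphereVolume] at h
  refine h.congr fun n => ?_
  simp only [Finset.smul_sum, Complex.real_smul]
  refine Finset.sum_congr rfl fun m _ => ?_
  push_cast
  ring

/-- The law of the spectral coefficients is determined by the law of the field. -/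
lemma identDistrib_spectralCoeff (hX : IsSquareIntegrableField P X)
    (hY : IsSquareIntegrableField P Y)
    (h : IdentDistrib (fun ω (p : SU2) => X ω p) (fun ω (p : SU2) => Y ω p) P P) :
    IdentDistrib (fun ω k => spectralCoeff X k ω) (fun ω k => spectralCoeff Y k ω) P P := by
  -- Both fields are sampled along the same points, so their averages are the same functional `F n`
  -- of the two fields.
  obtain ⟨ξ, hξ⟩ := exists_spectralCoeff_sampling (P := P) (Z := fun b : Bool => cond b X Y)
    (fun b => by cases b <;> assumption)
  let F : ℕ → (SU2 → ℂ) → WignerIndex → ℂ := fun n x k =>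
    ∑ m ∈ Finset.range n, ((16 * Real.pi ^ 2 * (n : ℝ)⁻¹ : ℝ) : ℂ) *
        star (hypersphericalHarmonic k.1 k.2.1 k.2.2 (ξ m)) * x (ξ m)
  have hF : ∀ n, Measurable (F n) := fun n => measurable_pi_iff.mpr fun k =>
    Finset.measurable_fun_sum _ fun m _ => (measurable_pi_apply (ξ m)).const_mul _
  refine identDistrib_of_ae_tendsto (X := fun n ω => F n (X ω)) (Y := fun n ω => F n (Y ω))
    hX.measurable_spectralCoeffs.aemeasurable hY.measurable_spectralCoeffs.aemeasurable ?_ ?_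
    fun n => h.comp (hF n)
  · filter_upwards [hξ true] with ω hω
    exact tendsto_pi_nhds.mpr hω
  · filter_upwards [hξ false] with ω hω
    exact tendsto_pi_nhds.mpr hω

/-- The spectral coefficients of a complex Gaussian field are complex Gaussian. -/
lemma IsComplexGaussianField.spectralCoeff (hX : IsSquareIntegrableField P X)
    (h : IsComplexGaussianField P X) (k : WignerIndex) :
    IsComplexGaussian P (spectralCoeff X k) := by
  obtain ⟨ξ, hξ⟩ := exists_spectralCoeff_sampling (P := P) (Z := fun _ : Unit => X) fun _ => hX
  refine isComplexGaussian_of_ae_tendsto (fun n => ?_)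
    (hX.measurable_spectralCoeff k).aemeasurable ((hξ ()).mono fun ω hω => hω k)
  have := h n (fun m => ξ m) fun m => ((16 * Real.pi ^ 2 * (n : ℝ)⁻¹ : ℝ) : ℂ) *
    star (hypersphericalHarmonic k.1 k.2.1 k.2.2 (ξ m))
  convert this using 2 with ω
  exact (Fin.sum_univ_eq_sum_range (fun m => ((16 * Real.pi ^ 2 * (n : ℝ)⁻¹ : ℝ) : ℂ) *
    star (hypersphericalHarmonic k.1 k.2.1 k.2.2 (ξ m)) * X ω (ξ m)) n).symm

/-! ### Reconstruction of a field from its coefficients -/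

/-- For almost every `ω` the reconstructions converge in `L²`, hence in measure on the group;
dominated convergence in `ω` gives convergence in the product measure. -/
lemma tendstoInMeasure_reconstruct (hX : IsSquareIntegrableField P X) :
    TendstoInMeasure (sphereVolume.prod P)
      (fun N (q : SU2 × Ω) => reconstruct N (fun k => spectralCoeff X k q.2) q.1) atTop
      (fun q => X q.2 q.1) := by
  intro ε hε
  have hXs : Measurable fun q : SU2 × Ω => X q.2 q.1 := hX.1.comp measurable_swap
  have hs : ∀ N, MeasurableSet {q : SU2 × Ω |
      ε ≤ edist (reconstruct N (fun k => spectralCoeff X k q.2) q.1) (X q.2 q.1)} := fun N =>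
    measurableSet_le measurable_const ((measurable_reconstruct hX N).edist hXs)
  refine (tendsto_congr fun N => Measure.prod_apply_symm (hs N)).mpr ?_
  have hlim := tendsto_lintegral_of_dominated_convergence (μ := P)
    (F := fun N ω => sphereVolume ((fun g => (g, ω)) ⁻¹' {q : SU2 × Ω |
      ε ≤ edist (reconstruct N (fun k => spectralCoeff X k q.2) q.1) (X q.2 q.1)}))
    (f := fun _ => 0) (fun _ => sphereVolume Set.univ)
    (fun N => measurable_measure_prodMk_right (hs N))
    (fun N => ae_of_all _ fun ω => measure_mono (Set.subset_univ _))
    (by simp) ?_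
  · simpa using hlim
  · filter_upwards [hX.2] with ω hω
    have h1 := tendstoInMeasure_of_tendsto_eLpNorm (μ := sphereVolume) (p := 2) two_ne_zero
      (f := fun N g => reconstruct N (fourierCoefficient (X ω)) g) (g := X ω) (l := atTop)
      (fun N => ((measurable_reconstruct hX N).comp measurable_prodMk_right).aestronglyMeasurable)
      hω.1 (tendsto_eLpNorm_sub_reconstruct hω)
    exact h1 ε hε

/-- Almost everywhere, two fields are limits of their reconstructions along a common sequence. -/
lemma exists_ae_tendsto_reconstruct (hX : IsSquareIntegrableField P X)
    (hY : IsSquareIntegrableField P Y) : ∃ ns : ℕ → ℕ, ∀ᵐ g ∂sphereVolume,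
      (∀ᵐ ω ∂P, Tendsto (fun r => reconstruct (ns r) (fun k => spectralCoeff X k ω) g) atTop
        (𝓝 (X ω g))) ∧
      ∀ᵐ ω ∂P, Tendsto (fun r => reconstruct (ns r) (fun k => spectralCoeff Y k ω) g) atTop
        (𝓝 (Y ω g)) := by
  obtain ⟨ns, hns, h1⟩ := (tendstoInMeasure_reconstruct hX).exists_seq_tendsto_ae
  obtain ⟨ms, hms, h2⟩ :=
    ((tendstoInMeasure_reconstruct hY).comp hns.tendsto_atTop).exists_seq_tendsto_ae
  refine ⟨ns ∘ ms, ?_⟩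
  filter_upwards [Measure.ae_ae_of_ae_prod h1, Measure.ae_ae_of_ae_prod h2] with g hg1 hg2
  exact ⟨hg1.mono fun ω hω => hω.comp hms.tendsto_atTop, hg2⟩

/-- Reconstructions are finite combinations of independent Gaussian variables. Their limits give
Gaussian vectors at almost all points, and stochastic continuity carries this to all points. -/
lemma IsStochasticallyContinuous.isComplexGaussianField (hX : IsSquareIntegrableField P X)
    (hc : IsStochasticallyContinuous P X) (hindep : iIndepFun (fun k => spectralCoeff X k) P)
    (ha : ∀ k, IsComplexGaussian P (spectralCoeff X k)) : IsComplexGaussianField P X := by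
  obtain ⟨ns, hns⟩ := exists_ae_tendsto_reconstruct hX hX
  have hmeas : ∀ (N : ℕ) (g : Fin N → SU2) (c : Fin N → ℂ),
      AEMeasurable (fun ω => ∑ i, c i * X ω (g i)) P := fun N g c =>
    (Finset.measurable_fun_sum _ fun i _ => (hX.measurable_eval (g i)).const_mul _).aemeasurable
  have hgood : ∀ (N : ℕ) (g : Fin N → SU2) (c : Fin N → ℂ),
      (∀ i, ∀ᵐ ω ∂P, Tendsto (fun r => reconstruct (ns r) (fun k => spectralCoeff X k ω) (g i))
        atTop (𝓝 (X ω (g i)))) → IsComplexGaussian P fun ω => ∑ i, c i * X ω (g i) := by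
    intro N g c hg
    refine isComplexGaussian_of_ae_tendsto (a := fun r ω =>
      ∑ i, c i * reconstruct (ns r) (fun k => spectralCoeff X k ω) (g i)) (fun r => ?_)
      (hmeas N g c) ?_
    · have := isComplexGaussian_sum_mul (degreeFinset (ns r))
        (fun k => ∑ i, c i * reconstructionKernel (ns r) k (g i)) ha hindep
      convert this using 2 with ω
      simp only [reconstruct, Finset.mul_sum, Finset.sum_mul]
      rw [Finset.sum_comm]
      exact Finset.sum_congr rfl fun k _ => Finset.sum_congr rfl fun i _ => by ring
    · filter_upwards [ae_all_iff.mpr hg] with ω hω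
      exact tendsto_finsetSum _ fun i _ => (hω i).const_mul _
  intro N g c
  choose q hq hqX _ using fun i => exists_seq_ae_tendsto hc hc hns (g i)
  refine isComplexGaussian_of_ae_tendsto (a := fun r ω => ∑ i, c i * X ω (q i r))
    (fun r => hgood N (fun i => q i r) c fun i => (hq i r).1) (hmeas N g c) ?_
  filter_upwards [ae_all_iff.mpr hqX] with ω hω
  exact tendsto_finsetSum _ fun i _ => (hω i).const_mul _

/-- The law of a stochastically continuous field is determined by the law of its coefficients. -/
lemma identDistrib_of_spectralCoeff (hX : IsSquareIntegrableField P X)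
    (hY : IsSquareIntegrableField P Y) (hcX : IsStochasticallyContinuous P X)
    (hcY : IsStochasticallyContinuous P Y)
    (h : IdentDistrib (fun ω k => spectralCoeff X k ω) (fun ω k => spectralCoeff Y k ω) P P) :
    IdentDistrib (fun ω (p : SU2) => X ω p) (fun ω (p : SU2) => Y ω p) P P := by
  obtain ⟨ns, hns⟩ := exists_ae_tendsto_reconstruct hX hY
  have hm : ∀ {Z : Ω → SU2 → ℂ} (I : Finset SU2) (g : I → SU2), IsSquareIntegrableField P Z →
      AEMeasurable (fun ω i => Z ω (g i)) P := fun I g hZ =>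
    (measurable_pi_iff.mpr fun i => hZ.measurable_eval (g i)).aemeasurable
  rw [identDistrib_iff_forall_finset_identDistrib (X := fun p ω => X ω p) (Y := fun p ω => Y ω p)
    hX.measurable_field.aemeasurable hY.measurable_field.aemeasurable]
  intro I
  choose q hq hqX hqY using fun i : I => exists_seq_ae_tendsto hcX hcY hns i
  refine identDistrib_of_ae_tendsto (X := fun r ω (i : I) => X ω (q i r))
    (Y := fun r ω (i : I) => Y ω (q i r)) (hm I (fun i => i) hX) (hm I (fun i => i) hY) ?_ ?_
    fun r => ?_
  · filter_upwards [ae_all_iff.mpr hqX] with ω hω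
    exact tendsto_pi_nhds.mpr hω
  · filter_upwards [ae_all_iff.mpr hqY] with ω hω
    exact tendsto_pi_nhds.mpr hω
  -- At the approximating points, the values of both fields are almost sure limits of one and the
  -- same function of the coefficients.
  · let F : ℕ → (WignerIndex → ℂ) → I → ℂ := fun s a i => reconstruct (ns s) a (q i r)
    have hF : ∀ s, Measurable (F s) := fun s => measurable_pi_iff.mpr fun i =>
      Finset.measurable_fun_sum _ fun k _ => (measurable_pi_apply k).mul_const _
    refine identDistrib_of_ae_tendsto (X := fun s ω => F s fun k => spectralCoeff X k ω)
      (Y := fun s ω => F s fun k => spectralCoeff Y k ω) (hm I (fun i => q i r) hX)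
      (hm I (fun i => q i r) hY) ?_ ?_ fun s => h.comp (hF s)
    · filter_upwards [ae_all_iff.mpr fun i => (hq i r).1] with ω hω
      exact tendsto_pi_nhds.mpr hω
    · filter_upwards [ae_all_iff.mpr fun i => (hq i r).2] with ω hω
      exact tendsto_pi_nhds.mpr hω

end Fields

section StochasticContinuity

variable {Ω : Type*} [MeasurableSpace Ω] {P : Measure Ω} {X : Ω → SU2 → ℂ}

/-! ### Stochastic continuity of invariant fields -/

lemma IsStochasticallyContinuous.comp (hX : IsStochasticallyContinuous P X) {f : SU2 → SU2}
    (hf : Continuous f) : IsStochasticallyContinuous P fun ω p => X ω (f p) := fun g =>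
  (hX (f g)).comp (hf.tendsto g)

/-- Translations act continuously on `L²`, and convergence in `L²` implies convergence in measure.
-/
lemma tendstoInMeasure_right_translate {f : SU2 → ℂ} (hf : MemLp f 2 sphereVolume) (g : SU2) :
    TendstoInMeasure sphereVolume (fun h q => f (q * h)) (𝓝 g) (fun q => f (q * g)) := by
  have hmp : ∀ h : SU2, MeasurePreserving (fun q => q * h) sphereVolume sphereVolume :=
    fun h => measurePreserving_mul_right sphereVolume h
  let R : SU2 → C(SU2, SU2) := fun h => ⟨fun q => q * h, continuous_mul_const h⟩
  have hR : Continuous R :=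
    (ContinuousMap.curry ⟨fun a : SU2 × SU2 => a.2 * a.1, continuous_snd.mul continuous_fst⟩).continuous
  have h1 := (tendsto_const_nhds (x := hf.toLp f)).compMeasurePreservingLp (hR.tendsto g)
    (fun h => hmp h) (hmp g) (by simp)
  rw [tendsto_iff_edist_tendsto_0] at h1
  have hae : ∀ h, Lp.compMeasurePreserving (R h) (hmp h) (hf.toLp f) =ᵐ[sphereVolume]
      fun q => f (q * h) := fun h =>
    (Lp.coeFn_compMeasurePreserving _ (hmp h)).trans
      ((hmp h).quasiMeasurePreserving.ae_eq_comp hf.coeFn_toLp)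
  refine tendstoInMeasure_of_tendsto_eLpNorm (p := 2) two_ne_zero
    (fun h => (hf.comp_measurePreserving (hmp h)).1) (hf.comp_measurePreserving (hmp g)).1
    (h1.congr fun h => ?_)
  rw [Lp.edist_def]
  exact eLpNorm_congr_ae ((hae h).sub (hae g))

/-- A measurable square integrable field whose law is invariant under left translations is
stochastically continuous. -/
lemma IsBiInvariant.isStochasticallyContinuous [IsProbabilityMeasure P]
    (hX : IsSquareIntegrableField P X) (hinv : IsBiInvariant P X) :
    IsStochasticallyContinuous P X := by
  intro g ε hε
  let A : SU2 → Set (Ω × SU2) := fun h => {x | ε ≤ edist (X x.1 (x.2 * h)) (X x.1 (x.2 * g))}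
  have hA : ∀ h, MeasurableSet (A h) := fun h => by
    have hm : ∀ h : SU2, Measurable fun x : Ω × SU2 => X x.1 (x.2 * h) := fun h =>
      hX.1.comp (measurable_fst.prodMk (measurable_snd.mul_const h))
    exact measurableSet_le measurable_const ((hm h).edist (hm g))
  -- By left invariance the probability of a large increment does not depend on `q`. Averaging over
  -- `q` and applying Fubini turns it into the mean volume where a trajectory differs from its right
  -- translate.
  have hconst : ∀ h q, P {ω | ε ≤ edist (X ω (q * h)) (X ω (q * g))} =
      P {ω | ε ≤ edist (X ω h) (X ω g)} := by
    intro h q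
    have h1 := hinv q⁻¹ 1
    simp only [inv_inv, mul_one] at h1
    have hs : MeasurableSet {x : SU2 → ℂ | ε ≤ edist (x h) (x g)} :=
      measurableSet_le measurable_const ((measurable_pi_apply h).edist (measurable_pi_apply g))
    exact h1.measure_mem_eq hs
  have hprod : ∀ h, P {ω | ε ≤ edist (X ω h) (X ω g)} * sphereVolume Set.univ =
      ∫⁻ ω, sphereVolume (Prod.mk ω ⁻¹' A h) ∂P := by
    intro h
    rw [← Measure.prod_apply (hA h), Measure.prod_apply_symm (hA h)]
    have : ∀ q, P ((fun ω => (ω, q)) ⁻¹' A h) = P {ω | ε ≤ edist (X ω h) (X ω g)} := hconst h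
    simp_rw [this]
    rw [lintegral_const]
  have hlim : Tendsto (fun h => ∫⁻ ω, sphereVolume (Prod.mk ω ⁻¹' A h) ∂P) (𝓝 g)
      (𝓝 (∫⁻ _, 0 ∂P)) := by
    refine tendsto_lintegral_filter_of_dominated_convergence (fun _ => sphereVolume Set.univ)
      (Eventually.of_forall fun h => measurable_measure_prodMk_left (hA h))
      (Eventually.of_forall fun h => ae_of_all _ fun ω => measure_mono (Set.subset_univ _))
      (by simp) ?_
    filter_upwards [hX.2] with ω hω
    exact tendstoInMeasure_right_translate hω g ε hε
  simp_rw [← hprod, lintegral_zero] at hlim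
  have h0 : sphereVolume Set.univ ≠ 0 := by rw [sphereVolume_univ]; simp
  have ht : sphereVolume Set.univ ≠ ⊤ := measure_ne_top _ _
  have h2 := ENNReal.Tendsto.mul_const (b := (sphereVolume Set.univ)⁻¹) hlim
    (Or.inr (ENNReal.inv_ne_top.mpr h0))
  simp_rw [mul_assoc, ENNReal.mul_inv_cancel h0 ht, mul_one, zero_mul] at h2
  exact h2

end StochasticContinuity

/-! ### Wigner matrices -/

section WignerMatrices

open scoped Matrix Kronecker

/-- The Wigner functions of degree `n` as a matrix. -/
def wignerMatrix (n : ℕ) (g : SU2) : Matrix (Fin (n + 1)) (Fin (n + 1)) ℂ :=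
  Matrix.of fun i j => wignerD n i j g

lemma wignerMatrix_conjTranspose_mul (n : ℕ) (g : SU2) :
    (wignerMatrix n g)ᴴ * wignerMatrix n g = 1 := by
  ext i j
  rw [Matrix.mul_apply, Matrix.one_apply]
  exact sum_star_wignerD_mul n i j g

lemma wignerMatrix_mul_conjTranspose (n : ℕ) (g : SU2) :
    wignerMatrix n g * (wignerMatrix n g)ᴴ = 1 :=
  mul_eq_one_comm.mp (wignerMatrix_conjTranspose_mul n g)

lemma sum_norm_sq_mulVec {ι : Type*} [Fintype ι] [DecidableEq ι] {U : Matrix ι ι ℂ}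
    (hU : Uᴴ * U = 1) (x : ι → ℂ) : ∑ i, ‖(U *ᵥ x) i‖ ^ 2 = ∑ i, ‖x i‖ ^ 2 := by
  have key : ∀ y : ι → ℂ, star y ⬝ᵥ y = ((∑ i, ‖y i‖ ^ 2 : ℝ) : ℂ) := by
    intro y
    simp only [dotProduct, Complex.ofReal_sum]
    refine Finset.sum_congr rfl fun i _ => ?_
    rw [Complex.ofReal_pow]
    exact Complex.conj_mul' (y i)
  have h : star (U *ᵥ x) ⬝ᵥ (U *ᵥ x) = star x ⬝ᵥ x := by
    rw [Matrix.star_mulVec, Matrix.dotProduct_mulVec, Matrix.vecMul_vecMul, hU, Matrix.vecMul_one]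
  rw [key, key] at h
  exact_mod_cast h

end WignerMatrices

/-! ### Gaussianity of the coefficients of an invariant field -/

section Coefficients

open scoped Matrix

variable {Ω : Type*} [MeasurableSpace Ω] {P : Measure Ω} {X : Ω → SU2 → ℂ}

lemma IsCentrallySymmetric.map_neg {a : Ω → ℂ} (h : IsCentrallySymmetric P a) :
    (P.map a).map (fun x => -x) = P.map a := by
  rw [AEMeasurable.map_map_of_aemeasurable measurable_neg.aemeasurable h.aemeasurable_snd]
  exact h.map_eq

lemma IsBiInvariant.identDistrib_left (hinv : IsBiInvariant P X) (g : SU2) :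
    IdentDistrib (fun ω (p : SU2) => X ω (g⁻¹ * p)) (fun ω (p : SU2) => X ω p) P P := by
  have := hinv g 1
  simpa only [mul_one] using this

lemma IsBiInvariant.identDistrib_right (hinv : IsBiInvariant P X) (g : SU2) :
    IdentDistrib (fun ω (p : SU2) => X ω (p * g)) (fun ω (p : SU2) => X ω p) P P := by
  have := hinv 1 g
  simpa only [inv_one, one_mul] using this

lemma IsSquareIntegrableField.measurable_mulVec (hX : IsSquareIntegrableField P X) {n : ℕ}
    (U : Matrix (Fin (n + 1)) (Fin (n + 1)) ℂ) (f : Fin (n + 1) → WignerIndex) :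
    Measurable fun ω => U *ᵥ fun m => spectralCoeff X (f m) ω :=
  (by fun_prop : Continuous fun y : Fin (n + 1) → ℂ => U *ᵥ y).measurable.comp
    (measurable_pi_iff.mpr fun m => hX.measurable_spectralCoeff (f m))

variable [IsProbabilityMeasure P]

lemma linkedByRotations_of_identDistrib {ι : Type*} [Fintype ι] [DecidableEq ι] {x : ι → Ω → ℂ}
    (hx : ∀ i, Measurable (x i)) (hindep : iIndepFun x P) {U : ℝ → Matrix ι ι ℂ}
    {A : Matrix ι ι ℂ} {j k : ι} {κ : ℂ} {r : ℝ} (hU0 : U 0 = 1)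
    (hA : ∀ i j, HasDerivAt (fun t => U t i j) (A i j) 0) (hU : ∀ t, (U t)ᴴ * U t = 1)
    (hinv : ∀ t, IdentDistrib (fun ω => U t *ᵥ fun i => x i ω) (fun ω i => x i ω) P P)
    (ha : A j k = star κ * r) (hb : A k j = -(κ * r)) :
    LinkedByRotations (fun i => P.map (x i)) j k κ r U A where
  zero := hU0
  deriv := hA
  norm t := sum_norm_sq_mulVec (hU t)
  invariant t := by
    have hpi : P.map (fun ω i => x i ω) = Measure.pi fun i => P.map (x i) :=
      (iIndepFun_iff_map_fun_eq_pi_map fun i => (hx i).aemeasurable).mp hindep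
    rw [← hpi, Measure.map_map (by fun_prop : Continuous fun y : ι → ℂ => U t *ᵥ y).measurable
      (measurable_pi_iff.mpr hx)]
    exact (hinv t).map_eq
  above := ha
  below := hb

/-- The two neighbouring entries of a column of independent symmetric variables whose law is
invariant under the conjugate Wigner matrices. -/
lemma isCircularGaussianCharFun_of_invariant_star {n : ℕ} {x : Fin (n + 1) → Ω → ℂ}
    (hx : ∀ m, Measurable (x m)) (hindep : iIndepFun x P)
    (hsymm : ∀ m, IsCentrallySymmetric P (x m))
    (hinv : ∀ g, IdentDistrib (fun ω => (Matrix.of fun a b => star (wignerD n a b g)) *ᵥ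
      fun m => x m ω) (fun ω m => x m ω) P P) (i : Fin n) :
    IsCircularGaussianCharFun (charFun (P.map (x i.castSucc))) ∧
      charFun (P.map (x i.castSucc)) = charFun (P.map (x i.succ)) := by
  have hp : ∀ m, IsProbabilityMeasure (P.map (x m)) := fun m =>
    Measure.isProbabilityMeasure_map (hx m).aemeasurable
  have hr : 0 < ladderCoeff n i := ladderCoeff_pos i.2
  have hval : ((i.castSucc : Fin (n + 1)) : ℕ) + 1 = (i.succ : Fin (n + 1)) := by simp
  refine isCircularGaussianCharFun_of_linkedByRotations (μ := fun m => P.map (x m))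
    (fun m => (hsymm m).map_neg) (Fin.castSucc_lt_succ).ne hr fun κ hκ => ?_
  -- The matrices acting on a column are conjugated, so the rotation of phase `star κ` produces the
  -- generator with phase `κ`.
  have hκ' : star (star κ) * star κ = 1 := by rw [star_star, mul_comm]; exact hκ
  refine ⟨fun t => Matrix.of fun a b => star (wignerD n a b (SU2.rotation (star κ) hκ' t)),
    Matrix.of fun a b => star (wignerGenerator n (star κ) a b),
    linkedByRotations_of_identDistrib hx hindep ?_ ?_ ?_ (fun t => hinv _) ?_ ?_⟩
  · ext a b
    rw [Matrix.of_apply, SU2.rotation_zero, wignerD_one, Matrix.one_apply]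
    split_ifs <;> simp
  · intro a b
    exact (hasDerivAt_wignerD_rotation n (star κ) hκ' a b).star
  · intro t
    ext a b
    rw [Matrix.mul_apply, Matrix.one_apply]
    have := congrArg star (sum_star_wignerD_mul n a b (SU2.rotation (star κ) hκ' t))
    simp only [star_sum, star_mul', star_star] at this
    simp only [Matrix.conjTranspose_apply, Matrix.of_apply, star_star]
    rw [this]
    split_ifs <;> simp
  · rw [Matrix.of_apply, wignerGenerator_above _ hval]
    simp
  · rw [Matrix.of_apply, wignerGenerator_below _ hval]
    simp

lemma charFun_eq_of_invariant {n : ℕ} {x : Fin (n + 1) → Ω → ℂ}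
    (hx : ∀ m, Measurable (x m)) (hindep : iIndepFun x P)
    (hsymm : ∀ m, IsCentrallySymmetric P (x m))
    (hinv : ∀ g, IdentDistrib (fun ω => wignerMatrix n g *ᵥ fun m => x m ω)
      (fun ω m => x m ω) P P) (i : Fin n) :
    charFun (P.map (x i.castSucc)) = charFun (P.map (x i.succ)) := by
  have hp : ∀ m, IsProbabilityMeasure (P.map (x m)) := fun m =>
    Measure.isProbabilityMeasure_map (hx m).aemeasurable
  have hr : 0 < ladderCoeff n i := ladderCoeff_pos i.2
  have hval : ((i.castSucc : Fin (n + 1)) : ℕ) + 1 = (i.succ : Fin (n + 1)) := by simp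
  refine (isCircularGaussianCharFun_of_linkedByRotations (μ := fun m => P.map (x m))
    (fun m => (hsymm m).map_neg) (Fin.castSucc_lt_succ).ne hr fun κ hκ => ?_).2
  refine ⟨fun t => wignerMatrix n (SU2.rotation κ hκ t), Matrix.of (wignerGenerator n κ),
    linkedByRotations_of_identDistrib hx hindep ?_ (hasDerivAt_wignerD_rotation n κ hκ)
    (fun t => wignerMatrix_conjTranspose_mul n _) (fun t => hinv _) (wignerGenerator_above κ hval)
    (wignerGenerator_below κ hval)⟩
  ext a b
  rw [SU2.rotation_zero, Matrix.one_apply]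
  exact wignerD_one n a b

lemma IsBiInvariant.identDistrib_column (hX : IsSquareIntegrableField P X)
    (hinv : IsBiInvariant P X) {n : ℕ} (j : Fin (n + 1)) (g : SU2) :
    IdentDistrib (fun ω => (Matrix.of fun a b => star (wignerD n a b g)) *ᵥ
      fun m => spectralCoeff X ⟨n, m, j⟩ ω) (fun ω m => spectralCoeff X ⟨n, m, j⟩ ω) P P := by
  have h1 := (identDistrib_spectralCoeff (hX.left_translate g) hX (hinv.identDistrib_left g)).comp
    (u := fun (a : WignerIndex → ℂ) (m : Fin (n + 1)) => a ⟨n, m, j⟩)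
    (measurable_pi_iff.mpr fun m => measurable_pi_apply _)
  refine IdentDistrib.trans (IdentDistrib.of_ae_eq ?_ ?_) h1
  · exact (hX.measurable_mulVec _ fun m => ⟨n, m, j⟩).aemeasurable
  · filter_upwards [hX.spectralCoeff_left_translate g] with ω hω
    funext m
    exact (hω n m j).symm

lemma IsBiInvariant.identDistrib_row (hX : IsSquareIntegrableField P X)
    (hinv : IsBiInvariant P X) {n : ℕ} (i : Fin (n + 1)) (g : SU2) :
    IdentDistrib (fun ω => wignerMatrix n g *ᵥ fun m => spectralCoeff X ⟨n, i, m⟩ ω)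
      (fun ω m => spectralCoeff X ⟨n, i, m⟩ ω) P P := by
  have h1 := (identDistrib_spectralCoeff (hX.right_translate g) hX
    (hinv.identDistrib_right g)).comp
    (u := fun (a : WignerIndex → ℂ) (m : Fin (n + 1)) => a ⟨n, i, m⟩)
    (measurable_pi_iff.mpr fun m => measurable_pi_apply _)
  refine IdentDistrib.trans (IdentDistrib.of_ae_eq ?_ ?_) h1
  · exact (hX.measurable_mulVec _ fun m => ⟨n, i, m⟩).aemeasurable
  · filter_upwards [hX.spectralCoeff_right_translate g] with ω hω
    funext m
    exact (hω n i m).symm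

lemma IsBiInvariant.charFun_spectralCoeff_castSucc_left
    (hX : IsSquareIntegrableField P X)
    (hinv : IsBiInvariant P X)
    (hindep : iIndepFun (fun k : WignerIndex => spectralCoeff X k) P)
    (hsymm : ∀ k : WignerIndex, IsCentrallySymmetric P (spectralCoeff X k))
    {n : ℕ} (i : Fin n) (j : Fin (n + 1)) :
    IsCircularGaussianCharFun (charFun (P.map (spectralCoeff X ⟨n, i.castSucc, j⟩))) ∧
      charFun (P.map (spectralCoeff X ⟨n, i.castSucc, j⟩)) =
        charFun (P.map (spectralCoeff X ⟨n, i.succ, j⟩)) :=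
by
  have hx : ∀ m, Measurable (spectralCoeff X ⟨n, m, j⟩) := fun m => hX.measurable_spectralCoeff _
  have hinj : Function.Injective fun m : Fin (n + 1) => (⟨n, m, j⟩ : WignerIndex) :=
    fun m m' h => by simpa using h
  have hxi : iIndepFun (fun m => spectralCoeff X ⟨n, m, j⟩) P := hindep.precomp hinj
  have hs : ∀ m, IsCentrallySymmetric P (spectralCoeff X ⟨n, m, j⟩) := fun m => hsymm _
  exact isCircularGaussianCharFun_of_invariant_star (x := fun m => spectralCoeff X ⟨n, m, j⟩)
    hx hxi hs (hinv.identDistrib_column hX j) i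

lemma IsBiInvariant.charFun_spectralCoeff_castSucc_right
    (hX : IsSquareIntegrableField P X)
    (hinv : IsBiInvariant P X)
    (hindep : iIndepFun (fun k : WignerIndex => spectralCoeff X k) P)
    (hsymm : ∀ k : WignerIndex, IsCentrallySymmetric P (spectralCoeff X k))
    {n : ℕ} (i : Fin (n + 1)) (j : Fin n) :
    charFun (P.map (spectralCoeff X ⟨n, i, j.castSucc⟩)) =
      charFun (P.map (spectralCoeff X ⟨n, i, j.succ⟩)) :=
by
  have hx : ∀ m, Measurable (spectralCoeff X ⟨n, i, m⟩) := fun m => hX.measurable_spectralCoeff _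
  have hinj : Function.Injective fun m : Fin (n + 1) => (⟨n, i, m⟩ : WignerIndex) :=
    fun m m' h => by simpa using h
  have hxi : iIndepFun (fun m => spectralCoeff X ⟨n, i, m⟩) P := hindep.precomp hinj
  have hs : ∀ m, IsCentrallySymmetric P (spectralCoeff X ⟨n, i, m⟩) := fun m => hsymm _
  exact charFun_eq_of_invariant (x := fun m => spectralCoeff X ⟨n, i, m⟩) hx hxi hs
    (hinv.identDistrib_row hX i) j

/-- Left translations connect neighbours in a column and right translations neighbours in a row;
together they reach every index of the degree. -/
lemma IsBiInvariant.charFun_spectralCoeff_eq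
    (hX : IsSquareIntegrableField P X)
    (hinv : IsBiInvariant P X)
    (hindep : iIndepFun (fun k : WignerIndex => spectralCoeff X k) P)
    (hsymm : ∀ k : WignerIndex, IsCentrallySymmetric P (spectralCoeff X k))
    {n : ℕ} (i j : Fin (n + 1)) :
    charFun (P.map (spectralCoeff X ⟨n, i, j⟩)) = charFun (P.map (spectralCoeff X ⟨n, 0, 0⟩)) := by
  have h1 : ∀ i j : Fin (n + 1), charFun (P.map (spectralCoeff X ⟨n, i, j⟩)) =
      charFun (P.map (spectralCoeff X ⟨n, 0, j⟩)) := by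
    intro i j
    induction i using Fin.induction with
    | zero => rfl
    | succ i ih =>
      rw [← (hinv.charFun_spectralCoeff_castSucc_left hX hindep hsymm i j).2, ih]
  have h2 : ∀ j : Fin (n + 1), charFun (P.map (spectralCoeff X ⟨n, 0, j⟩)) =
      charFun (P.map (spectralCoeff X ⟨n, 0, 0⟩)) := by
    intro j
    induction j using Fin.induction with
    | zero => rfl
    | succ j ih =>
      rw [← hinv.charFun_spectralCoeff_castSucc_right hX hindep hsymm 0 j, ih]
  rw [h1, h2]

/-- In positive degree a column has at least two entries, so there is a neighbouring pair to which
the functional equation applies. -/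
lemma IsBiInvariant.isComplexGaussian_spectralCoeff
    (hX : IsSquareIntegrableField P X)
    (hinv : IsBiInvariant P X)
    (hindep : iIndepFun (fun k : WignerIndex => spectralCoeff X k) P)
    (hsymm : ∀ k : WignerIndex, IsCentrallySymmetric P (spectralCoeff X k))
    {k : WignerIndex} (hk : k.1 ≠ 0) :
    IsComplexGaussian P (spectralCoeff X k) := by
  obtain ⟨n, i, j⟩ := k
  obtain ⟨n, rfl⟩ := Nat.exists_eq_succ_of_ne_zero hk
  rw [isComplexGaussian_iff]
  refine ⟨(hX.measurable_spectralCoeff _).aemeasurable, ?_⟩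
  rw [hinv.charFun_spectralCoeff_eq hX hindep hsymm i j]
  exact (hinv.charFun_spectralCoeff_castSucc_left hX hindep hsymm (n := n + 1) 0 0).1

lemma IsBiInvariant.varianceDependsOnlyOnDegree
    (hX : IsSquareIntegrableField P X)
    (hinv : IsBiInvariant P X)
    (hindep : iIndepFun (fun k : WignerIndex => spectralCoeff X k) P)
    (hsymm : ∀ k : WignerIndex, IsCentrallySymmetric P (spectralCoeff X k))
    : VarianceDependsOnlyOnDegree P X := by
  refine ⟨fun n => complexVariance P (spectralCoeff X ⟨n, 0, 0⟩), fun ⟨n, i, j⟩ => ?_⟩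
  have hm := fun k => (hX.measurable_spectralCoeff k).aemeasurable (μ := P)
  have hp := fun k => Measure.isProbabilityMeasure_map (hm k)
  have h : IdentDistrib (spectralCoeff X ⟨n, i, j⟩) (spectralCoeff X ⟨n, 0, 0⟩) P P :=
    ⟨hm _, hm _, by
      have := hp ⟨n, i, j⟩
      have := hp ⟨n, 0, 0⟩
      exact Measure.ext_of_charFun (hinv.charFun_spectralCoeff_eq hX hindep hsymm i j)⟩
  change ∫⁻ ω, _ ∂P = ∫⁻ ω, _ ∂P
  rw [h.integral_eq]
  exact (h.comp (u := fun x : ℂ => ‖x - ∫ ω, spectralCoeff X ⟨n, 0, 0⟩ ω ∂P‖ₑ ^ 2)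
    (by fun_prop)).lintegral_eq

end Coefficients

section GaussianVariance

variable {Ω : Type*} [MeasurableSpace Ω] {P : Measure Ω}

/-! ### The variance of a complex Gaussian variable -/

lemma lintegral_enorm_sq_gaussianReal (v : NNReal) :
    ∫⁻ x, ‖x‖ₑ ^ 2 ∂gaussianReal 0 v = v := by
  have h := ofReal_variance (memLp_id_gaussianReal (μ := 0) (v := v) 2)
  rw [variance_id_gaussianReal, evariance] at h
  simpa using h.symm

lemma complexVariance_of_map_eq {a : Ω → ℂ} (ha : AEMeasurable a P)
    (hsymm : IsCentrallySymmetric P a) {v : NNReal}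
    (hv : P.map a = ((gaussianReal 0 v).prod (gaussianReal 0 v)).map
      fun p : ℝ × ℝ => (p.1 : ℂ) + p.2 * Complex.I) :
    complexVariance P a = v + v := by
  -- Central symmetry makes the mean its own negative. The variance is then the sum of those of the
  -- real and imaginary parts.
  have h0 : ∫ ω, a ω ∂P = 0 := by
    have h := hsymm.integral_eq
    rw [integral_neg] at h
    exact self_eq_neg.mp h.symm
  have hc : Continuous fun p : ℝ × ℝ => (p.1 : ℂ) + p.2 * Complex.I := by fun_prop
  have hsq : Measurable fun x : ℂ => ‖x‖ₑ ^ 2 := by fun_prop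
  have hn : ∀ p : ℝ × ℝ, ‖(p.1 : ℂ) + p.2 * Complex.I‖ₑ ^ 2 = ‖p.1‖ₑ ^ 2 + ‖p.2‖ₑ ^ 2 := by
    intro p
    rw [← ofReal_norm, ← ofReal_norm, ← ofReal_norm, ← ENNReal.ofReal_pow (norm_nonneg _),
      ← ENNReal.ofReal_pow (norm_nonneg _), ← ENNReal.ofReal_pow (norm_nonneg _),
      ← ENNReal.ofReal_add (by positivity) (by positivity), Complex.sq_norm,
      Complex.normSq_add_mul_I, Real.norm_eq_abs, Real.norm_eq_abs, sq_abs, sq_abs]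
  have hf : ∀ ν ν' : Measure ℝ, IsProbabilityMeasure ν → IsProbabilityMeasure ν' →
      ∫⁻ p : ℝ × ℝ, ‖p.1‖ₑ ^ 2 ∂ν.prod ν' = ∫⁻ x, ‖x‖ₑ ^ 2 ∂ν := fun ν ν' _ _ =>
    (measurePreserving_fst (μ := ν) (ν := ν')).lintegral_comp (f := fun x : ℝ => ‖x‖ₑ ^ 2)
      (by fun_prop)
  have hs : ∀ ν ν' : Measure ℝ, IsProbabilityMeasure ν → IsProbabilityMeasure ν' →
      ∫⁻ p : ℝ × ℝ, ‖p.2‖ₑ ^ 2 ∂ν.prod ν' = ∫⁻ x, ‖x‖ₑ ^ 2 ∂ν' := fun ν ν' _ _ =>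
    (measurePreserving_snd (μ := ν) (ν := ν')).lintegral_comp (f := fun x : ℝ => ‖x‖ₑ ^ 2)
      (by fun_prop)
  rw [complexVariance, h0]
  simp only [sub_zero]
  rw [← lintegral_map' hsq.aemeasurable ha, hv, lintegral_map hsq hc.measurable]
  simp_rw [hn]
  rw [lintegral_add_left (by fun_prop), hf _ _ inferInstance inferInstance,
    hs _ _ inferInstance inferInstance, lintegral_enorm_sq_gaussianReal]

end GaussianVariance

/-! ### Families of variables indexed by the Wigner functions -/

section Families

open scoped Matrix Kronecker

variable {Ω : Type*} [MeasurableSpace Ω] {P : Measure Ω} [IsProbabilityMeasure P]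

/-- Every real functional is the real part of a complex one, so the law of a complex vector is
determined by the characteristic functions at `1` of its complex linear combinations. -/
lemma exists_re_sum_eq {ι : Type*} [Fintype ι] [DecidableEq ι] (L : StrongDual ℝ (ι → ℂ)) :
    ∃ c : ι → ℂ, ∀ x, L x = (∑ i, c i * x i).re := by
  refine ⟨fun i => (L (Pi.single i 1) : ℂ) - Complex.I * L (Pi.single i Complex.I), fun x => ?_⟩
  have hx : x = ∑ i, ((x i).re • Pi.single (M := fun _ => ℂ) i 1 +
      (x i).im • Pi.single (M := fun _ => ℂ) i Complex.I) := by
    funext j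
    rw [Finset.sum_apply, Finset.sum_eq_single j (fun i _ hi => by simp [Pi.single_eq_of_ne' hi])
      (by simp)]
    simp [Complex.re_add_im]
  conv_lhs => rw [hx]
  rw [map_sum, Complex.re_sum]
  refine Finset.sum_congr rfl fun i _ => ?_
  rw [map_add, map_smul, map_smul]
  simp
  ring

lemma identDistrib_of_charFun_sum {a b : WignerIndex → Ω → ℂ} (ha : ∀ k, Measurable (a k))
    (hb : ∀ k, Measurable (b k))
    (h : ∀ (N : ℕ) (c : WignerIndex → ℂ),
      charFun (P.map fun ω => ∑ k ∈ degreeFinset N, c k * a k ω) 1 =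
        charFun (P.map fun ω => ∑ k ∈ degreeFinset N, c k * b k ω) 1) :
    IdentDistrib (fun ω k => a k ω) (fun ω k => b k ω) P P := by
  classical
  rw [identDistrib_iff_forall_finset_identDistrib (X := a) (Y := b)
    (measurable_pi_iff.mpr ha).aemeasurable (measurable_pi_iff.mpr hb).aemeasurable]
  intro I
  have hm : ∀ {d : WignerIndex → Ω → ℂ}, (∀ k, Measurable (d k)) →
      Measurable fun ω => I.restrict (d · ω) := fun hd => measurable_pi_iff.mpr fun i => hd i
  refine ⟨(hm ha).aemeasurable, (hm hb).aemeasurable, ?_⟩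
  have := Measure.isProbabilityMeasure_map (μ := P) (hm ha).aemeasurable
  have := Measure.isProbabilityMeasure_map (μ := P) (hm hb).aemeasurable
  refine Measure.ext_of_charFunDual (funext fun L => ?_)
  obtain ⟨c, hc⟩ := exists_re_sum_eq L
  let C : WignerIndex → ℂ := fun k => if hk : k ∈ I then c ⟨k, hk⟩ else 0
  have hIN : I ⊆ degreeFinset (I.sup fun k => k.1) := fun k hk =>
    mem_degreeFinset.mpr (Finset.le_sup (f := fun k : WignerIndex => k.1) hk)
  have key : ∀ {d : WignerIndex → Ω → ℂ}, (∀ k, Measurable (d k)) →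
      charFunDual (P.map fun ω => I.restrict (d · ω)) L =
        charFun (P.map fun ω => ∑ k ∈ degreeFinset (I.sup fun k => k.1), C k * d k ω) 1 := by
    intro d hd
    have hsum : ∀ ω, ∑ k ∈ degreeFinset (I.sup fun k => k.1), C k * d k ω =
        ∑ i : I, c i * I.restrict (d · ω) i := by
      intro ω
      rw [← Finset.sum_subset hIN (fun k _ hk => by simp [C, hk]), ← Finset.sum_coe_sort]
      exact Finset.sum_congr rfl fun i _ => by simp [C]
    rw [charFunDual_apply, charFun_apply,
      integral_map (hm hd).aemeasurable (by fun_prop : Continuous fun x : I → ℂ =>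
        Complex.exp (L x * Complex.I)).aestronglyMeasurable,
      integral_map (Finset.measurable_fun_sum _ fun k _ => (hd k).const_mul _).aemeasurable
        (by fun_prop : Continuous fun x : ℂ =>
          Complex.exp (inner ℝ x 1 * Complex.I)).aestronglyMeasurable]
    refine integral_congr_ae (ae_of_all _ fun ω => ?_)
    simp only [hsum, hc]
    simp [Complex.inner]
  rw [key ha, key hb, h]

/-- Unitary mixing within the degrees preserves the law of a family of independent variables which
are Gaussian, with variance depending only on the degree, in all degrees which are mixed. -/
lemma identDistrib_of_unitary {a b : WignerIndex → Ω → ℂ} (ha : ∀ k, Measurable (a k))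
    (hb : ∀ k, Measurable (b k)) (hindep : iIndepFun a P)
    {B : ∀ n : ℕ, Matrix (Fin (n + 1) × Fin (n + 1)) (Fin (n + 1) × Fin (n + 1)) ℂ}
    (hB : ∀ n, B n * (B n)ᴴ = 1) (hB0 : B 0 = 1) {v : ℕ → NNReal}
    (hv : ∀ k : WignerIndex, k.1 ≠ 0 → ∀ w,
      charFun (P.map (a k)) w = (Real.exp (-(v k.1 * ‖w‖ ^ 2 / 2)) : ℝ))
    (h : ∀ᵐ ω ∂P, ∀ n p, b ⟨n, p⟩ ω = (B n *ᵥ fun q => a ⟨n, q⟩ ω) p) :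
    IdentDistrib (fun ω k => b k ω) (fun ω k => a k ω) P P := by
  refine identDistrib_of_charFun_sum hb ha fun N c => ?_
  -- The mixing is moved from the variables to the weights. For Gaussian variables of equal
  -- variance, only the norm of the weights within each degree matters, and `B n` preserves it.
  let d : WignerIndex → ℂ := fun k => ((fun p => c ⟨k.1, p⟩) ᵥ* B k.1) k.2
  have hmap : P.map (fun ω => ∑ k ∈ degreeFinset N, c k * b k ω) =
      P.map fun ω => ∑ k ∈ degreeFinset N, d k * a k ω := by
    refine Measure.map_congr ?_
    filter_upwards [h] with ω hω
    rw [degreeFinset, Finset.sum_sigma, Finset.sum_sigma]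
    refine Finset.sum_congr rfl fun n _ => ?_
    have e := Matrix.dotProduct_mulVec (fun p => c ⟨n, p⟩) (B n) fun q => a ⟨n, q⟩ ω
    simp only [dotProduct] at e
    simp only [hω]
    exact e
  have ha' := fun k => (ha k).aemeasurable (μ := P)
  rw [hmap, charFun_sum_mul ha' hindep, charFun_sum_mul ha' hindep, degreeFinset,
    Finset.prod_sigma, Finset.prod_sigma]
  refine Finset.prod_congr rfl fun n _ => ?_
  -- No Gaussianity is available in degree `0`; there `B 0 = 1` leaves the weights unchanged.
  by_cases hn : n = 0
  · subst hn
    refine Finset.prod_congr rfl fun p _ => ?_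
    have : d ⟨0, p⟩ = c ⟨0, p⟩ := by
      change ((fun p => c ⟨0, p⟩) ᵥ* B 0) p = c ⟨0, p⟩
      rw [hB0, Matrix.vecMul_one]
    rw [this]
  · have hU : ((B n)ᵀ)ᴴ * (B n)ᵀ = 1 := by
      rw [show ((B n)ᵀ)ᴴ = ((B n)ᴴ)ᵀ from rfl, ← Matrix.transpose_mul, hB, Matrix.transpose_one]
    have hs := sum_norm_sq_mulVec hU fun p => c ⟨n, p⟩
    rw [Matrix.mulVec_transpose] at hs
    have hprod : ∀ e : Fin (n + 1) × Fin (n + 1) → ℂ,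
        ∏ p, charFun (P.map (a ⟨n, p⟩)) (star (e p) * 1) =
          (Real.exp (-(v n * (∑ p, ‖e p‖ ^ 2) / 2)) : ℝ) := by
      intro e
      simp_rw [hv ⟨n, _⟩ hn]
      rw [← Complex.ofReal_prod, ← Real.exp_sum]
      congr 2
      rw [Finset.mul_sum, Finset.sum_div, ← Finset.sum_neg_distrib]
      simp
    rw [hprod, hprod]
    rw [← hs]

end Families

/-! ### Invariance from Gaussianity -/

section Invariance

open scoped Matrix Kronecker

variable {Ω : Type*} [MeasurableSpace Ω] {P : Measure Ω} [IsProbabilityMeasure P]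
  {X : Ω → SU2 → ℂ}

lemma wignerMatrix_zero (g : SU2) : wignerMatrix 0 g = 1 := by
  ext i j
  rw [Subsingleton.elim (α := Fin 1) i j, Matrix.one_apply_eq]
  exact wignerD_zero _ _ g

lemma kronecker_unitary {ι : Type*} [Fintype ι] [DecidableEq ι] {A B : Matrix ι ι ℂ}
    (hA : A * Aᴴ = 1) (hB : B * Bᴴ = 1) : (A ⊗ₖ B) * (A ⊗ₖ B)ᴴ = 1 := by
  rw [Matrix.conjTranspose_kronecker, ← Matrix.mul_kronecker_mul, hA, hB, Matrix.one_kronecker_one]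

lemma map_star_mul_conjTranspose {ι : Type*} [Fintype ι] [DecidableEq ι] {A : Matrix ι ι ℂ}
    (hA : A * Aᴴ = 1) : A.map star * (A.map star)ᴴ = 1 := by
  have h := congrArg (fun M : Matrix ι ι ℂ => M.map star) hA
  ext i j
  have := congrFun (congrFun h i) j
  simp only [Matrix.map_apply, Matrix.mul_apply, Matrix.conjTranspose_apply, star_sum, star_mul',
    Matrix.one_apply] at this ⊢
  rw [this]
  split_ifs <;> simp

/-- On pairs of indices, a left translation acts as the conjugate Wigner matrix tensored with the
identity. The invariance of the coefficients is then carried over to the field. -/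
lemma identDistrib_left_translate_of_gaussian (hX : IsSquareIntegrableField P X)
    (hc : IsStochasticallyContinuous P X)
    (hindep : iIndepFun (fun k : WignerIndex => spectralCoeff X k) P) {v : ℕ → NNReal}
    (hv : ∀ k : WignerIndex, k.1 ≠ 0 → ∀ w,
      charFun (P.map (spectralCoeff X k)) w = (Real.exp (-(v k.1 * ‖w‖ ^ 2 / 2)) : ℝ))
    (g : SU2) :
    IdentDistrib (fun ω (p : SU2) => X ω (g⁻¹ * p)) (fun ω (p : SU2) => X ω p) P P := by
  refine identDistrib_of_spectralCoeff (hX.left_translate g) hX (hc.comp (continuous_const_mul _)) hc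
    (identDistrib_of_unitary (B := fun n => (wignerMatrix n g).map star ⊗ₖ 1)
      hX.measurable_spectralCoeff (hX.left_translate g).measurable_spectralCoeff hindep
      (fun n => kronecker_unitary (map_star_mul_conjTranspose (wignerMatrix_mul_conjTranspose n g))
        (by simp)) ?_ hv ?_)
  · simp [wignerMatrix_zero, Matrix.map_one]
  · filter_upwards [hX.spectralCoeff_left_translate g] with ω hω n p
    rw [hω n p.1 p.2]
    simp [Matrix.mulVec, dotProduct, Fintype.sum_prod_type, Matrix.one_apply, wignerMatrix]

lemma identDistrib_right_translate_of_gaussian (hX : IsSquareIntegrableField P X)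
    (hc : IsStochasticallyContinuous P X)
    (hindep : iIndepFun (fun k : WignerIndex => spectralCoeff X k) P) {v : ℕ → NNReal}
    (hv : ∀ k : WignerIndex, k.1 ≠ 0 → ∀ w,
      charFun (P.map (spectralCoeff X k)) w = (Real.exp (-(v k.1 * ‖w‖ ^ 2 / 2)) : ℝ))
    (g : SU2) :
    IdentDistrib (fun ω (p : SU2) => X ω (p * g)) (fun ω (p : SU2) => X ω p) P P := by
  refine identDistrib_of_spectralCoeff (hX.right_translate g) hX (hc.comp (continuous_mul_const _))
    hc (identDistrib_of_unitary (B := fun n => 1 ⊗ₖ wignerMatrix n g)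
      hX.measurable_spectralCoeff (hX.right_translate g).measurable_spectralCoeff hindep
      (fun n => kronecker_unitary (by simp) (wignerMatrix_mul_conjTranspose n g)) ?_ hv ?_)
  · simp [wignerMatrix_zero]
  · filter_upwards [hX.spectralCoeff_right_translate g] with ω hω n p
    rw [hω n p.1 p.2]
    simp [Matrix.mulVec, dotProduct, Fintype.sum_prod_type, Matrix.one_apply, wignerMatrix]

lemma isBiInvariant_of_charFun (hX : IsSquareIntegrableField P X)
    (hc : IsStochasticallyContinuous P X)
    (hindep : iIndepFun (fun k : WignerIndex => spectralCoeff X k) P) {v : ℕ → NNReal}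
    (hv : ∀ k : WignerIndex, k.1 ≠ 0 → ∀ w,
      charFun (P.map (spectralCoeff X k)) w = (Real.exp (-(v k.1 * ‖w‖ ^ 2 / 2)) : ℝ)) :
    IsBiInvariant P X := by
  intro g g'
  have h1 := (identDistrib_left_translate_of_gaussian hX hc hindep hv g).comp
    (u := fun (x : SU2 → ℂ) p => x (p * g')) (measurable_pi_iff.mpr fun p => measurable_pi_apply _)
  have h2 := h1.trans (identDistrib_right_translate_of_gaussian hX hc hindep hv g')
  simpa only [Function.comp_def, mul_assoc] using h2

lemma isBiInvariant_of_gaussian (hX : IsSquareIntegrableField P X)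
    (hc : IsStochasticallyContinuous P X)
    (hindep : iIndepFun (fun k : WignerIndex => spectralCoeff X k) P)
    (hsymm : ∀ k : WignerIndex, IsCentrallySymmetric P (spectralCoeff X k))
    (hg : ∀ k : WignerIndex, k.1 ≠ 0 → IsComplexGaussian P (spectralCoeff X k))
    (hvar : VarianceDependsOnlyOnDegree P X) : IsBiInvariant P X := by
  obtain ⟨V, hV⟩ := hvar
  -- The complex variance is twice that of the real part. In degree `0` it may be infinite, where
  -- `toNNReal` returns `0`, but this value plays no role.
  refine isBiInvariant_of_charFun (v := fun n => (V n / 2).toNNReal) hX hc hindep fun k hk w => ?_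
  obtain ⟨ha, u, hu⟩ := hg k hk
  have hVu : (V k.1 / 2).toNNReal = u := by
    rw [← hV k, complexVariance_of_map_eq ha (hsymm k) hu, ENNReal.add_div, ENNReal.add_halves,
      ENNReal.toNNReal_coe]
  rw [hVu, hu, charFun_circularGaussian]

end Invariance

/-! ### The field without its component of degree `0` -/

lemma degreeComponent_zero {Ω : Type*} (X : Ω → SU2 → ℂ) (ω : Ω) (g : SU2) :
    degreeComponent X 0 ω g = spectralCoeff X ⟨0, 0, 0⟩ ω * ((4 * Real.pi)⁻¹ : ℝ) := by
  simp [degreeComponent, hypersphericalHarmonic_zero]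

section Centered

variable {Ω : Type*} [MeasurableSpace Ω] {P : Measure Ω} {X : Ω → SU2 → ℂ}

lemma IsSquareIntegrableField.sub_degreeComponent_zero
    (hX : IsSquareIntegrableField P X) :
    IsSquareIntegrableField P fun ω g => X ω g - degreeComponent X 0 ω g := by
  simp_rw [degreeComponent_zero]
  refine ⟨hX.1.sub (((hX.measurable_spectralCoeff _).comp measurable_fst).mul_const _), ?_⟩
  filter_upwards [hX.2] with ω hω
  exact hω.sub (memLp_const _)

lemma IsStochasticallyContinuous.sub_degreeComponent_zero (hX : IsStochasticallyContinuous P X) :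
    IsStochasticallyContinuous P fun ω g => X ω g - degreeComponent X 0 ω g := by
  intro g ε hε
  simpa only [degreeComponent_zero, edist_sub_right] using hX g ε hε

/-- The constant harmonic is `(4π)⁻¹` and a constant `c` has degree-`0` coefficient `4π c`, so that
coefficient cancels exactly; constants contribute nothing in the other degrees. -/
lemma spectralCoeff_sub_degreeComponent_zero (hX : IsSquareIntegrableField P X) :
    ∀ᵐ ω ∂P, ∀ k, spectralCoeff (fun ω g => X ω g - degreeComponent X 0 ω g) k ω =
      if k.1 = 0 then 0 else spectralCoeff X k ω := by
  have hpi : (Real.pi : ℂ) ≠ 0 := by exact_mod_cast Real.pi_ne_zero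
  filter_upwards [hX.ae_integrable] with ω hω k
  simp only [spectralCoeff, degreeComponent_zero, sub_mul]
  rw [integral_sub (integrable_mul_star_harmonic hω _ _ _)
    (integrable_mul_star_harmonic (integrable_const _) _ _ _)]
  change _ - fourierCoefficient (fun _ => spectralCoeff X ⟨0, 0, 0⟩ ω * ((4 * Real.pi)⁻¹ : ℝ)) k = _
  split_ifs with hk
  · obtain ⟨n, i, j⟩ := k
    obtain rfl : n = 0 := hk
    rw [fourierCoefficient_const_zero, Subsingleton.elim (α := Fin 1) i 0,
      Subsingleton.elim (α := Fin 1) j 0]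
    change spectralCoeff X ⟨0, 0, 0⟩ ω - _ = 0
    push_cast
    field_simp
    ring
  · rw [fourierCoefficient_const _ hk, sub_zero]

end Centered

lemma isComplexGaussian_zero {Ω : Type*} [MeasurableSpace Ω] {P : Measure Ω}
    [IsProbabilityMeasure P] : IsComplexGaussian P fun _ => 0 := by
  rw [isComplexGaussian_iff]
  refine ⟨aemeasurable_const, 0, fun w => ?_⟩
  simp [Measure.map_const]

lemma IsComplexGaussian.congr {Ω : Type*} [MeasurableSpace Ω] {P : Measure Ω} {a b : Ω → ℂ}
    (ha : IsComplexGaussian P a) (h : a =ᵐ[P] b) : IsComplexGaussian P b :=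
  ⟨ha.1.congr h, by rw [← Measure.map_congr h]; exact ha.2⟩

/-- The coefficients of the reduced field are those of `X` with the one of degree `0` replaced by
`0`. They remain independent, and `0` is Gaussian with zero variance. -/
lemma isComplexGaussianField_sub_degreeComponent_zero_iff {Ω : Type*} [MeasurableSpace Ω]
    {P : Measure Ω} [IsProbabilityMeasure P] {X : Ω → SU2 → ℂ} (hX : IsSquareIntegrableField P X)
    (hindep : iIndepFun (fun k : WignerIndex => spectralCoeff X k) P)
    (hc : IsStochasticallyContinuous P X) :
    IsComplexGaussianField P (fun ω g => X ω g - degreeComponent X 0 ω g) ↔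
      ∀ k : WignerIndex, k.1 ≠ 0 → IsComplexGaussian P (spectralCoeff X k) := by
  have hY := hX.sub_degreeComponent_zero
  have hae := spectralCoeff_sub_degreeComponent_zero hX
  have hk : ∀ k, (fun ω => if k.1 = 0 then 0 else spectralCoeff X k ω) =ᵐ[P]
      spectralCoeff (fun ω g => X ω g - degreeComponent X 0 ω g) k := fun k =>
    hae.mono fun ω hω => (hω k).symm
  constructor
  · intro h k hk0
    refine (h.spectralCoeff hY k).congr ((hk k).symm.trans ?_)
    simp only [if_neg hk0]
    exact ae_eq_refl _
  · intro h
    refine hc.sub_degreeComponent_zero.isComplexGaussianField hY ?_ fun k => ?_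
    · refine iIndepFun.congr hk (hindep.comp (fun k x => if k.1 = 0 then 0 else x) fun k => ?_)
      by_cases h0 : k.1 = 0
      · simp [h0]
      · simpa [h0] using measurable_id'
    · refine IsComplexGaussian.congr ?_ (hk k)
      by_cases h0 : k.1 = 0
      · simpa only [h0, if_true] using isComplexGaussian_zero
      · simpa only [h0, if_false] using h k h0

end

/-! ### The two equivalences. -/

theorem mainTheorem3 {Ω : Type*} [MeasurableSpace Ω] (P : Measure Ω) [IsProbabilityMeasure P]
    (X : Ω → SU2 → ℂ) (hX : IsSquareIntegrableField P X)
    (hindep : iIndepFun (fun k : WignerIndex => spectralCoeff X k) P)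
    (hsymm : ∀ k : WignerIndex, IsCentrallySymmetric P (spectralCoeff X k)) :
    (IsBiInvariant P X ↔
      IsStochasticallyContinuous P X ∧
        IsComplexGaussianField P (fun ω g => X ω g - degreeComponent X 0 ω g) ∧
        VarianceDependsOnlyOnDegree P X) ∧
    ((IsBiInvariant P X ∧ IsComplexGaussian P (spectralCoeff X ⟨0, 0, 0⟩)) ↔
      IsStochasticallyContinuous P X ∧ IsComplexGaussianField P X ∧
        VarianceDependsOnlyOnDegree P X) := by
  refine ⟨⟨fun h => ?_, fun ⟨hc, hG, hvar⟩ => ?_⟩, ⟨fun ⟨h, h0⟩ => ?_, fun ⟨hc, hG, hvar⟩ => ?_⟩⟩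
  · have hc := h.isStochasticallyContinuous hX
    exact ⟨hc, (isComplexGaussianField_sub_degreeComponent_zero_iff hX hindep hc).mpr fun k hk =>
      h.isComplexGaussian_spectralCoeff hX hindep hsymm hk,
      h.varianceDependsOnlyOnDegree hX hindep hsymm⟩
  · exact isBiInvariant_of_gaussian hX hc hindep hsymm
      ((isComplexGaussianField_sub_degreeComponent_zero_iff hX hindep hc).mp hG) hvar
  · have hc := h.isStochasticallyContinuous hX
    refine ⟨hc, hc.isComplexGaussianField hX hindep fun k => ?_,
      h.varianceDependsOnlyOnDegree hX hindep hsymm⟩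
    obtain ⟨n, i, j⟩ := k
    rcases eq_or_ne n 0 with rfl | hn
    · rw [Subsingleton.elim (α := Fin 1) i 0, Subsingleton.elim (α := Fin 1) j 0]
      exact h0
    · exact h.isComplexGaussian_spectralCoeff hX hindep hsymm hn
  · exact ⟨isBiInvariant_of_gaussian hX hc hindep hsymm (fun k _ => hG.spectralCoeff hX k) hvar,
      hG.spectralCoeff hX _⟩
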